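/- **Conventions.** A symmetric 2-group is a symmetric monoidal category $(\mathcal A,+,0)$ in which every morphism is invertible and every object has an inverse up to isomorphism. A 2-ring $\mathcal R$ is a symmetric 2-group with a biadditive multiplication that is associative and unital up to coherent natural isomorphisms additive in each variable. An $\mathcal R$-2-module is a small symmetric 2-group with a biadditive action of $\mathcal R$, associative and unital up to coherent natural isomorphisms additive in each variable. A 1-morphism of $\mathcal R$-2-modules is a symmetric monoidal functor $F$ with natural isomorphisms $F(r\cdot m)\cong r\cdot F(m)$ compatible with the structure; a 2-morphism is a monoidal natural transformation compatible with these isomorphisms. Sums $F+G$ of 1-morphisms are pointwise. These data form the 2-category $(\mathcal R\text{-2-Mod})$. An $\mathcal R$-2-module $\mathcal J$ is injective if, for every 1-morphism $i:\mathcal M\to\mathcal N$ that is a faithful functor and every 1-morphism $f:\mathcal M\to\mathcal J$, there are a 1-morphism $g:\mathcal N\to\mathcal J$ and a 2-morphism $g\circ i\Rightarrow f$. A 2-cochain complex is a sequence of 1-morphisms $\mathcal A_0\xrightarrow{L_0}\mathcal A_1\xrightarrow{L_1}\cdots$ with 2-morphisms $\alpha_n:L_{n+1}\circ L_n\Rightarrow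 0$ such that $L_{n+2}\alpha_n$ (followed by $L_{n+2}\circ 0\cong 0$) equals $\alpha_{n+1}L_n$. A morphism from it to $(\mathcal B_\cdot,M_\cdot,\beta_\cdot)$ consists of 1-morphisms $F_n:\mathcal A_n\to\mathcal B_n$ and 2-morphisms $\lambda_n:F_{n+1}\circ L_n\Rightarrow M_n\circ F_n$ such that the two induced 2-morphisms $F_{n+2}\circ L_{n+1}\circ L_n\Rightarrow 0$, one given by $F_{n+2}\alpha_n$ and the other by $\lambda_{n+1}L_n$, $M_{n+1}\lambda_n$, $\beta_nF_n$, are equal. Two morphisms $(F_\cdot,\lambda_\cdot),(G_\cdot,\mu_\cdot):\mathcal A_\cdot\to\mathcal B_\cdot$ are 2-cochain homotopic if there are 1-morphisms $H_n:\mathcal A_{n+1}\to\mathcal B_n$ ($n\ge 0$, with $M_{-1}\circ H_{-1}=0$) and 2-morphisms $\tau_n:F_n\Rightarrow M_{n-1}\circ H_{n-1}+H_n\circ L_n+G_n$ ($n\ge0$) such that for every $n\ge 0$ the two 2-morphisms $F_{n+1}\circ L_n\Rightarrow M_n\circ H_n\circ L_n+M_n\circ G_n$, one given by $\tau_{n+1}L_n$,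 $H_{n+1}\alpha_n$, $\mu_n$, the other by $\lambda_n$, $M_n\tau_n$ and $\beta_{n-1}H_{n-1}$ (for $n=0$: $M_0\circ 0\cong 0$), are equal. For $\mathcal A\xrightarrow{F}\mathcal B\xrightarrow{G}\mathcal C$ and $\varphi:G\circ F\Rightarrow0$, the relative cokernel $\mathrm{Coker}(\varphi,G)$ has the objects of $\mathcal C$; its morphisms $X\to Y$ are classes of pairs $(B,f:X\to G(B)+Y)$, where $(B,f)\sim(B',f')$ if there are $A\in\mathcal A$ and $a:B\to F(A)+B'$ such that $f$ followed by $G(a)+1$ and the morphism $G(F(A)+B')+Y\to G(B')+Y$ induced by $\varphi_A$ is $f'$. Given in addition $\mathcal C\xrightarrow{H}\mathcal D\xrightarrow{K}\mathcal E$ with $\psi:H\circ G\Rightarrow 0$, $\chi:K\circ H\Rightarrow 0$, successive 2-morphisms being compatible as in a complex, the sequence is relative 2-exact at $\mathcal C$ if the functor $H':\mathrm{Coker}(\varphi,G)\to\mathcal D$ induced by $(H,\psi)$ is faithful and every $g:H(X)\to H(Y)$ with $\chi_Y\circ K(g)=\chi_X$ is the image under $H'$ of some morphism $X\to Y$. An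 injective resolution $(L_\cdot:\mathcal A\to\mathcal I_\cdot,\alpha_\cdot)$ of $\mathcal A$ is a 2-cochain complex $\mathcal A\xrightarrow{L_0}\mathcal I_0\xrightarrow{L_1}\mathcal I_1\xrightarrow{L_2}\cdots$ with all $\mathcal I_n$ injective that, after extension by zeros on the left, is relative 2-exact at $\mathcal A$ and at every $\mathcal I_n$. **Theorem 1.** Let $\mathcal R$ be a 2-ring, $(L_\cdot:\mathcal A\to\mathcal I_\cdot,\alpha_\cdot)$ an injective resolution of an $\mathcal R$-2-module $\mathcal A$, and $F:\mathcal A\to\mathcal B$ a 1-morphism in $(\mathcal R\text{-2-Mod})$. Then for every injective resolution $(M_\cdot:\mathcal B\to\mathcal J_\cdot,\beta_\cdot)$ of $\mathcal B$ there are 1-morphisms $F_n:\mathcal I_n\to\mathcal J_n$ and 2-morphisms $\varepsilon_n:F_n\circ L_n\Rightarrow M_n\circ F_{n-1}$ ($n\ge0$, with $F_{-1}=F$) which form a morphism of 2-cochain complexes from $\mathcal A\to\mathcal I_0\to\mathcal I_1\to\cdots$ to $\mathcal B\to\mathcal J_0\to\mathcal J_1\to\cdots$ over $F$; in particular $F_\cdot:\mathcal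 I_\cdot\to\mathcal J_\cdot$ is a morphism of 2-cochain complexes. For any two such morphisms over $F$, the underlying morphisms $\mathcal I_\cdot\to\mathcal J_\cdot$ are 2-cochain homotopic. -/

import Mathlib

open CategoryTheory MonoidalCategory
open CategoryTheory.Functor.LaxMonoidal (ε μ)
open CategoryTheory.Functor.OplaxMonoidal (η δ)

universe w' w u v₁ u₁ v₂ u₂ v₃ u₃

theorem tensorμ_braiding {C : Type u₁} [Category.{v₁} C] [MonoidalCategory C] [SymmetricCategory C]
    (X₁ X₂ Y₁ Y₂ : C) :
    tensorμ X₁ X₂ Y₁ Y₂ ≫ ((β_ X₁ Y₁).hom ⊗ₘ (β_ X₂ Y₂).hom) =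
      (β_ (X₁ ⊗ X₂) (Y₁ ⊗ Y₂)).hom ≫ tensorμ Y₁ Y₂ X₁ X₂ := by
  simp [tensorμ, SymmetricCategory.braiding_swap_eq_inv_braiding Y₂ X₁,
    MonoidalCategory.tensorHom_def]

/-- A symmetric monoidal category (its tensor product is written `⊗` and plays the role of the
addition `+`; its unit object `𝟙_ C` plays the role of `0`) is a *symmetric 2-group* if every
morphism is invertible and every object has an inverse up to isomorphism. -/
class IsTwoGroup (C : Type u₁) [Category.{v₁} C] [MonoidalCategory C] : Prop where
  isGroupoid : IsGroupoid C
  exists_neg : ∀ X : C, ∃ Y : C, Nonempty (X ⊗ Y ≅ 𝟙_ C)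

section Biadditive

variable {A : Type u₁} [Category.{v₁} A] [MonoidalCategory A] [BraidedCategory A]
  {B : Type u₂} [Category.{v₂} B] [MonoidalCategory B] [BraidedCategory B]
  {C : Type u₃} [Category.{v₃} C] [MonoidalCategory C] [BraidedCategory C]

/-- The value `a · b` of a bifunctor. -/
abbrev bi (T : A ⥤ B ⥤ C) (a : A) (b : B) : C := (T.obj a).obj b

/-- The value `f · g` of a bifunctor on morphisms. -/
abbrev biMap (T : A ⥤ B ⥤ C) {a a' : A} {b b' : B} (f : a ⟶ a') (g : b ⟶ b') :
    bi T a b ⟶ bi T a' b' :=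
  (T.map f).app b ≫ (T.obj a').map g

/-- The distributor `a · b + a · b' ⟶ a · (b + b')`. -/
abbrev addR (T : A ⥤ B ⥤ C) [∀ a, (T.obj a).Braided] (a : A) (b b' : B) :
    bi T a b ⊗ bi T a b' ⟶ bi T a (b ⊗ b') :=
  μ (T.obj a) b b'

/-- The distributor `a · b + a' · b ⟶ (a + a') · b`. -/
abbrev addL (T : A ⥤ B ⥤ C) [∀ b, (T.flip.obj b).Braided] (a a' : A) (b : B) :
    bi T a b ⊗ bi T a' b ⟶ bi T (a ⊗ a') b :=
  μ (T.flip.obj b) a a'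

/-- A bifunctor `·` that is additive in each variable: every `a · -` and every `- · b` is a
symmetric monoidal functor, the distributors are natural in all the variables, and the two ways of
expanding `(a + a') · (b + b')` agree.  The isomorphism `0 ⟶ a · 0` is `ε (T.obj a)`; it is natural
and additive in `a`. -/
class Biadditive (T : A ⥤ B ⥤ C) where
  [braidedRight : ∀ a, (T.obj a).Braided]
  [braidedLeft : ∀ b, (T.flip.obj b).Braided]
  isMonoidal_map : ∀ {a a' : A} (f : a ⟶ a'), NatTrans.IsMonoidal (T.map f)
  isMonoidal_flip_map : ∀ {b b' : B} (g : b ⟶ b'), NatTrans.IsMonoidal (T.flip.map g)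
  interchange : ∀ (a a' : A) (b b' : B),
    tensorμ (bi T a b) (bi T a b') (bi T a' b) (bi T a' b') ≫
        (addL T a a' b ⊗ₘ addL T a a' b') ≫ addR T (a ⊗ a') b b' =
      (addR T a b b' ⊗ₘ addR T a' b b') ≫ addL T a a' (b ⊗ b')
  zero_add : ∀ a a' : A,
    (ε (T.obj a) ⊗ₘ ε (T.obj a')) ≫ addL T a a' (𝟙_ B) = (λ_ (𝟙_ C)).hom ≫ ε (T.obj (a ⊗ a'))

attribute [reducible, instance] Biadditive.braidedRight Biadditive.braidedLeft

end Biadditive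

/-- A *2-ring* (categorical ring): a symmetric 2-group with a biadditive multiplication, which is
associative and unital up to coherent natural isomorphisms that are additive in every variable. -/
class TwoRing (R : Type w) [Category.{w'} R] [MonoidalCategory R] [SymmetricCategory R]
    [IsTwoGroup R] where
  mul : R ⥤ R ⥤ R
  [biadditive : Biadditive mul]
  one : R
  assoc : ∀ r s t : R, bi mul (bi mul r s) t ≅ bi mul r (bi mul s t)
  oneMul : ∀ r : R, bi mul one r ≅ r
  mulOne : ∀ r : R, bi mul r one ≅ r
  assoc_naturality : ∀ {r r' s s' t t' : R} (f : r ⟶ r') (g : s ⟶ s') (h : t ⟶ t'),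
    biMap mul (biMap mul f g) h ≫ (assoc r' s' t').hom =
      (assoc r s t).hom ≫ biMap mul f (biMap mul g h)
  oneMul_naturality : ∀ {r r' : R} (f : r ⟶ r'),
    (mul.obj one).map f ≫ (oneMul r').hom = (oneMul r).hom ≫ f
  mulOne_naturality : ∀ {r r' : R} (f : r ⟶ r'),
    (mul.map f).app one ≫ (mulOne r').hom = (mulOne r).hom ≫ f
  pentagon : ∀ r s t q : R,
    (mul.map (assoc r s t).hom).app q ≫ (assoc r (bi mul s t) q).hom ≫
        (mul.obj r).map (assoc s t q).hom =
      (assoc (bi mul r s) t q).hom ≫ (assoc r s (bi mul t q)).hom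
  triangle : ∀ r s : R,
    (assoc r one s).hom ≫ (mul.obj r).map (oneMul s).hom = (mul.map (mulOne r).hom).app s
  assoc_add₁ : ∀ r r' s t : R,
    addL mul (bi mul r s) (bi mul r' s) t ≫ (mul.map (addL mul r r' s)).app t ≫
        (assoc (r ⊗ r') s t).hom =
      ((assoc r s t).hom ⊗ₘ (assoc r' s t).hom) ≫ addL mul r r' (bi mul s t)
  assoc_add₂ : ∀ r s s' t : R,
    addL mul (bi mul r s) (bi mul r s') t ≫ (mul.map (addR mul r s s')).app t ≫
        (assoc r (s ⊗ s') t).hom =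
      ((assoc r s t).hom ⊗ₘ (assoc r s' t).hom) ≫ addR mul r (bi mul s t) (bi mul s' t) ≫
        (mul.obj r).map (addL mul s s' t)
  assoc_add₃ : ∀ r s t t' : R,
    addR mul (bi mul r s) t t' ≫ (assoc r s (t ⊗ t')).hom =
      ((assoc r s t).hom ⊗ₘ (assoc r s t').hom) ≫ addR mul r (bi mul s t) (bi mul s t') ≫
        (mul.obj r).map (addR mul s t t')
  oneMul_add : ∀ r s : R,
    addR mul one r s ≫ (oneMul (r ⊗ s)).hom = ((oneMul r).hom ⊗ₘ (oneMul s).hom)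
  mulOne_add : ∀ r s : R,
    addL mul r s one ≫ (mulOne (r ⊗ s)).hom = ((mulOne r).hom ⊗ₘ (mulOne s).hom)

attribute [reducible, instance] TwoRing.biadditive

section Modules

variable (R : Type w) [Category.{w'} R] [MonoidalCategory R] [SymmetricCategory R]
  [IsTwoGroup R] [TwoRing R]

/-- An *`R`-2-module*: a (small) symmetric 2-group with a biadditive action of the 2-ring `R`,
associative and unital up to coherent natural isomorphisms that are additive in every variable. -/
structure TwoModule where
  carrier : Type u
  [category : Category.{u} carrier]
  [monoidal : MonoidalCategory carrier]
  [symmetric : SymmetricCategory carrier]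
  [isTwoGroup : IsTwoGroup carrier]
  smul : R ⥤ carrier ⥤ carrier
  [biadditive : Biadditive smul]
  assoc : ∀ (r s : R) (m : carrier), bi smul (bi TwoRing.mul r s) m ≅ bi smul r (bi smul s m)
  oneSmul : ∀ m : carrier, bi smul TwoRing.one m ≅ m
  assoc_naturality : ∀ {r r' s s' : R} {m m' : carrier} (f : r ⟶ r') (g : s ⟶ s') (h : m ⟶ m'),
    biMap smul (biMap TwoRing.mul f g) h ≫ (assoc r' s' m').hom =
      (assoc r s m).hom ≫ biMap smul f (biMap smul g h)
  oneSmul_naturality : ∀ {m m' : carrier} (h : m ⟶ m'),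
    (smul.obj TwoRing.one).map h ≫ (oneSmul m').hom = (oneSmul m).hom ≫ h
  pentagon : ∀ (r s t : R) (m : carrier),
    (smul.map (TwoRing.assoc r s t).hom).app m ≫ (assoc r (bi TwoRing.mul s t) m).hom ≫
        (smul.obj r).map (assoc s t m).hom =
      (assoc (bi TwoRing.mul r s) t m).hom ≫ (assoc r s (bi smul t m)).hom
  triangle : ∀ (r : R) (m : carrier),
    (assoc r TwoRing.one m).hom ≫ (smul.obj r).map (oneSmul m).hom =
      (smul.map (TwoRing.mulOne r).hom).app m
  assoc_add₁ : ∀ (r r' s : R) (m : carrier),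
    addL smul (bi TwoRing.mul r s) (bi TwoRing.mul r' s) m ≫
        (smul.map (addL TwoRing.mul r r' s)).app m ≫ (assoc (r ⊗ r') s m).hom =
      ((assoc r s m).hom ⊗ₘ (assoc r' s m).hom) ≫ addL smul r r' (bi smul s m)
  assoc_add₂ : ∀ (r s s' : R) (m : carrier),
    addL smul (bi TwoRing.mul r s) (bi TwoRing.mul r s') m ≫
        (smul.map (addR TwoRing.mul r s s')).app m ≫ (assoc r (s ⊗ s') m).hom =
      ((assoc r s m).hom ⊗ₘ (assoc r s' m).hom) ≫ addR smul r (bi smul s m) (bi smul s' m) ≫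
        (smul.obj r).map (addL smul s s' m)
  assoc_add₃ : ∀ (r s : R) (m m' : carrier),
    addR smul (bi TwoRing.mul r s) m m' ≫ (assoc r s (m ⊗ m')).hom =
      ((assoc r s m).hom ⊗ₘ (assoc r s m').hom) ≫ addR smul r (bi smul s m) (bi smul s m') ≫
        (smul.obj r).map (addR smul s m m')
  assoc_zero : ∀ r s : R,
    ε (smul.obj (bi TwoRing.mul r s)) ≫ (assoc r s (𝟙_ carrier)).hom =
      ε (smul.obj r) ≫ (smul.obj r).map (ε (smul.obj s))
  oneSmul_add : ∀ m m' : carrier,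
    addR smul TwoRing.one m m' ≫ (oneSmul (m ⊗ m')).hom = ((oneSmul m).hom ⊗ₘ (oneSmul m').hom)
  oneSmul_zero : ε (smul.obj TwoRing.one) ≫ (oneSmul (𝟙_ carrier)).hom = 𝟙 (𝟙_ carrier)

attribute [instance] TwoModule.category TwoModule.monoidal TwoModule.symmetric
  TwoModule.isTwoGroup TwoModule.biadditive

end Modules

section Morphisms

variable {R : Type w} [Category.{w'} R] [MonoidalCategory R] [SymmetricCategory R]
  [IsTwoGroup R] [TwoRing R]

/-- A 1-morphism of `R`-2-modules (`R`-homomorphism): a symmetric monoidal functor `F` with natural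
isomorphisms `F (r · m) ≅ r · F m` compatible with all the structure. -/
structure Mor₁ (M N : TwoModule.{w', w, u} R) where
  functor : M.carrier ⥤ N.carrier
  [braided : functor.Braided]
  lin : ∀ (r : R) (m : M.carrier), functor.obj (bi M.smul r m) ≅ bi N.smul r (functor.obj m)
  lin_naturality : ∀ {r r' : R} {m m' : M.carrier} (f : r ⟶ r') (h : m ⟶ m'),
    functor.map (biMap M.smul f h) ≫ (lin r' m').hom =
      (lin r m).hom ≫ biMap N.smul f (functor.map h)
  lin_add : ∀ (r : R) (m m' : M.carrier),
    μ functor (bi M.smul r m) (bi M.smul r m') ≫ functor.map (addR M.smul r m m') ≫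
        (lin r (m ⊗ m')).hom =
      ((lin r m).hom ⊗ₘ (lin r m').hom) ≫ addR N.smul r (functor.obj m) (functor.obj m') ≫
        (N.smul.obj r).map (μ functor m m')
  add_lin : ∀ (r s : R) (m : M.carrier),
    μ functor (bi M.smul r m) (bi M.smul s m) ≫ functor.map (addL M.smul r s m) ≫
        (lin (r ⊗ s) m).hom =
      ((lin r m).hom ⊗ₘ (lin s m).hom) ≫ addL N.smul r s (functor.obj m)
  lin_zero : ∀ r : R,
    ε functor ≫ functor.map (ε (M.smul.obj r)) ≫ (lin r (𝟙_ M.carrier)).hom =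
      ε (N.smul.obj r) ≫ (N.smul.obj r).map (ε functor)
  lin_assoc : ∀ (r s : R) (m : M.carrier),
    functor.map (M.assoc r s m).hom ≫ (lin r (bi M.smul s m)).hom ≫
        (N.smul.obj r).map (lin s m).hom =
      (lin (bi TwoRing.mul r s) m).hom ≫ (N.assoc r s (functor.obj m)).hom
  lin_one : ∀ m : M.carrier,
    (lin TwoRing.one m).hom ≫ (N.oneSmul (functor.obj m)).hom = functor.map (M.oneSmul m).hom

attribute [instance] Mor₁.braided

/-- A 2-morphism of `R`-2-modules: a monoidal natural transformation compatible with the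
isomorphisms `F (r · m) ≅ r · F m`.  (It is invertible, all the categories being groupoids.) -/
structure Mor₂ {M N : TwoModule.{w', w, u} R} (F G : Mor₁ M N) where
  nat : F.functor ⟶ G.functor
  isMonoidal : NatTrans.IsMonoidal nat
  lin : ∀ (r : R) (m : M.carrier),
    (F.lin r m).hom ≫ (N.smul.obj r).map (nat.app m) = nat.app (bi M.smul r m) ≫ (G.lin r m).hom

namespace Mor₁

variable {M N P : TwoModule.{w', w, u} R}

/-- The composite "first `F`, then `G`". -/
def comp (F : Mor₁ M N) (G : Mor₁ N P) : Mor₁ M P where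
  functor := F.functor ⋙ G.functor
  lin r m := G.functor.mapIso (F.lin r m) ≪≫ G.lin r (F.functor.obj m)
  lin_naturality f h := by
    have h1 := G.lin_naturality f (F.functor.map h)
    have h2 := F.lin_naturality f h
    simp only [Functor.comp_map, Iso.trans_hom, Functor.mapIso_hom, ← Functor.map_comp_assoc,
      h2, Category.assoc]
    simp only [Functor.map_comp, Category.assoc, Functor.comp_obj] at h1 ⊢
    rw [h1]
  lin_add r m m' := by
    have h1 := G.lin_add r (F.functor.obj m) (F.functor.obj m')
    have h2 := congrArg G.functor.map (F.lin_add r m m')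
    have h3 := G.lin_naturality (𝟙 r) (μ F.functor m m')
    simp only [biMap, Functor.map_comp, CategoryTheory.Functor.map_id, NatTrans.id_app,
      Category.id_comp] at h1 h2 h3
    simp only [Functor.comp_map, Iso.trans_hom, Functor.mapIso_hom, Functor.LaxMonoidal.comp_μ, Category.assoc,
      Functor.comp_obj, ← tensorHom_comp_tensorHom, Functor.map_comp]
    rw [reassoc_of% h2, h3, ← reassoc_of% h1, Functor.LaxMonoidal.μ_natural_assoc]
  add_lin r s m := by
    have h1 := G.add_lin r s (F.functor.obj m)
    have h2 := congrArg G.functor.map (F.add_lin r s m)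
    simp only [Functor.map_comp] at h1 h2
    simp only [Functor.comp_map, Iso.trans_hom, Functor.mapIso_hom, Functor.LaxMonoidal.comp_μ, Category.assoc,
      Functor.comp_obj, ← tensorHom_comp_tensorHom]
    rw [reassoc_of% h2, ← h1, Functor.LaxMonoidal.μ_natural_assoc]
  lin_zero r := by
    have h1 := G.lin_zero r
    have h2 := congrArg G.functor.map (F.lin_zero r)
    have h3 := G.lin_naturality (𝟙 r) (ε F.functor)
    simp only [biMap, Functor.map_comp, CategoryTheory.Functor.map_id, NatTrans.id_app,
      Category.id_comp] at h2 h3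
    simp only [Functor.comp_map, Iso.trans_hom, Functor.mapIso_hom, Functor.LaxMonoidal.comp_ε,
      Category.assoc, Functor.map_comp]
    rw [reassoc_of% h2, h3, reassoc_of% h1]
  lin_assoc r s m := by
    have h1 := G.lin_assoc r s (F.functor.obj m)
    have h2 := congrArg G.functor.map (F.lin_assoc r s m)
    have h3 := G.lin_naturality (𝟙 r) (F.lin s m).hom
    simp only [biMap, Functor.map_comp, CategoryTheory.Functor.map_id, NatTrans.id_app,
      Category.id_comp] at h1 h2 h3
    simp only [Functor.comp_map, Iso.trans_hom, Functor.mapIso_hom, Category.assoc,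
      Functor.comp_obj, Functor.map_comp]
    rw [← reassoc_of% h3, reassoc_of% h2, h1]
  lin_one m := by
    have h1 := G.lin_one (F.functor.obj m)
    have h2 := congrArg G.functor.map (F.lin_one m)
    simp only [Functor.map_comp] at h2
    simp only [Functor.comp_map, Iso.trans_hom, Functor.mapIso_hom, Category.assoc,
      Functor.comp_obj]
    rw [h1, h2]

/-- The constant functor at the unit object is symmetric monoidal. -/
@[reducible] def constBraided (A : Type u₁) [Category.{v₁} A] [MonoidalCategory A]
    [BraidedCategory A] (B : Type u₂) [Category.{v₂} B] [MonoidalCategory B] [BraidedCategory B] :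
    ((Functor.const A).obj (𝟙_ B)).Braided where
  ε := 𝟙 _
  μ _ _ := (λ_ (𝟙_ B)).hom
  η := 𝟙 _
  δ _ _ := (λ_ (𝟙_ B)).inv
  μ_natural_left := by simp
  μ_natural_right := by simp
  associativity := by simp [unitors_equal]
  left_unitality := by simp
  right_unitality := by simp [unitors_equal]
  δ_natural_left := by simp
  δ_natural_right := by simp
  oplax_associativity := by simp [unitors_inv_equal]
  oplax_left_unitality := by simp
  oplax_right_unitality := by simp [unitors_inv_equal]
  ε_η := by simp
  η_ε := by simp
  μ_δ := by simp
  δ_μ := by simp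
  braided _ _ := by
    change _ ≫ 𝟙 _ = (β_ (𝟙_ B) (𝟙_ B)).hom ≫ (λ_ (𝟙_ B)).hom
    rw [Category.comp_id, braiding_leftUnitor, unitors_equal]

/-- The zero 1-morphism. -/
def zero (M N : TwoModule.{w', w, u} R) : Mor₁ M N where
  functor := (Functor.const M.carrier).obj (𝟙_ N.carrier)
  braided := constBraided _ _
  lin r _ := Functor.Monoidal.εIso (N.smul.obj r)
  lin_naturality f h := by
    have := (Biadditive.isMonoidal_map (T := N.smul) f).unit
    simp [biMap, this]
  lin_add r m m' := by
    have := Functor.LaxMonoidal.left_unitality (N.smul.obj r) (𝟙_ _)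
    change (λ_ _).hom ≫ 𝟙 _ ≫ ε _ = (ε _ ⊗ₘ ε _) ≫ μ _ _ _ ≫ (N.smul.obj r).map (λ_ _).hom
    rw [MonoidalCategory.tensorHom_def', Category.assoc, ← this]
    simp
  add_lin r s m := by
    have := Biadditive.zero_add (T := N.smul) r s
    change (λ_ _).hom ≫ 𝟙 _ ≫ ε _ = (ε _ ⊗ₘ ε _) ≫ _
    simp [this]
  lin_zero r := by
    change 𝟙 _ ≫ 𝟙 _ ≫ ε _ = ε _ ≫ (N.smul.obj r).map (𝟙 _)
    simp
  lin_assoc r s m := by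
    simp [N.assoc_zero r s]
  lin_one m := by
    simp [N.oneSmul_zero]

/-- The pointwise sum of two symmetric monoidal functors. -/
abbrev sumFunctor (F G : Mor₁ M N) : M.carrier ⥤ N.carrier :=
  Functor.prod' F.functor G.functor ⋙ tensor N.carrier

theorem sumFunctor_μ (F G : Mor₁ M N) (m m' : M.carrier) :
    μ (sumFunctor F G) m m' =
      tensorμ (F.functor.obj m) (G.functor.obj m) (F.functor.obj m') (G.functor.obj m') ≫
        (μ F.functor m m' ⊗ₘ μ G.functor m m') := by
  simp [sumFunctor, Functor.prod'_μ_fst]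

theorem sumFunctor_ε (F G : Mor₁ M N) :
    ε (sumFunctor F G) = (λ_ (𝟙_ N.carrier)).inv ≫ (ε F.functor ⊗ₘ ε G.functor) := by
  simp [sumFunctor]

instance (F G : Mor₁ M N) : (sumFunctor F G).Braided where
  braided m m' := by
    rw [sumFunctor_μ, sumFunctor_μ]
    change _ ≫ (F.functor.map _ ⊗ₘ G.functor.map _) =
      (β_ (F.functor.obj m ⊗ G.functor.obj m) (F.functor.obj m' ⊗ G.functor.obj m')).hom ≫ _
    rw [← reassoc_of% tensorμ_braiding, Category.assoc,
      tensorHom_comp_tensorHom, Functor.LaxBraided.braided,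
      Functor.LaxBraided.braided, tensorHom_comp_tensorHom]

/-- The pointwise sum `F + G` of two 1-morphisms. -/
def sum (F G : Mor₁ M N) : Mor₁ M N where
  functor := sumFunctor F G
  lin r m := (F.lin r m ⊗ᵢ G.lin r m) ≪≫
    Functor.Monoidal.μIso (N.smul.obj r) (F.functor.obj m) (G.functor.obj m)
  lin_naturality {r r' m m'} f h := by
    have h0 := (Biadditive.isMonoidal_map (T := N.smul) f).tensor
      (F.functor.obj m) (G.functor.obj m)
    have h1 := F.lin_naturality f h
    have h2 := G.lin_naturality f h
    change (F.functor.map _ ⊗ₘ G.functor.map _) ≫ ((F.lin r' m').hom ⊗ₘ (G.lin r' m').hom) ≫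
      μ (N.smul.obj r') _ _ = (((F.lin r m).hom ⊗ₘ (G.lin r m).hom) ≫ μ (N.smul.obj r) _ _) ≫
      (N.smul.map f).app _ ≫ (N.smul.obj r').map (F.functor.map h ⊗ₘ G.functor.map h)
    rw [Category.assoc, reassoc_of% h0, ← Functor.LaxMonoidal.μ_natural,
      tensorHom_comp_tensorHom_assoc, tensorHom_comp_tensorHom_assoc,
      tensorHom_comp_tensorHom_assoc, h1, h2, Category.assoc, Category.assoc]
  lin_add r m m' := by
    have h1 := F.lin_add r m m'
    have h2 := G.lin_add r m m'
    have h3 := tensorμ_comp_μ_tensorHom_μ_comp_μ (N.smul.obj r) (F.functor.obj m)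
      (G.functor.obj m) (F.functor.obj m') (G.functor.obj m')
    change μ (sumFunctor F G) _ _ ≫ (F.functor.map _ ⊗ₘ G.functor.map _) ≫
        ((F.lin r (m ⊗ m')).hom ⊗ₘ (G.lin r (m ⊗ m')).hom) ≫ μ (N.smul.obj r) _ _ =
      (((F.lin r m).hom ⊗ₘ (G.lin r m).hom) ≫ μ (N.smul.obj r) _ _ ⊗ₘ
        ((F.lin r m').hom ⊗ₘ (G.lin r m').hom) ≫ μ (N.smul.obj r) _ _) ≫
      μ (N.smul.obj r) _ _ ≫ (N.smul.obj r).map (μ (sumFunctor F G) _ _)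
    rw [sumFunctor_μ, sumFunctor_μ]
    rw [Category.assoc, tensorHom_comp_tensorHom_assoc, tensorHom_comp_tensorHom_assoc,
      Category.assoc, Category.assoc, h1, h2]
    simp only [← tensorHom_comp_tensorHom, Category.assoc, Functor.map_comp]
    rw [Functor.LaxMonoidal.μ_natural, ← reassoc_of% h3, reassoc_of% tensorμ_natural]
  add_lin r s m := by
    have h1 := F.add_lin r s m
    have h2 := G.add_lin r s m
    have h3 := Biadditive.interchange (T := N.smul) r s (F.functor.obj m) (G.functor.obj m)
    change μ (sumFunctor F G) _ _ ≫ (F.functor.map _ ⊗ₘ G.functor.map _) ≫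
        ((F.lin (r ⊗ s) m).hom ⊗ₘ (G.lin (r ⊗ s) m).hom) ≫ μ (N.smul.obj (r ⊗ s)) _ _ =
      (((F.lin r m).hom ⊗ₘ (G.lin r m).hom) ≫ μ (N.smul.obj r) _ _ ⊗ₘ
        ((F.lin s m).hom ⊗ₘ (G.lin s m).hom) ≫ μ (N.smul.obj s) _ _) ≫ addL N.smul r s _
    rw [sumFunctor_μ]
    rw [Category.assoc, tensorHom_comp_tensorHom_assoc, tensorHom_comp_tensorHom_assoc,
      Category.assoc, Category.assoc, h1, h2]
    simp only [← tensorHom_comp_tensorHom, Category.assoc]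
    rw [← h3, reassoc_of% tensorμ_natural]
  lin_zero r := by
    have h1 := F.lin_zero r
    have h2 := G.lin_zero r
    have h3 := Functor.LaxMonoidal.left_unitality (N.smul.obj r) (𝟙_ N.carrier)
    rw [sumFunctor_ε]
    change ((λ_ _).inv ≫ (ε F.functor ⊗ₘ ε G.functor)) ≫ (F.functor.map _ ⊗ₘ G.functor.map _) ≫
        ((F.lin r _).hom ⊗ₘ (G.lin r _).hom) ≫ μ (N.smul.obj r) _ _ =
      ε (N.smul.obj r) ≫ (N.smul.obj r).map ((λ_ _).inv ≫ (ε F.functor ⊗ₘ ε G.functor))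
    rw [Category.assoc, tensorHom_comp_tensorHom_assoc, tensorHom_comp_tensorHom_assoc,
      Category.assoc, Category.assoc, h1, h2, ← tensorHom_comp_tensorHom, Category.assoc,
      Functor.LaxMonoidal.μ_natural, Functor.map_comp, ← Category.assoc, ← Category.assoc,
      ← Category.assoc]
    congr 1
    rw [Category.assoc, Iso.inv_comp_eq, MonoidalCategory.tensorHom_def', Category.assoc,
      ← cancel_mono ((N.smul.obj r).map (λ_ (𝟙_ N.carrier)).hom)]
    simp only [Category.assoc, ← h3]
    simp [← Functor.map_comp]
  lin_assoc r s m := by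
    have h1 := F.lin_assoc r s m
    have h2 := G.lin_assoc r s m
    have h3 := N.assoc_add₃ r s (F.functor.obj m) (G.functor.obj m)
    change (F.functor.map _ ⊗ₘ G.functor.map _) ≫
        (((F.lin r _).hom ⊗ₘ (G.lin r _).hom) ≫ μ (N.smul.obj r) _ _) ≫
        (N.smul.obj r).map (((F.lin s m).hom ⊗ₘ (G.lin s m).hom) ≫ μ (N.smul.obj s) _ _) =
      (((F.lin _ m).hom ⊗ₘ (G.lin _ m).hom) ≫ μ (N.smul.obj _) _ _) ≫ (N.assoc r s _).hom
    rw [Category.assoc, Category.assoc, h3, Functor.map_comp,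
      ← Functor.LaxMonoidal.μ_natural_assoc,
      tensorHom_comp_tensorHom_assoc, tensorHom_comp_tensorHom_assoc,
      tensorHom_comp_tensorHom_assoc, Category.assoc, Category.assoc, h1, h2]
  lin_one m := by
    have h1 := F.lin_one m
    have h2 := G.lin_one m
    have h3 := N.oneSmul_add (F.functor.obj m) (G.functor.obj m)
    change (((F.lin _ m).hom ⊗ₘ (G.lin _ m).hom) ≫ μ (N.smul.obj TwoRing.one) _ _) ≫
      (N.oneSmul _).hom = (F.functor.map _ ⊗ₘ G.functor.map _)
    rw [Category.assoc, h3, tensorHom_comp_tensorHom, h1, h2]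

end Mor₁

/-- The component `G (F m) ⟶ 0` of a 2-morphism `G ∘ F ⇒ 0`. -/
def Mor₂.toZero {M N P : TwoModule.{w', w, u} R} {F : Mor₁ M N} {G : Mor₁ N P}
    (φ : Mor₂ (F.comp G) (Mor₁.zero M P)) (m : M.carrier) :
    G.functor.obj (F.functor.obj m) ⟶ 𝟙_ P.carrier :=
  φ.nat.app m

/-- The component `G (F m) ⟶ K (H m)` of a 2-morphism `G ∘ F ⇒ K ∘ H`. -/
def Mor₂.square {M N N' P : TwoModule.{w', w, u} R} {F : Mor₁ M N} {G : Mor₁ N P}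
    {H : Mor₁ M N'} {K : Mor₁ N' P} (φ : Mor₂ (F.comp G) (H.comp K)) (m : M.carrier) :
    G.functor.obj (F.functor.obj m) ⟶ K.functor.obj (H.functor.obj m) :=
  φ.nat.app m

/-- Compatibility of `φ : G ∘ F ⇒ 0` with `ψ : H ∘ G ⇒ 0`: the two 2-morphisms
`H ∘ G ∘ F ⇒ 0`, namely `H φ` followed by `H ∘ 0 ≅ 0`, and `ψ F`, are equal. -/
def Mor₂.Compat {A B C D : TwoModule.{w', w, u} R} {F : Mor₁ A B} {G : Mor₁ B C} {H : Mor₁ C D}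
    (φ : Mor₂ (F.comp G) (Mor₁.zero A C)) (ψ : Mor₂ (G.comp H) (Mor₁.zero B D)) : Prop :=
  ∀ a : A.carrier,
    H.functor.map (φ.toZero a) ≫ η H.functor = ψ.toZero (F.functor.obj a)

/-- The canonical 2-morphism `G ∘ 0 ⇒ 0`. -/
def Mor₂.zeroComp (M : TwoModule.{w', w, u} R) {N P : TwoModule.{w', w, u} R} (G : Mor₁ N P) :
    Mor₂ ((Mor₁.zero M N).comp G) (Mor₁.zero M P) where
  nat :=
    { app := fun _ => η G.functor
      naturality := fun _ _ _ => by
        change G.functor.map (𝟙 _) ≫ η G.functor = η G.functor ≫ 𝟙 _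
        simp }
  isMonoidal :=
    { unit := by
        change (ε G.functor ≫ G.functor.map (𝟙 _)) ≫ η G.functor = 𝟙 _
        simp
      tensor := fun X Y => by
        have h := Functor.LaxMonoidal.left_unitality G.functor (𝟙_ N.carrier)
        change (μ G.functor _ _ ≫ G.functor.map (λ_ _).hom) ≫ η G.functor =
          (η G.functor ⊗ₘ η G.functor) ≫ (λ_ _).hom
        rw [← cancel_epi (ε G.functor ▷ G.functor.obj (𝟙_ N.carrier)), Category.assoc,
          ← reassoc_of% h, MonoidalCategory.tensorHom_def]
        simp [← comp_whiskerRight_assoc] }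
  lin r m := by
    have h := G.lin_zero r
    change (G.functor.map (ε _) ≫ (G.lin r _).hom) ≫ (P.smul.obj r).map (η G.functor) =
      η G.functor ≫ ε (P.smul.obj r)
    rw [← cancel_epi (ε G.functor), Category.assoc, reassoc_of% h]
    simp [← Functor.map_comp]

/-! ### Relative cokernels and relative exactness -/

section RelativeExact

variable {A B C D E : TwoModule.{w', w, u} R}

/-- Representatives `(b, f : x ⟶ G b + y)` of the morphisms `x ⟶ y` of the relative cokernel of
`(F, φ, G)`. -/
def CokerPre (G : Mor₁ B C) (x y : C.carrier) : Type u :=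
  Σ b : B.carrier, x ⟶ G.functor.obj b ⊗ y

/-- The morphism `G (F a + b) ≅ G (F a) + G b ⟶ 0 + G b ≅ G b`. -/
def cokerCollapse {F : Mor₁ A B} {G : Mor₁ B C} (φ : Mor₂ (F.comp G) (Mor₁.zero A C))
    (a : A.carrier) (b : B.carrier) :
    G.functor.obj (F.functor.obj a ⊗ b) ⟶ G.functor.obj b :=
  δ G.functor (F.functor.obj a) b ≫ φ.toZero a ▷ G.functor.obj b ≫ (λ_ (G.functor.obj b)).hom

/-- `(b, f)` and `(b', f')` are identified in the relative cokernel when there are `a` and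
`k : b ⟶ F a + b'` such that `x ⟶ G b + y ⟶ G (F a + b') + y ⟶ G b' + y` is `f'`. -/
def CokerRel {F : Mor₁ A B} {G : Mor₁ B C} (φ : Mor₂ (F.comp G) (Mor₁.zero A C))
    (x y : C.carrier) (p q : CokerPre G x y) : Prop :=
  ∃ (a : A.carrier) (k : p.1 ⟶ F.functor.obj a ⊗ q.1),
    p.2 ≫ G.functor.map k ▷ y ≫ cokerCollapse φ a q.1 ▷ y = q.2

/-- Morphisms `x ⟶ y` of the relative cokernel `Coker (φ, G)` of `A ⟶ B ⟶ C`, whose objects are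
those of `C`. -/
def CokerHom {F : Mor₁ A B} {G : Mor₁ B C} (φ : Mor₂ (F.comp G) (Mor₁.zero A C))
    (x y : C.carrier) : Type u :=
  Quot (CokerRel φ x y)

/-- The action on representatives of the functor `H' : Coker (φ, G) ⥤ D` induced by `(H, ψ)`:
`H x ⟶ H (G b + y) ≅ H (G b) + H y ⟶ 0 + H y ≅ H y`. -/
def cokerPreMap {G : Mor₁ B C} {H : Mor₁ C D} (ψ : Mor₂ (G.comp H) (Mor₁.zero B D))
    (x y : C.carrier) (p : CokerPre G x y) : H.functor.obj x ⟶ H.functor.obj y :=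
  H.functor.map p.2 ≫ cokerCollapse ψ p.1 y

theorem toZero_naturality {F : Mor₁ A B} {G : Mor₁ B C} (φ : Mor₂ (F.comp G) (Mor₁.zero A C))
    {a a' : A.carrier} (f : a ⟶ a') :
    G.functor.map (F.functor.map f) ≫ φ.toZero a' = φ.toZero a := by
  have h := φ.nat.naturality f
  refine h.trans ?_
  exact Category.comp_id _

theorem toZero_tensor {F : Mor₁ A B} {G : Mor₁ B C} (φ : Mor₂ (F.comp G) (Mor₁.zero A C))
    (a a' : A.carrier) :
    (μ G.functor _ _ ≫ G.functor.map (μ F.functor a a')) ≫ φ.toZero (a ⊗ a') =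
      (φ.toZero a ⊗ₘ φ.toZero a') ≫ (λ_ (𝟙_ C.carrier)).hom :=
  φ.isMonoidal.tensor a a'

theorem cokerPreMap_eq {F : Mor₁ A B} {G : Mor₁ B C} {H : Mor₁ C D}
    {φ : Mor₂ (F.comp G) (Mor₁.zero A C)} {ψ : Mor₂ (G.comp H) (Mor₁.zero B D)}
    (h : φ.Compat ψ) (x y : C.carrier) (p q : CokerPre G x y) (hpq : CokerRel φ x y p q) :
    cokerPreMap ψ x y p = cokerPreMap ψ x y q := by
  obtain ⟨b, f⟩ := p
  obtain ⟨b', f'⟩ := q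
  obtain ⟨a, k, hk⟩ := hpq
  dsimp only at k hk
  have h1 := toZero_naturality ψ k
  have h2 := toZero_tensor ψ (F.functor.obj a) b'
  rw [← h a] at h2
  simp only [cokerPreMap, cokerCollapse, ← hk]
  rw [← h1]
  have h3 : ψ.toZero (F.functor.obj a ⊗ b') =
      H.functor.map (cokerCollapse φ a b') ≫ ψ.toZero b' := by
    rw [← cancel_epi (μ H.functor _ _ ≫ H.functor.map (μ G.functor (F.functor.obj a) b')), h2]
    simp only [cokerCollapse, Functor.map_comp, Category.assoc]
    rw [← Functor.map_comp_assoc H.functor (μ G.functor _ _), Functor.Monoidal.μ_δ,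
      CategoryTheory.Functor.map_id, Category.id_comp,
      ← Functor.LaxMonoidal.μ_natural_left_assoc, MonoidalCategory.tensorHom_def,
      comp_whiskerRight, Category.assoc, Category.assoc]
    have h4 := Functor.LaxMonoidal.left_unitality H.functor (G.functor.obj b')
    have h5 : η H.functor ▷ H.functor.obj (G.functor.obj b') ≫ (λ_ _).hom =
        μ H.functor _ _ ≫ H.functor.map (λ_ (G.functor.obj b')).hom := by
      rw [h4, ← comp_whiskerRight_assoc]
      simp
    rw [← reassoc_of% h5, ← leftUnitor_naturality]
  rw [h3]
  simp [cokerCollapse]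

/-- The functor `H' : Coker (φ, G) ⥤ D` induced by `(H, ψ)` on morphisms `x ⟶ y`. -/
def cokerMap {F : Mor₁ A B} {G : Mor₁ B C} {H : Mor₁ C D}
    {φ : Mor₂ (F.comp G) (Mor₁.zero A C)} {ψ : Mor₂ (G.comp H) (Mor₁.zero B D)}
    (h : φ.Compat ψ) (x y : C.carrier) :
    CokerHom φ x y → (H.functor.obj x ⟶ H.functor.obj y) :=
  Quot.lift (cokerPreMap ψ x y) (cokerPreMap_eq h x y)

/-- The sequence `A ⟶ B ⟶ C ⟶ D ⟶ E` (with `φ : G ∘ F ⇒ 0`, `ψ : H ∘ G ⇒ 0`, `χ : K ∘ H ⇒ 0`,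
compatible with each other) is *relative 2-exact* at `C`: the functor
`H' : Coker (φ, G) ⥤ D` induced by `(H, ψ)` is faithful, and it is full with respect to the
2-morphism `K ∘ H' ⇒ 0` induced by `χ`. -/
def RelativeExact {F : Mor₁ A B} {G : Mor₁ B C} {H : Mor₁ C D} {K : Mor₁ D E}
    (φ : Mor₂ (F.comp G) (Mor₁.zero A C)) (ψ : Mor₂ (G.comp H) (Mor₁.zero B D))
    (χ : Mor₂ (H.comp K) (Mor₁.zero C E)) (h : φ.Compat ψ) : Prop :=
  (∀ x y : C.carrier, Function.Injective (cokerMap h x y)) ∧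
  ∀ (x y : C.carrier) (g : H.functor.obj x ⟶ H.functor.obj y),
    K.functor.map g ≫ χ.toZero y = χ.toZero x → ∃ f : CokerHom φ x y, cokerMap h x y f = g

end RelativeExact

/-- An injective object of the 2-category of `R`-2-modules: 1-morphisms into `J` extend, up to a
2-morphism, along faithful 1-morphisms. -/
def TwoModule.IsInjective (J : TwoModule.{w', w, u} R) : Prop :=
  ∀ (M N : TwoModule.{w', w, u} R) (i : Mor₁ M N) (f : Mor₁ M J), i.functor.Faithful →
    ∃ g : Mor₁ N J, Nonempty (Mor₂ (i.comp g) f)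

/-! ### The zero module -/

section ZeroModule

instance : IsTwoGroup (Discrete PUnit.{u + 1}) where
  isGroupoid := inferInstance
  exists_neg _ := ⟨⟨PUnit.unit⟩, ⟨eqToIso (Subsingleton.elim _ _)⟩⟩

instance : SymmetricCategory (Discrete PUnit.{u + 1}) where
  symmetry _ _ := Subsingleton.elim _ _

/-- The constant functor to the one-object category is symmetric monoidal. -/
@[reducible] def toPUnitBraided (A : Type u₁) [Category.{v₁} A] [MonoidalCategory A]
    [BraidedCategory A] (F : A ⥤ Discrete PUnit.{u + 1}) : F.Braided where
  ε := eqToHom (Subsingleton.elim _ _)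
  μ _ _ := eqToHom (Subsingleton.elim _ _)
  η := eqToHom (Subsingleton.elim _ _)
  δ _ _ := eqToHom (Subsingleton.elim _ _)

/-- The zero `R`-2-module, with one object and one morphism. -/
def TwoModule.zero (R : Type w) [Category.{w'} R] [MonoidalCategory R] [SymmetricCategory R]
    [IsTwoGroup R] [TwoRing R] : TwoModule.{w', w, u} R where
  carrier := Discrete PUnit.{u + 1}
  smul := (Functor.const R).obj (𝟭 _)
  biadditive :=
    letI := fun F : Discrete PUnit.{u + 1} ⥤ Discrete PUnit.{u + 1} => toPUnitBraided _ F
    letI := fun F : R ⥤ Discrete PUnit.{u + 1} => toPUnitBraided _ F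
    { isMonoidal_map := fun _ =>
        { unit := Subsingleton.elim _ _, tensor := fun _ _ => Subsingleton.elim _ _ }
      isMonoidal_flip_map := fun _ =>
        { unit := Subsingleton.elim _ _, tensor := fun _ _ => Subsingleton.elim _ _ }
      interchange := fun _ _ _ _ => Subsingleton.elim _ _
      zero_add := fun _ _ => Subsingleton.elim _ _ }
  assoc _ _ _ := eqToIso (Subsingleton.elim _ _)
  oneSmul _ := eqToIso (Subsingleton.elim _ _)
  assoc_naturality _ _ _ := Subsingleton.elim _ _
  oneSmul_naturality _ := Subsingleton.elim _ _
  pentagon _ _ _ _ := Subsingleton.elim _ _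
  triangle _ _ := Subsingleton.elim _ _
  assoc_add₁ _ _ _ _ := Subsingleton.elim _ _
  assoc_add₂ _ _ _ _ := Subsingleton.elim _ _
  assoc_add₃ _ _ _ _ := Subsingleton.elim _ _
  assoc_zero _ _ := Subsingleton.elim _ _
  oneSmul_add _ _ := Subsingleton.elim _ _
  oneSmul_zero := Subsingleton.elim _ _

end ZeroModule

/-! ### 2-cochain complexes -/

/-- A 2-cochain complex of `R`-2-modules `X 0 ⟶ X 1 ⟶ X 2 ⟶ ⋯`. -/
structure CochainComplex₂ (R : Type w) [Category.{w'} R] [MonoidalCategory R]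
    [SymmetricCategory R] [IsTwoGroup R] [TwoRing R] where
  X : ℕ → TwoModule.{w', w, u} R
  d : ∀ n, Mor₁ (X n) (X (n + 1))
  α : ∀ n, Mor₂ ((d n).comp (d (n + 1))) (Mor₁.zero (X n) (X (n + 2)))
  compat : ∀ n, (α n).Compat (α (n + 1))

namespace CochainComplex₂

/-- The complex `A ⟶ C.X 0 ⟶ C.X 1 ⟶ ⋯`. -/
def prepend (C : CochainComplex₂.{w', w, u} R) {A : TwoModule.{w', w, u} R} (L : Mor₁ A (C.X 0))
    (a : Mor₂ (L.comp (C.d 0)) (Mor₁.zero A (C.X 1))) (h : a.Compat (C.α 0)) :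
    CochainComplex₂.{w', w, u} R where
  X
    | 0 => A
    | n + 1 => C.X n
  d
    | 0 => L
    | n + 1 => C.d n
  α
    | 0 => a
    | n + 1 => C.α n
  compat
    | 0 => h
    | n + 1 => C.compat n

/-- The complex `0 ⟶ C.X 0 ⟶ C.X 1 ⟶ ⋯`. -/
def prependZero (C : CochainComplex₂.{w', w, u} R) : CochainComplex₂.{w', w, u} R :=
  C.prepend (Mor₁.zero (TwoModule.zero R) (C.X 0)) (Mor₂.zeroComp _ (C.d 0)) (fun _ => by
    have h := (C.α 0).isMonoidal.unit
    change (ε (C.d 1).functor ≫ (C.d 1).functor.map (ε (C.d 0).functor)) ≫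
      (C.α 0).toZero (𝟙_ _) = 𝟙 _ at h
    change (C.d 1).functor.map (η (C.d 0).functor) ≫ η (C.d 1).functor = (C.α 0).toZero (𝟙_ _)
    rw [← cancel_epi (ε (C.d 1).functor ≫ (C.d 1).functor.map (ε (C.d 0).functor)), h,
      Category.assoc, ← Functor.map_comp_assoc]
    simp)

/-- A complex `C`, extended by zero modules on the left, is relative 2-exact at every `C.X n`. -/
def IsExact (C : CochainComplex₂.{w', w, u} R) : Prop :=
  ∀ n : ℕ, RelativeExact (C.prependZero.prependZero.α n) (C.prependZero.prependZero.α (n + 1))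
    (C.prependZero.prependZero.α (n + 2)) (C.prependZero.prependZero.compat n)

/-- A morphism of 2-cochain complexes. -/
structure Hom (C D : CochainComplex₂.{w', w, u} R) where
  f : ∀ n, Mor₁ (C.X n) (D.X n)
  comm : ∀ n, Mor₂ ((C.d n).comp (f (n + 1))) ((f n).comp (D.d n))
  compat : ∀ (n : ℕ) (x : (C.X n).carrier),
    (f (n + 2)).functor.map ((C.α n).toZero x) ≫ η (f (n + 2)).functor =
      (comm (n + 1)).square ((C.d n).functor.obj x) ≫
        (D.d (n + 1)).functor.map ((comm n).square x) ≫
          (D.α n).toZero ((f n).functor.obj x)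

/-- The term `M_{n-1} ∘ H_{n-1} : C.X n ⟶ D.X n` of a homotopy; it is zero for `n = 0`, since the
complexes are zero in negative degrees. -/
def prevTerm {C D : CochainComplex₂.{w', w, u} R} (H : ∀ n, Mor₁ (C.X (n + 1)) (D.X n)) :
    ∀ n, Mor₁ (C.X n) (D.X n)
  | 0 => Mor₁.zero (C.X 0) (D.X 0)
  | n + 1 => (H n).comp (D.d n)

/-- The morphism `M_n (M_{n-1} (H_{n-1} x)) ⟶ 0`. -/
def prevTermToZero {C D : CochainComplex₂.{w', w, u} R} (H : ∀ n, Mor₁ (C.X (n + 1)) (D.X n)) :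
    ∀ (n : ℕ) (x : (C.X n).carrier),
      (D.d n).functor.obj ((prevTerm H n).functor.obj x) ⟶ 𝟙_ (D.X (n + 1)).carrier
  | 0, _ => η (D.d 0).functor
  | n + 1, x => (D.α n).toZero ((H n).functor.obj x)

/-- A 2-cochain homotopy between two morphisms `F`, `G` of 2-cochain complexes: 1-morphisms
`H n : C.X (n + 1) ⟶ D.X n` and 2-morphisms `τ n : F_n ⇒ M_{n-1} ∘ H_{n-1} + H_n ∘ L_n + G_n`
such that the two 2-morphisms `F_{n+1} ∘ L_n ⇒ M_n ∘ H_n ∘ L_n + M_n ∘ G_n`, one using `τ (n + 1)`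
and one using `τ n`, are equal. -/
structure Homotopy {C D : CochainComplex₂.{w', w, u} R} (F G : Hom C D) where
  H : ∀ n, Mor₁ (C.X (n + 1)) (D.X n)
  τ : ∀ n, Mor₂ (F.f n) (((prevTerm H n).sum ((C.d n).comp (H n))).sum (G.f n))
  compat : ∀ (n : ℕ) (x : (C.X n).carrier),
    (show (F.f (n + 1)).functor.obj ((C.d n).functor.obj x) ⟶
        ((D.d n).functor.obj ((H n).functor.obj ((C.d n).functor.obj x)) ⊗
          (H (n + 1)).functor.obj ((C.d (n + 1)).functor.obj ((C.d n).functor.obj x))) ⊗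
        (G.f (n + 1)).functor.obj ((C.d n).functor.obj x)
      from (τ (n + 1)).nat.app ((C.d n).functor.obj x)) ≫
      ((_ ◁ ((H (n + 1)).functor.map ((C.α n).toZero x) ≫ η (H (n + 1)).functor) ≫
        (ρ_ _).hom) ⊗ₘ (G.comm n).square x) =
    (F.comm n).square x ≫
      (D.d n).functor.map
        (show (F.f n).functor.obj x ⟶
            ((prevTerm H n).functor.obj x ⊗ (H n).functor.obj ((C.d n).functor.obj x)) ⊗
              (G.f n).functor.obj x
          from (τ n).nat.app x) ≫
      δ (D.d n).functor _ _ ≫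
      ((δ (D.d n).functor _ _ ≫ prevTermToZero H n x ▷ _ ≫ (λ_ _).hom) ⊗ₘ 𝟙 _)

end CochainComplex₂

/-! ### Injective resolutions -/

/-- An injective resolution of `A`: a 2-cochain complex `A ⟶ I_0 ⟶ I_1 ⟶ ⋯` of `R`-2-modules that
is relative 2-exact in `A` and in every `I_n`, with every `I_n` injective. -/
structure InjectiveResolution₂ (A : TwoModule.{w', w, u} R) where
  I : CochainComplex₂.{w', w, u} R
  L₀ : Mor₁ A (I.X 0)
  α₀ : Mor₂ (L₀.comp (I.d 0)) (Mor₁.zero A (I.X 1))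
  compat₀ : α₀.Compat (I.α 0)
  exact : (I.prepend L₀ α₀ compat₀).IsExact
  injective : ∀ n, (I.X n).IsInjective

/-- A morphism `F. : I. ⟶ J.` of 2-cochain complexes between injective resolutions `A ⟶ I.` and
`B ⟶ J.` lying over `F : A ⟶ B`.  The 2-morphism `ε_0 : F_0 ∘ L_0 ⇒ M_0 ∘ F` is the field `comm₀`,
and `ε_{n+1} : F_{n+1} ∘ L_{n+1} ⇒ M_{n+1} ∘ F_n` is `hom.comm n`.  The condition `compat₀`
together with `hom.compat` says that they form a morphism from the complex `A ⟶ I_0 ⟶ I_1 ⟶ ⋯`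
to the complex `B ⟶ J_0 ⟶ J_1 ⟶ ⋯` with `F_{-1} = F`. -/
structure MorphismOver {A B : TwoModule.{w', w, u} R} (F : Mor₁ A B)
    (P : InjectiveResolution₂ A) (Q : InjectiveResolution₂ B) where
  hom : CochainComplex₂.Hom P.I Q.I
  comm₀ : Mor₂ (P.L₀.comp (hom.f 0)) (F.comp Q.L₀)
  compat₀ : ∀ x : A.carrier,
    (hom.f 1).functor.map (P.α₀.toZero x) ≫ η (hom.f 1).functor =
      (hom.comm 0).square (P.L₀.functor.obj x) ≫
        (Q.I.d 0).functor.map (comm₀.square x) ≫ Q.α₀.toZero (F.functor.obj x)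

end Morphisms

/-! ### Cancellation in symmetric 2-groups -/

attribute [instance] IsTwoGroup.isGroupoid

section Cancellation

variable {C : Type u₁} [Category.{v₁} C] [MonoidalCategory C] [SymmetricCategory C]
  [IsTwoGroup C]

theorem tensorLeft_isEquivalence (X : C) : (tensorLeft X).IsEquivalence := by
  obtain ⟨Y, ⟨i⟩⟩ := IsTwoGroup.exists_neg X
  have e : ∀ {A B : C} (_ : A ⊗ B ≅ 𝟙_ C), Nonempty (tensorLeft B ⋙ tensorLeft A ≅ 𝟭 C) :=
    fun {A B} j => ⟨(tensorLeftTensor A B).symm ≪≫ (curriedTensor C).mapIso j ≪≫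
      leftUnitorNatIso C⟩
  obtain ⟨e₁⟩ := e i
  obtain ⟨e₂⟩ := e (β_ Y X ≪≫ i)
  exact (CategoryTheory.Equivalence.mk (tensorLeft X) (tensorLeft Y) e₂.symm e₁).isEquivalence_functor

theorem whiskerLeft_injective (X : C) {Y Z : C} {f g : Y ⟶ Z} (h : X ◁ f = X ◁ g) : f = g :=
  haveI := tensorLeft_isEquivalence X
  (tensorLeft X).map_injective h

theorem whiskerLeft_surjective (X : C) {Y Z : C} (g : X ⊗ Y ⟶ X ⊗ Z) : ∃ f : Y ⟶ Z, X ◁ f = g :=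
  haveI := tensorLeft_isEquivalence X
  (tensorLeft X).map_surjective g

theorem whiskerRight_injective (X : C) {Y Z : C} {f g : Y ⟶ Z} (h : f ▷ X = g ▷ X) : f = g := by
  apply whiskerLeft_injective X
  rw [← cancel_epi (β_ Y X).hom, ← BraidedCategory.braiding_naturality_left, h,
    BraidedCategory.braiding_naturality_left]

theorem whiskerRight_surjective (X : C) {Y Z : C} (g : Y ⊗ X ⟶ Z ⊗ X) : ∃ f : Y ⟶ Z, f ▷ X = g := by
  obtain ⟨f, hf⟩ := whiskerLeft_surjective X ((β_ X Y).hom ≫ g ≫ (β_ Z X).hom)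
  refine ⟨f, ?_⟩
  rw [← cancel_epi (β_ X Y).hom, ← BraidedCategory.braiding_naturality_right, hf]
  simp

/-- In a pairing `X + A ⟶ 0` the second object is determined by the first, functorially. -/
theorem pairing_left_injective {X Y A B : C} (e' : Y ⊗ B ⟶ 𝟙_ C) (f : X ⟶ Y)
    {k k' : A ⟶ B} (h : (f ⊗ₘ k) ≫ e' = (f ⊗ₘ k') ≫ e') : k = k' := by
  rw [cancel_mono, MonoidalCategory.tensorHom_def, MonoidalCategory.tensorHom_def,
    cancel_epi] at h
  exact whiskerLeft_injective Y h

theorem exists_pairing_map {X Y A B : C} (e : X ⊗ A ⟶ 𝟙_ C) (e' : Y ⊗ B ⟶ 𝟙_ C) (f : X ⟶ Y) :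
    ∃ k : A ⟶ B, (f ⊗ₘ k) ≫ e' = e := by
  obtain ⟨k, hk⟩ := whiskerLeft_surjective Y (inv (f ▷ A) ≫ e ≫ inv e')
  exact ⟨k, by simp [MonoidalCategory.tensorHom_def, hk]⟩

end Cancellation

section Pairing

variable {C : Type u₁} [Category.{v₁} C] [MonoidalCategory C] [SymmetricCategory C]

/-- The sum of two pairings. -/
def tensorPairing {X A Y B : C} (e : X ⊗ A ⟶ 𝟙_ C) (e' : Y ⊗ B ⟶ 𝟙_ C) :
    (X ⊗ Y) ⊗ (A ⊗ B) ⟶ 𝟙_ C :=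
  tensorμ X Y A B ≫ (e ⊗ₘ e') ≫ (λ_ (𝟙_ C)).hom

theorem tensorPairing_natural {X A Y B X' A' Y' B' : C} {e : X ⊗ A ⟶ 𝟙_ C} {e' : Y ⊗ B ⟶ 𝟙_ C}
    {d : X' ⊗ A' ⟶ 𝟙_ C} {d' : Y' ⊗ B' ⟶ 𝟙_ C} {f : X ⟶ X'} {k : A ⟶ A'} {f' : Y ⟶ Y'}
    {k' : B ⟶ B'} (h : (f ⊗ₘ k) ≫ d = e) (h' : (f' ⊗ₘ k') ≫ d' = e') :
    ((f ⊗ₘ f') ⊗ₘ (k ⊗ₘ k')) ≫ tensorPairing d d' = tensorPairing e e' := by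
  subst h h'
  simp only [tensorPairing, tensorμ_natural_assoc, ← tensorHom_comp_tensorHom, Category.assoc]

theorem tensorPairing_associator {X A Y B Z D : C} (e : X ⊗ A ⟶ 𝟙_ C) (e' : Y ⊗ B ⟶ 𝟙_ C)
    (e'' : Z ⊗ D ⟶ 𝟙_ C) :
    ((α_ X Y Z).hom ⊗ₘ (α_ A B D).hom) ≫ tensorPairing e (tensorPairing e' e'') =
      tensorPairing (tensorPairing e e') e'' := by
  have h := associator_monoidal X Y Z A B D
  have h1 : (e ⊗ₘ (tensorμ Y Z B D ≫ (e' ⊗ₘ e'') ≫ (λ_ (𝟙_ C)).hom)) =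
      (X ⊗ A) ◁ tensorμ Y Z B D ≫ (e ⊗ₘ (e' ⊗ₘ e'')) ≫ (𝟙_ C ◁ (λ_ (𝟙_ C)).hom) := by
    rw [← id_tensorHom, ← id_tensorHom, tensorHom_comp_tensorHom, tensorHom_comp_tensorHom]
    simp
  have h2 : ((tensorμ X Y A B ≫ (e ⊗ₘ e') ≫ (λ_ (𝟙_ C)).hom) ⊗ₘ e'') =
      tensorμ X Y A B ▷ (Z ⊗ D) ≫ ((e ⊗ₘ e') ⊗ₘ e'') ≫ ((λ_ (𝟙_ C)).hom ▷ 𝟙_ C) := by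
    rw [← tensorHom_id, ← tensorHom_id, tensorHom_comp_tensorHom, tensorHom_comp_tensorHom]
    simp
  simp only [tensorPairing, h1, h2, Category.assoc]
  rw [← reassoc_of% h, ← associator_naturality_assoc]
  congr 3
  monoidal

theorem tensorPairing_braiding {X A Y B : C} (e : X ⊗ A ⟶ 𝟙_ C) (e' : Y ⊗ B ⟶ 𝟙_ C) :
    ((β_ X Y).hom ⊗ₘ (β_ A B).hom) ≫ tensorPairing e' e = tensorPairing e e' := by
  have h : ((β_ X Y).hom ⊗ₘ (β_ A B).hom) ≫ tensorμ Y X B A =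
      tensorμ X Y A B ≫ (β_ (X ⊗ A) (Y ⊗ B)).hom := by
    simp [tensorμ, SymmetricCategory.braiding_swap_eq_inv_braiding A Y,
      MonoidalCategory.tensorHom_def]
  have h' : (β_ (𝟙_ C) (𝟙_ C)).hom ≫ (λ_ (𝟙_ C)).hom = (λ_ (𝟙_ C)).hom := by
    rw [braiding_leftUnitor, unitors_equal]
  simp only [tensorPairing]
  rw [reassoc_of% h, ← BraidedCategory.braiding_naturality_assoc, h']

theorem tensorPairing_leftUnitor {X A : C} (e : X ⊗ A ⟶ 𝟙_ C) :
    ((λ_ X).hom ⊗ₘ (λ_ A).hom) ≫ e = tensorPairing (λ_ (𝟙_ C)).hom e := by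
  rw [leftUnitor_monoidal X A, tensorPairing, MonoidalCategory.tensorHom_def]
  simp

theorem tensorPairing_rightUnitor {X A : C} (e : X ⊗ A ⟶ 𝟙_ C) :
    ((ρ_ X).hom ⊗ₘ (ρ_ A).hom) ≫ e = tensorPairing e (λ_ (𝟙_ C)).hom := by
  rw [rightUnitor_monoidal X A, tensorPairing, MonoidalCategory.tensorHom_def', unitors_equal]
  simp

end Pairing

/-! ### Negation as a 1-morphism -/

section Negation

variable {R : Type w} [Category.{w'} R] [MonoidalCategory R] [SymmetricCategory R]
  [IsTwoGroup R] [TwoRing R] {N : TwoModule.{w', w, u} R}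

theorem tensorμ_tensorμ {C : Type u₁} [Category.{v₁} C] [MonoidalCategory C] [SymmetricCategory C]
    (X Y Z W : C) : tensorμ X Y Z W ≫ tensorμ X Z Y W = 𝟙 _ := by
  have h : tensorμ X Z Y W = tensorδ X Y Z W := by
    simp only [tensorμ, tensorδ, SymmetricCategory.braiding_swap_eq_inv_braiding Y Z]
  rw [h, tensorμ_tensorδ]

/-- The pairing `r · X + r · A ⟶ r · (X + A) ⟶ r · 0 ⟶ 0`. -/
def smulPairing (r : R) {X A : N.carrier} (e : X ⊗ A ⟶ 𝟙_ N.carrier) :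
    bi N.smul r X ⊗ bi N.smul r A ⟶ 𝟙_ N.carrier :=
  addR N.smul r X A ≫ (N.smul.obj r).map e ≫ η (N.smul.obj r)

theorem smulPairing_natural {r r' : R} (g : r ⟶ r') {X A X' A' : N.carrier}
    {e : X ⊗ A ⟶ 𝟙_ N.carrier} {d : X' ⊗ A' ⟶ 𝟙_ N.carrier} {f : X ⟶ X'} {k : A ⟶ A'}
    (h : (f ⊗ₘ k) ≫ d = e) :
    (biMap N.smul g f ⊗ₘ biMap N.smul g k) ≫ smulPairing r' d = smulPairing r e := by
  subst h
  have h1 := (Biadditive.isMonoidal_map (T := N.smul) g).tensor X A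
  have h2 := (Biadditive.isMonoidal_map (T := N.smul) g).unit
  have h3 : (N.smul.map g).app (𝟙_ _) ≫ η (N.smul.obj r') = η (N.smul.obj r) := by
    rw [← cancel_epi (ε (N.smul.obj r)), reassoc_of% h2]
    simp
  simp only [smulPairing, biMap, addR, ← tensorHom_comp_tensorHom, Category.assoc,
    Functor.LaxMonoidal.μ_natural_assoc, Functor.map_comp]
  rw [← reassoc_of% h1, ← h3]
  simp only [NatTrans.naturality_assoc]

theorem smulPairing_addR (r : R) {X A Y B : N.carrier} (e : X ⊗ A ⟶ 𝟙_ N.carrier)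
    (e' : Y ⊗ B ⟶ 𝟙_ N.carrier) :
    (addR N.smul r X Y ⊗ₘ addR N.smul r A B) ≫ smulPairing r (tensorPairing e e') =
      tensorPairing (smulPairing r e) (smulPairing r e') := by
  have h := tensorμ_comp_μ_tensorHom_μ_comp_μ (N.smul.obj r) X Y A B
  have h5 : (η (N.smul.obj r) ⊗ₘ η (N.smul.obj r)) ≫ (λ_ _).hom =
      μ (N.smul.obj r) _ _ ≫ (N.smul.obj r).map (λ_ (𝟙_ N.carrier)).hom ≫ η (N.smul.obj r) := by
    have h4 := Functor.LaxMonoidal.left_unitality (N.smul.obj r) (𝟙_ N.carrier)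
    rw [← cancel_epi (ε (N.smul.obj r) ▷ (N.smul.obj r).obj (𝟙_ _)), ← reassoc_of% h4,
      MonoidalCategory.tensorHom_def]
    simp [← comp_whiskerRight_assoc]
  simp only [smulPairing, tensorPairing, addR, Functor.map_comp, ← tensorHom_comp_tensorHom,
    Category.assoc]
  rw [h5, Functor.LaxMonoidal.μ_natural_assoc, reassoc_of% h]

theorem smulPairing_addL (r s : R) {X A : N.carrier} (e : X ⊗ A ⟶ 𝟙_ N.carrier) :
    (addL N.smul r s X ⊗ₘ addL N.smul r s A) ≫ smulPairing (r ⊗ s) e =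
      tensorPairing (smulPairing r e) (smulPairing s e) := by
  have h1 := Biadditive.interchange (T := N.smul) r s X A
  have h2 : addL N.smul r s (X ⊗ A) ≫ (N.smul.obj (r ⊗ s)).map e =
      ((N.smul.obj r).map e ⊗ₘ (N.smul.obj s).map e) ≫ addL N.smul r s (𝟙_ _) :=
    (Biadditive.isMonoidal_flip_map (T := N.smul) e).tensor r s
  have h3 := Biadditive.zero_add (T := N.smul) r s
  have h4 : (η (N.smul.obj r) ⊗ₘ η (N.smul.obj s)) ≫ (λ_ _).hom =
      addL N.smul r s (𝟙_ _) ≫ η (N.smul.obj (r ⊗ s)) := by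
    rw [← cancel_epi (ε (N.smul.obj r) ⊗ₘ ε (N.smul.obj s)), reassoc_of% h3]
    simp
  simp only [smulPairing, tensorPairing, ← tensorHom_comp_tensorHom, Category.assoc, h4]
  rw [← reassoc_of% h2, ← reassoc_of% h1, reassoc_of% tensorμ_tensorμ]

theorem smulPairing_unit (r : R) :
    (ε (N.smul.obj r) ⊗ₘ ε (N.smul.obj r)) ≫ smulPairing r (λ_ (𝟙_ N.carrier)).hom =
      (λ_ (𝟙_ N.carrier)).hom := by
  have h4 := Functor.LaxMonoidal.left_unitality (N.smul.obj r) (𝟙_ N.carrier)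
  rw [smulPairing, MonoidalCategory.tensorHom_def', Category.assoc, addR, ← reassoc_of% h4]
  simp

theorem smulPairing_assoc (r s : R) {X A : N.carrier} (e : X ⊗ A ⟶ 𝟙_ N.carrier) :
    ((N.assoc r s X).hom ⊗ₘ (N.assoc r s A).hom) ≫ smulPairing r (smulPairing s e) =
      smulPairing (bi TwoRing.mul r s) e := by
  have h1 := N.assoc_add₃ r s X A
  have h2 := N.assoc_naturality (𝟙 r) (𝟙 s) e
  have h3 := N.assoc_zero r s
  have h4 : (N.assoc r s (𝟙_ N.carrier)).hom ≫ (N.smul.obj r).map (η (N.smul.obj s)) ≫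
      η (N.smul.obj r) = η (N.smul.obj (bi TwoRing.mul r s)) := by
    rw [← cancel_epi (ε (N.smul.obj (bi TwoRing.mul r s))), reassoc_of% h3]
    simp [← Functor.map_comp_assoc]
  simp only [biMap, CategoryTheory.Functor.map_id, NatTrans.id_app, Category.id_comp,
    Category.comp_id] at h2
  simp only [smulPairing, Functor.map_comp, ← h4, Category.assoc]
  rw [← reassoc_of% h1, reassoc_of% h2]

theorem smulPairing_one {X A : N.carrier} (e : X ⊗ A ⟶ 𝟙_ N.carrier) :
    ((N.oneSmul X).hom ⊗ₘ (N.oneSmul A).hom) ≫ e = smulPairing TwoRing.one e := by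
  have h1 := N.oneSmul_add X A
  have h2 := N.oneSmul_naturality e
  have h3 : (N.oneSmul (𝟙_ N.carrier)).hom = η (N.smul.obj TwoRing.one) := by
    rw [← cancel_epi (ε (N.smul.obj TwoRing.one)), N.oneSmul_zero]
    simp
  rw [smulPairing, ← h1, Category.assoc, ← h2, h3]

variable (N)

theorem exists_negPairing (X : N.carrier) : ∃ Y : N.carrier, Nonempty (X ⊗ Y ⟶ 𝟙_ N.carrier) := by
  obtain ⟨Y, ⟨i⟩⟩ := IsTwoGroup.exists_neg X
  exact ⟨Y, ⟨i.hom⟩⟩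

/-- A chosen inverse of an object. -/
noncomputable def negObj (X : N.carrier) : N.carrier := (exists_negPairing N X).choose

/-- The chosen pairing `X + (-X) ⟶ 0`. -/
noncomputable def negObjPairing (X : N.carrier) : X ⊗ negObj N X ⟶ 𝟙_ N.carrier :=
  (exists_negPairing N X).choose_spec.some

variable {N}

/-- The morphism `A ⟶ B` dual to `f : X ⟶ Y` with respect to two pairings. -/
noncomputable def dualMap {X Y A B : N.carrier} (e : X ⊗ A ⟶ 𝟙_ N.carrier)
    (e' : Y ⊗ B ⟶ 𝟙_ N.carrier) (f : X ⟶ Y) : A ⟶ B :=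
  (exists_pairing_map e e' f).choose

theorem dualMap_spec {X Y A B : N.carrier} (e : X ⊗ A ⟶ 𝟙_ N.carrier)
    (e' : Y ⊗ B ⟶ 𝟙_ N.carrier) (f : X ⟶ Y) : (f ⊗ₘ dualMap e e' f) ≫ e' = e :=
  (exists_pairing_map e e' f).choose_spec

theorem pairing_comp {X Y Z A B D : N.carrier} {e : X ⊗ A ⟶ 𝟙_ N.carrier}
    {e' : Y ⊗ B ⟶ 𝟙_ N.carrier} {e'' : Z ⊗ D ⟶ 𝟙_ N.carrier} {f : X ⟶ Y} {k : A ⟶ B} {f' : Y ⟶ Z}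
    {k' : B ⟶ D} (h : (f ⊗ₘ k) ≫ e' = e) (h' : (f' ⊗ₘ k') ≫ e'' = e') :
    ((f ≫ f') ⊗ₘ (k ≫ k')) ≫ e'' = e := by
  rw [← tensorHom_comp_tensorHom, Category.assoc, h', h]

theorem pairing_id {X A : N.carrier} (e : X ⊗ A ⟶ 𝟙_ N.carrier) : (𝟙 X ⊗ₘ 𝟙 A) ≫ e = e := by
  simp

variable (N)

/-- The functor `X ↦ -X`. -/
noncomputable def negFunctor : N.carrier ⥤ N.carrier where
  obj X := negObj N X
  map f := dualMap (negObjPairing N _) (negObjPairing N _) f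
  map_id X := pairing_left_injective (negObjPairing N X) (𝟙 X)
    ((dualMap_spec _ _ _).trans (pairing_id _).symm)
  map_comp f g := pairing_left_injective (negObjPairing N _) (f ≫ g)
    ((dualMap_spec _ _ _).trans (pairing_comp (dualMap_spec _ _ _) (dualMap_spec _ _ _)).symm)

/-- The pairing `X + (-X) ⟶ 0`. -/
noncomputable def negPairing (X : N.carrier) : X ⊗ (negFunctor N).obj X ⟶ 𝟙_ N.carrier :=
  negObjPairing N X

theorem negPairing_natural {X Y : N.carrier} (f : X ⟶ Y) :
    (f ⊗ₘ (negFunctor N).map f) ≫ negPairing N Y = negPairing N X :=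
  dualMap_spec (negObjPairing N X) (negObjPairing N Y) f

/-- The isomorphism `(-X) + (-Y) ⟶ -(X + Y)`. -/
noncomputable def negTensor (X Y : N.carrier) :
    (negFunctor N).obj X ⊗ (negFunctor N).obj Y ⟶ (negFunctor N).obj (X ⊗ Y) :=
  dualMap (tensorPairing (negPairing N X) (negPairing N Y)) (negPairing N _) (𝟙 _)

theorem negTensor_spec (X Y : N.carrier) : (𝟙 (X ⊗ Y) ⊗ₘ negTensor N X Y) ≫ negPairing N (X ⊗ Y) =
    tensorPairing (negPairing N X) (negPairing N Y) :=
  dualMap_spec _ _ _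

/-- The isomorphism `0 ⟶ -0`. -/
noncomputable def negUnit : 𝟙_ N.carrier ⟶ (negFunctor N).obj (𝟙_ N.carrier) :=
  dualMap (λ_ (𝟙_ N.carrier)).hom (negPairing N _) (𝟙 _)

theorem negUnit_spec : (𝟙 (𝟙_ N.carrier) ⊗ₘ negUnit N) ≫ negPairing N _ = (λ_ (𝟙_ N.carrier)).hom :=
  dualMap_spec _ _ _

/-- The isomorphism `-(r · X) ⟶ r · (-X)`. -/
noncomputable def negLin (r : R) (X : N.carrier) :
    (negFunctor N).obj (bi N.smul r X) ⟶ bi N.smul r ((negFunctor N).obj X) :=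
  dualMap (negPairing N _) (smulPairing r (negPairing N X)) (𝟙 _)

theorem negLin_spec (r : R) (X : N.carrier) :
    (𝟙 (bi N.smul r X) ⊗ₘ negLin N r X) ≫ smulPairing r (negPairing N X) = negPairing N _ :=
  dualMap_spec _ _ _

/-- Two morphisms that are dual to equal morphisms are equal. -/
theorem pairing_unique {X Y A B : N.carrier} {e : X ⊗ A ⟶ 𝟙_ N.carrier}
    {e' : Y ⊗ B ⟶ 𝟙_ N.carrier} {f f' : X ⟶ Y} {k k' : A ⟶ B} (h : (f ⊗ₘ k) ≫ e' = e)
    (h' : (f' ⊗ₘ k') ≫ e' = e) (hf : f = f') : k = k' := by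
  subst hf
  exact pairing_left_injective e' f (h.trans h'.symm)

theorem negTensor_natural {X X' Y Y' : N.carrier} (f : X ⟶ X') (g : Y ⟶ Y') :
    ((negFunctor N).map f ⊗ₘ (negFunctor N).map g) ≫ negTensor N X' Y' =
      negTensor N X Y ≫ (negFunctor N).map (f ⊗ₘ g) :=
  pairing_unique N
    (pairing_comp (tensorPairing_natural (negPairing_natural N f) (negPairing_natural N g))
      (negTensor_spec N X' Y'))
    (pairing_comp (negTensor_spec N X Y) (negPairing_natural N _)) (by simp)

noncomputable instance : (negFunctor N).Monoidal :=
  Functor.CoreMonoidal.toMonoidal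
    { εIso := asIso (negUnit N)
      μIso X Y := asIso (negTensor N X Y)
      μIso_hom_natural_left f X' := by
        simpa using negTensor_natural N f (𝟙 X')
      μIso_hom_natural_right X' f := by
        simpa using negTensor_natural N (𝟙 X') f
      associativity X Y Z := by
        simp only [asIso_hom, ← id_tensorHom, ← tensorHom_id]
        exact pairing_unique N
          (pairing_comp (tensorPairing_natural (negTensor_spec N X Y) (pairing_id _))
            (pairing_comp (negTensor_spec N _ _) (negPairing_natural N (α_ X Y Z).hom)))
          (pairing_comp (tensorPairing_associator _ _ _)
            (pairing_comp (tensorPairing_natural (pairing_id _) (negTensor_spec N Y Z))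
              (negTensor_spec N _ _))) (by simp)
      left_unitality X := by
        simp only [asIso_hom, ← tensorHom_id]
        exact pairing_unique N (tensorPairing_leftUnitor (negPairing N X))
          (pairing_comp (tensorPairing_natural (negUnit_spec N) (pairing_id _))
            (pairing_comp (negTensor_spec N _ _) (negPairing_natural N (λ_ X).hom))) (by simp)
      right_unitality X := by
        simp only [asIso_hom, ← id_tensorHom]
        exact pairing_unique N (tensorPairing_rightUnitor (negPairing N X))
          (pairing_comp (tensorPairing_natural (pairing_id _) (negUnit_spec N))
            (pairing_comp (negTensor_spec N _ _) (negPairing_natural N (ρ_ X).hom))) (by simp) }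

theorem negFunctor_μ (X Y : N.carrier) : μ (negFunctor N) X Y = negTensor N X Y := rfl

theorem negFunctor_ε : ε (negFunctor N) = negUnit N := rfl

noncomputable instance : (negFunctor N).Braided where
  braided X Y := by
    rw [negFunctor_μ, negFunctor_μ]
    exact pairing_unique N
      (pairing_comp (negTensor_spec N X Y) (negPairing_natural N (β_ X Y).hom))
      (pairing_comp (tensorPairing_braiding _ _) (negTensor_spec N Y X)) (by simp)

theorem pairing_smul (r : R) {X A X' A' : N.carrier} {e : X ⊗ A ⟶ 𝟙_ N.carrier}
    {d : X' ⊗ A' ⟶ 𝟙_ N.carrier} {f : X ⟶ X'} {k : A ⟶ A'} (h : (f ⊗ₘ k) ≫ d = e) :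
    ((N.smul.obj r).map f ⊗ₘ (N.smul.obj r).map k) ≫ smulPairing r d = smulPairing r e := by
  simpa [biMap] using smulPairing_natural (𝟙 r) h

/-- Negation as a 1-morphism. -/
noncomputable def Mor₁.neg : Mor₁ N N where
  functor := negFunctor N
  lin r X := asIso (negLin N r X)
  lin_naturality f h := by
    simp only [asIso_hom]
    exact pairing_unique N (pairing_comp (negPairing_natural N _) (negLin_spec N _ _))
      (pairing_comp (negLin_spec N _ _) (smulPairing_natural f (negPairing_natural N h))) (by simp)
  lin_add r m m' := by
    simp only [asIso_hom, negFunctor_μ]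
    exact pairing_unique N
      (pairing_comp (negTensor_spec N _ _)
        (pairing_comp (negPairing_natural N _) (negLin_spec N _ _)))
      (pairing_comp (tensorPairing_natural (negLin_spec N r m) (negLin_spec N r m'))
        (pairing_comp (smulPairing_addR r _ _) (pairing_smul N r (negTensor_spec N m m'))))
      (by simp)
  add_lin r s m := by
    simp only [asIso_hom, negFunctor_μ]
    exact pairing_unique N
      (pairing_comp (negTensor_spec N _ _)
        (pairing_comp (negPairing_natural N _) (negLin_spec N _ _)))
      (pairing_comp (tensorPairing_natural (negLin_spec N r m) (negLin_spec N s m))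
        (smulPairing_addL r s _)) (by simp)
  lin_zero r := by
    simp only [asIso_hom, negFunctor_ε]
    exact pairing_unique N
      (pairing_comp (negUnit_spec N) (pairing_comp (negPairing_natural N _) (negLin_spec N _ _)))
      (pairing_comp (smulPairing_unit r) (pairing_smul N r (negUnit_spec N))) (by simp)
  lin_assoc r s m := by
    simp only [asIso_hom]
    exact pairing_unique N
      (pairing_comp (negPairing_natural N _)
        (pairing_comp (negLin_spec N _ _) (pairing_smul N r (negLin_spec N s m))))
      (pairing_comp (negLin_spec N _ m) (smulPairing_assoc r s _)) (by simp)
  lin_one m := by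
    simp only [asIso_hom]
    exact pairing_unique N (pairing_comp (negLin_spec N _ m) (smulPairing_one _))
      (negPairing_natural N _) (by simp)

end Negation

/-! ### Calculus of 2-morphisms -/

section Calculus

variable {R : Type w} [Category.{w'} R] [MonoidalCategory R] [SymmetricCategory R]
  [IsTwoGroup R] [TwoRing R] {M N P Q : TwoModule.{w', w, u} R}

namespace Mor₁

theorem comp_obj (F : Mor₁ M N) (G : Mor₁ N P) (m : M.carrier) :
    (F.comp G).functor.obj m = G.functor.obj (F.functor.obj m) := rfl

theorem comp_map (F : Mor₁ M N) (G : Mor₁ N P) {m m' : M.carrier} (f : m ⟶ m') :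
    (F.comp G).functor.map f = G.functor.map (F.functor.map f) := rfl

theorem sum_obj (F G : Mor₁ M N) (m : M.carrier) :
    (F.sum G).functor.obj m = F.functor.obj m ⊗ G.functor.obj m := rfl

theorem sum_map (F G : Mor₁ M N) {m m' : M.carrier} (f : m ⟶ m') :
    (F.sum G).functor.map f = (F.functor.map f ⊗ₘ G.functor.map f) := rfl

theorem zero_obj (m : M.carrier) : (zero M N).functor.obj m = 𝟙_ N.carrier := rfl

theorem zero_map {m m' : M.carrier} (f : m ⟶ m') :
    (zero M N).functor.map f = 𝟙 (𝟙_ N.carrier) := rfl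

theorem neg_obj (X : N.carrier) : (neg N).functor.obj X = (negFunctor N).obj X := rfl

theorem neg_map {X Y : N.carrier} (f : X ⟶ Y) :
    (neg N).functor.map f = (negFunctor N).map f := rfl

theorem comp_μ (F : Mor₁ M N) (G : Mor₁ N P) (m m' : M.carrier) :
    μ (F.comp G).functor m m' = μ G.functor _ _ ≫ G.functor.map (μ F.functor m m') := rfl

theorem comp_ε (F : Mor₁ M N) (G : Mor₁ N P) :
    ε (F.comp G).functor = ε G.functor ≫ G.functor.map (ε F.functor) := rfl

theorem comp_lin (F : Mor₁ M N) (G : Mor₁ N P) (r : R) (m : M.carrier) :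
    ((F.comp G).lin r m).hom = G.functor.map (F.lin r m).hom ≫ (G.lin r _).hom := rfl

theorem zero_μ (m m' : M.carrier) : μ (zero M N).functor m m' = (λ_ (𝟙_ N.carrier)).hom := rfl

theorem zero_ε : ε (zero M N).functor = 𝟙 (𝟙_ N.carrier) := rfl

theorem zero_lin (r : R) (m : M.carrier) : ((zero M N).lin r m).hom = ε (N.smul.obj r) := rfl

theorem sum_μ (F G : Mor₁ M N) (m m' : M.carrier) :
    μ (F.sum G).functor m m' =
      tensorμ (F.functor.obj m) (G.functor.obj m) (F.functor.obj m') (G.functor.obj m') ≫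
        (μ F.functor m m' ⊗ₘ μ G.functor m m') :=
  sumFunctor_μ F G m m'

theorem sum_ε (F G : Mor₁ M N) :
    ε (F.sum G).functor = (λ_ (𝟙_ N.carrier)).inv ≫ (ε F.functor ⊗ₘ ε G.functor) :=
  sumFunctor_ε F G

theorem sum_lin (F G : Mor₁ M N) (r : R) (m : M.carrier) :
    ((F.sum G).lin r m).hom = ((F.lin r m).hom ⊗ₘ (G.lin r m).hom) ≫
      μ (N.smul.obj r) (F.functor.obj m) (G.functor.obj m) := rfl

theorem neg_ε : ε (neg N).functor = negUnit N := rfl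

theorem neg_μ (X Y : N.carrier) : μ (neg N).functor X Y = negTensor N X Y := rfl

theorem neg_lin (r : R) (X : N.carrier) : ((neg N).lin r X).hom = negLin N r X := rfl

theorem lin_map (G : Mor₁ M N) (r : R) {m m' : M.carrier} (f : m ⟶ m') :
    G.functor.map ((M.smul.obj r).map f) ≫ (G.lin r m').hom =
      (G.lin r m).hom ≫ (N.smul.obj r).map (G.functor.map f) := by
  simpa [biMap] using G.lin_naturality (𝟙 r) f

end Mor₁

namespace Mor₂

variable {F G H F' G' : Mor₁ M N}

/-- A 2-morphism from its components. -/
def ofApp (app : ∀ m, F.functor.obj m ⟶ G.functor.obj m)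
    (naturality : ∀ {m m' : M.carrier} (f : m ⟶ m'),
      F.functor.map f ≫ app m' = app m ≫ G.functor.map f)
    (unit : ε F.functor ≫ app (𝟙_ _) = ε G.functor)
    (tensor : ∀ m m' : M.carrier,
      μ F.functor m m' ≫ app (m ⊗ m') = (app m ⊗ₘ app m') ≫ μ G.functor m m')
    (lin : ∀ (r : R) (m : M.carrier),
      (F.lin r m).hom ≫ (N.smul.obj r).map (app m) = app (bi M.smul r m) ≫ (G.lin r m).hom) :
    Mor₂ F G where
  nat := { app := app, naturality := fun _ _ f => naturality f }
  isMonoidal := { unit := unit, tensor := tensor }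
  lin := lin

theorem naturality (φ : Mor₂ F G) {m m' : M.carrier} (f : m ⟶ m') :
    F.functor.map f ≫ φ.nat.app m' = φ.nat.app m ≫ G.functor.map f := φ.nat.naturality f

theorem unit (φ : Mor₂ F G) : ε F.functor ≫ φ.nat.app (𝟙_ _) = ε G.functor := φ.isMonoidal.unit

theorem tensor (φ : Mor₂ F G) (m m' : M.carrier) : μ F.functor m m' ≫ φ.nat.app (m ⊗ m') =
    (φ.nat.app m ⊗ₘ φ.nat.app m') ≫ μ G.functor m m' := φ.isMonoidal.tensor m m'

/-- Vertical composition. -/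
def vcomp (φ : Mor₂ F G) (ψ : Mor₂ G H) : Mor₂ F H :=
  ofApp (fun m => φ.nat.app m ≫ ψ.nat.app m) (by simp)
    (by rw [← Category.assoc, φ.unit, ψ.unit])
    (fun m m' => by
      rw [← Category.assoc, φ.tensor, Category.assoc, ψ.tensor, tensorHom_comp_tensorHom_assoc])
    (fun r m => by
      rw [Functor.map_comp, ← Category.assoc, φ.lin, Category.assoc, ψ.lin, Category.assoc])

/-- The inverse of a 2-morphism. -/
noncomputable def symm (φ : Mor₂ F G) : Mor₂ G F :=
  ofApp (fun m => inv (φ.nat.app m)) (by simp)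
    (by rw [IsIso.comp_inv_eq, φ.unit])
    (fun m m' => by
      rw [IsIso.comp_inv_eq, Category.assoc, φ.tensor, tensorHom_comp_tensorHom_assoc]
      simp)
    (fun r m => by
      rw [Functor.map_inv, IsIso.comp_inv_eq, Category.assoc, φ.lin]
      simp)

/-- Precomposition of a 2-morphism with a 1-morphism. -/
def whiskerL (L : Mor₁ P M) (φ : Mor₂ F G) : Mor₂ (L.comp F) (L.comp G) :=
  ofApp (fun m => φ.nat.app (L.functor.obj m))
    (fun f => φ.naturality _)
    (by
      simp only [Mor₁.comp_ε, Mor₁.comp_obj, Category.assoc, φ.naturality]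
      rw [← Category.assoc, φ.unit])
    (fun m m' => by
      simp only [Mor₁.comp_μ, Mor₁.comp_obj, Category.assoc, φ.naturality]
      rw [← Category.assoc, φ.tensor, Category.assoc])
    (fun r m => by
      simp only [Mor₁.comp_lin, Mor₁.comp_obj, Category.assoc, φ.lin]
      rw [← Category.assoc, φ.naturality, Category.assoc])

/-- Postcomposition of a 2-morphism with a 1-morphism. -/
def whiskerR (φ : Mor₂ F G) (K : Mor₁ N P) : Mor₂ (F.comp K) (G.comp K) :=
  ofApp (fun m => K.functor.map (φ.nat.app m))
    (fun f => by
      simp only [Mor₁.comp_map, Mor₁.comp_obj, ← Functor.map_comp, φ.naturality])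
    (by
      simp only [Mor₁.comp_ε, Mor₁.comp_obj, Category.assoc, ← Functor.map_comp, φ.unit])
    (fun m m' => by
      simp only [Mor₁.comp_μ, Mor₁.comp_obj, Category.assoc, ← Functor.map_comp, φ.tensor]
      rw [Functor.map_comp, ← Functor.LaxMonoidal.μ_natural_assoc])
    (fun r m => by
      simp only [Mor₁.comp_lin, Mor₁.comp_obj, Category.assoc, ← Mor₁.lin_map]
      rw [← Functor.map_comp_assoc, φ.lin, Functor.map_comp_assoc])

/-- The sum of two 2-morphisms. -/
def sumMap (φ : Mor₂ F G) (ψ : Mor₂ F' G') : Mor₂ (F.sum F') (G.sum G') :=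
  ofApp (fun m => φ.nat.app m ⊗ₘ ψ.nat.app m)
    (fun f => by
      simp only [Mor₁.sum_map, Mor₁.sum_obj, tensorHom_comp_tensorHom, φ.naturality, ψ.naturality])
    (by
      simp only [Mor₁.sum_ε, Mor₁.sum_obj, Category.assoc, tensorHom_comp_tensorHom, φ.unit, ψ.unit])
    (fun m m' => by
      simp only [Mor₁.sum_μ, Mor₁.sum_obj, Category.assoc, tensorHom_comp_tensorHom, φ.tensor,
        ψ.tensor]
      simp only [← tensorHom_comp_tensorHom]
      exact (tensorμ_natural_assoc _ _ _ _ _).symm)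
    (fun r m => by
      simp only [Mor₁.sum_lin, Mor₁.sum_obj, Category.assoc, ← Functor.LaxMonoidal.μ_natural,
        tensorHom_comp_tensorHom_assoc, φ.lin, ψ.lin]
      rfl)

/-- Associativity of the sum of 1-morphisms. -/
def sumAssoc (F G H : Mor₁ M N) : Mor₂ ((F.sum G).sum H) (F.sum (G.sum H)) :=
  ofApp (fun m => (α_ (F.functor.obj m) (G.functor.obj m) (H.functor.obj m)).hom)
    (fun f => associator_naturality (F.functor.map f) (G.functor.map f) (H.functor.map f))
    (by
      simp only [Mor₁.sum_ε, Mor₁.sum_obj, Category.assoc]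
      have h1 : (((λ_ (𝟙_ N.carrier)).inv ≫ (ε F.functor ⊗ₘ ε G.functor)) ⊗ₘ ε H.functor) =
          (λ_ (𝟙_ N.carrier)).inv ▷ _ ≫ ((ε F.functor ⊗ₘ ε G.functor) ⊗ₘ ε H.functor) := by
        simp only [← tensorHom_id, tensorHom_comp_tensorHom, Category.id_comp]
      have h2 : (ε F.functor ⊗ₘ ((λ_ (𝟙_ N.carrier)).inv ≫ (ε G.functor ⊗ₘ ε H.functor))) =
          _ ◁ (λ_ (𝟙_ N.carrier)).inv ≫ (ε F.functor ⊗ₘ (ε G.functor ⊗ₘ ε H.functor)) := by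
        simp only [← id_tensorHom, tensorHom_comp_tensorHom, Category.id_comp]
      rw [h1, h2, Category.assoc, associator_naturality]
      simp only [← Category.assoc]
      congr 1
      monoidal)
    (fun m m' => by
      have h := associator_monoidal (F.functor.obj m) (G.functor.obj m) (H.functor.obj m)
        (F.functor.obj m') (G.functor.obj m') (H.functor.obj m')
      have h1 : (tensorμ (F.functor.obj m) (G.functor.obj m) (F.functor.obj m')
          (G.functor.obj m') ≫ (μ F.functor m m' ⊗ₘ μ G.functor m m') ⊗ₘ μ H.functor m m') =
          tensorμ (F.functor.obj m) (G.functor.obj m) (F.functor.obj m') (G.functor.obj m') ▷ _ ≫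
            ((μ F.functor m m' ⊗ₘ μ G.functor m m') ⊗ₘ μ H.functor m m') := by
        simp only [← tensorHom_id, tensorHom_comp_tensorHom, Category.id_comp]
      have h2 : (μ F.functor m m' ⊗ₘ tensorμ (G.functor.obj m) (H.functor.obj m)
          (G.functor.obj m') (H.functor.obj m') ≫ (μ G.functor m m' ⊗ₘ μ H.functor m m')) =
          _ ◁ tensorμ (G.functor.obj m) (H.functor.obj m) (G.functor.obj m') (H.functor.obj m') ≫
            (μ F.functor m m' ⊗ₘ μ G.functor m m' ⊗ₘ μ H.functor m m') := by
        simp only [← id_tensorHom, tensorHom_comp_tensorHom, Category.id_comp]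
      simp only [Mor₁.sum_μ, Mor₁.sum_obj, h1, h2, Category.assoc]
      rw [associator_naturality, reassoc_of% h])
    (fun r m => by
      have h := Functor.LaxMonoidal.associativity (N.smul.obj r) (F.functor.obj m)
        (G.functor.obj m) (H.functor.obj m)
      simp only [Mor₁.sum_lin, Mor₁.sum_obj, Category.assoc]
      have h1 : (((F.lin r m).hom ⊗ₘ (G.lin r m).hom) ≫ μ (N.smul.obj r) _ _ ⊗ₘ
          (H.lin r m).hom) = (((F.lin r m).hom ⊗ₘ (G.lin r m).hom) ⊗ₘ (H.lin r m).hom) ≫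
            μ (N.smul.obj r) _ _ ▷ _ := by
        simp only [← tensorHom_id, tensorHom_comp_tensorHom, Category.comp_id]
      have h2 : ((F.lin r m).hom ⊗ₘ (((G.lin r m).hom ⊗ₘ (H.lin r m).hom) ≫
          μ (N.smul.obj r) _ _)) = ((F.lin r m).hom ⊗ₘ ((G.lin r m).hom ⊗ₘ (H.lin r m).hom)) ≫
            _ ◁ μ (N.smul.obj r) _ _ := by
        simp only [← id_tensorHom, tensorHom_comp_tensorHom, Category.comp_id]
      rw [h1, h2, Category.assoc, Category.assoc, h, associator_naturality_assoc])

theorem tensorμ_comp_braiding {C : Type u₁} [Category.{v₁} C] [MonoidalCategory C]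
    [SymmetricCategory C] (X A Y B : C) :
    tensorμ X A Y B ≫ (β_ (X ⊗ Y) (A ⊗ B)).hom =
      ((β_ X A).hom ⊗ₘ (β_ Y B).hom) ≫ tensorμ A X B Y := by
  simp [tensorμ, SymmetricCategory.braiding_swap_eq_inv_braiding Y A,
    MonoidalCategory.tensorHom_def]

/-- Commutativity of the sum of 1-morphisms. -/
def sumBraiding (F G : Mor₁ M N) : Mor₂ (F.sum G) (G.sum F) :=
  ofApp (fun m => (β_ (F.functor.obj m) (G.functor.obj m)).hom)
    (fun f => BraidedCategory.braiding_naturality (F.functor.map f) (G.functor.map f))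
    (by
      simp only [Mor₁.sum_ε, Mor₁.sum_obj, Category.assoc]
      rw [BraidedCategory.braiding_naturality, leftUnitor_inv_braiding_assoc, unitors_inv_equal])
    (fun m m' => by
      simp only [Mor₁.sum_μ, Mor₁.sum_obj, Category.assoc]
      rw [BraidedCategory.braiding_naturality, reassoc_of% tensorμ_comp_braiding])
    (fun r m => by
      simp only [Mor₁.sum_lin, Mor₁.sum_obj, Category.assoc]
      rw [Functor.LaxBraided.braided, BraidedCategory.braiding_naturality_assoc])

/-- The zero 1-morphism is a left unit for the sum. -/
def sumZeroLeft (F : Mor₁ M N) : Mor₂ ((Mor₁.zero M N).sum F) F :=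
  ofApp (fun m => (λ_ (F.functor.obj m)).hom)
    (fun f => by
      simp only [Mor₁.sum_map, Mor₁.zero_map, Mor₁.sum_obj, Mor₁.zero_obj, id_tensorHom]
      exact leftUnitor_naturality _)
    (by
      simp only [Mor₁.sum_ε, Mor₁.zero_ε, Mor₁.sum_obj, Mor₁.zero_obj, id_tensorHom,
        Category.assoc]
      rw [leftUnitor_naturality, Iso.inv_hom_id_assoc])
    (fun m m' => by
      simp only [Mor₁.sum_μ, Mor₁.zero_μ, Mor₁.sum_obj, Mor₁.zero_obj, Category.assoc]
      rw [leftUnitor_monoidal, MonoidalCategory.tensorHom_def]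
      simp only [Category.assoc]
      rw [leftUnitor_naturality])
    (fun r m => by
      have h := Functor.LaxMonoidal.left_unitality (N.smul.obj r) (F.functor.obj m)
      simp only [Mor₁.sum_lin, Mor₁.zero_lin, Mor₁.sum_obj, Mor₁.zero_obj, Category.assoc,
        MonoidalCategory.tensorHom_def']
      rw [← h]
      exact leftUnitor_naturality _)

/-- The zero 1-morphism is a right unit for the sum. -/
def sumZeroRight (F : Mor₁ M N) : Mor₂ (F.sum (Mor₁.zero M N)) F :=
  vcomp (sumBraiding F _) (sumZeroLeft F)

/-- Associativity of the composition of 1-morphisms. -/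
def compAssoc (F : Mor₁ M N) (G : Mor₁ N P) (H : Mor₁ P Q) :
    Mor₂ ((F.comp G).comp H) (F.comp (G.comp H)) :=
  ofApp (fun _ => 𝟙 _) (fun f => (Category.comp_id _).trans (Category.id_comp _).symm)
    (by
      simp only [Mor₁.comp_ε, Mor₁.comp_map, Mor₁.comp_obj, Functor.map_comp, Category.assoc,
        Category.comp_id])
    (fun m m' => by
      simp only [Mor₁.comp_μ, Mor₁.comp_map, Mor₁.comp_obj, Functor.map_comp, Category.assoc,
        Category.comp_id, id_tensorHom, MonoidalCategory.whiskerLeft_id, Category.id_comp])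
    (fun r m => by
      simp only [Mor₁.comp_lin, Mor₁.comp_map, Mor₁.comp_obj, Functor.map_comp, Category.assoc,
        Category.comp_id, CategoryTheory.Functor.map_id, Category.id_comp])

/-- Precomposition is additive. -/
def compSum (L : Mor₁ P M) (F G : Mor₁ M N) :
    Mor₂ (L.comp (F.sum G)) ((L.comp F).sum (L.comp G)) :=
  ofApp (fun _ => 𝟙 _) (fun f => (Category.comp_id _).trans (Category.id_comp _).symm)
    (by
      simp only [Mor₁.comp_ε, Mor₁.sum_ε, Mor₁.sum_map, Mor₁.sum_obj, Mor₁.comp_obj,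
        Category.assoc, Category.comp_id, tensorHom_comp_tensorHom])
    (fun m m' => by
      simp only [Mor₁.comp_μ, Mor₁.sum_μ, Mor₁.sum_map, Mor₁.sum_obj, Mor₁.comp_obj,
        Category.assoc, Category.comp_id, tensorHom_comp_tensorHom, id_tensorHom,
        MonoidalCategory.whiskerLeft_id, Category.id_comp])
    (fun r m => by
      simp only [Mor₁.comp_lin, Mor₁.sum_lin, Mor₁.sum_map, Mor₁.sum_obj, Mor₁.comp_obj,
        Category.comp_id, CategoryTheory.Functor.map_id, Category.id_comp,
        tensorHom_comp_tensorHom_assoc])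

/-- Postcomposition is additive. -/
def compSumInv (F G : Mor₁ M N) (K : Mor₁ N P) :
    Mor₂ ((F.comp K).sum (G.comp K)) ((F.sum G).comp K) :=
  ofApp (fun m => μ K.functor (F.functor.obj m) (G.functor.obj m))
    (fun f => by
      simp only [Mor₁.comp_map, Mor₁.sum_map, Mor₁.comp_obj, Mor₁.sum_obj]
      exact Functor.LaxMonoidal.μ_natural _ _ _)
    (by
      have h := Functor.LaxMonoidal.left_unitality_inv K.functor (𝟙_ N.carrier)
      simp only [Mor₁.comp_ε, Mor₁.sum_ε, Mor₁.comp_obj, Mor₁.sum_obj, Category.assoc,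
        Functor.map_comp, ← tensorHom_comp_tensorHom, Functor.LaxMonoidal.μ_natural]
      rw [← h, MonoidalCategory.tensorHom_def', Category.assoc, Category.assoc,
        ← leftUnitor_inv_naturality_assoc, Category.assoc])
    (fun m m' => by
      have h := tensorμ_comp_μ_tensorHom_μ_comp_μ K.functor (F.functor.obj m) (G.functor.obj m)
        (F.functor.obj m') (G.functor.obj m')
      simp only [Mor₁.comp_μ, Mor₁.sum_μ, Mor₁.comp_obj, Mor₁.sum_obj, Category.assoc,
        Functor.map_comp, ← tensorHom_comp_tensorHom, Functor.LaxMonoidal.μ_natural]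
      rw [reassoc_of% h])
    (fun r m => by
      have h := K.lin_add r (F.functor.obj m) (G.functor.obj m)
      simp only [Mor₁.comp_lin, Mor₁.sum_lin, Mor₁.comp_obj, Mor₁.sum_obj, Category.assoc,
        Functor.map_comp, ← tensorHom_comp_tensorHom]
      rw [← h, Functor.LaxMonoidal.μ_natural_assoc])

/-- The evaluation `F + (-F) ⇒ 0`. -/
noncomputable def sumNeg (F : Mor₁ M N) : Mor₂ (F.sum (F.comp (Mor₁.neg N))) (Mor₁.zero M N) :=
  ofApp (fun m => negPairing N (F.functor.obj m))
    (fun f => (negPairing_natural N (F.functor.map f)).trans (Category.comp_id _).symm)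
    (by
      simp only [Mor₁.sum_ε, Mor₁.comp_ε, Mor₁.zero_ε, Mor₁.neg_ε, Mor₁.neg_map, Mor₁.sum_obj,
        Mor₁.comp_obj, Mor₁.neg_obj, Mor₁.zero_obj, Category.assoc]
      have h := pairing_comp (negUnit_spec N) (negPairing_natural N (ε F.functor))
      rw [Category.id_comp] at h
      rw [Iso.inv_comp_eq, Category.comp_id]
      exact h)
    (fun m m' => by
      simp only [Mor₁.sum_μ, Mor₁.comp_μ, Mor₁.zero_μ, Mor₁.neg_μ, Mor₁.neg_map, Mor₁.sum_obj,
        Mor₁.comp_obj, Mor₁.neg_obj, Mor₁.zero_obj, Category.assoc]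
      have h := pairing_comp (negTensor_spec N _ _) (negPairing_natural N (μ F.functor m m'))
      rw [Category.id_comp] at h
      rw [h, tensorPairing, reassoc_of% tensorμ_tensorμ])
    (fun r m => by
      have h := pairing_comp (negPairing_natural N (F.lin r m).hom) (negLin_spec N r _)
      rw [Category.comp_id] at h
      simp only [Mor₁.sum_lin, Mor₁.comp_lin, Mor₁.zero_lin, Mor₁.neg_lin, Mor₁.neg_map,
        Mor₁.sum_obj, Mor₁.comp_obj, Mor₁.neg_obj, Mor₁.zero_obj, Category.assoc]
      refine Eq.trans ?_ (congrArg (· ≫ ε (N.smul.obj r)) h)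
      simp only [smulPairing, Category.assoc, Functor.Monoidal.η_ε, Category.comp_id])

end Mor₂

end Calculus

/-! ### The relative image of a 1-morphism -/

section RelativeImage

variable {R : Type w} [Category.{w'} R] [MonoidalCategory R] [SymmetricCategory R]
  [IsTwoGroup R] [TwoRing R] {C D E : TwoModule.{w', w, u} R} {H : Mor₁ C D} {K : Mor₁ D E}

/-- For `χ : K ∘ H ⇒ 0`, the objects of the relative image of `H` are those of its source. -/
structure RelImage (χ : Mor₂ (H.comp K) (Mor₁.zero C E)) : Type u where
  obj : C.carrier

namespace RelImage

variable {χ : Mor₂ (H.comp K) (Mor₁.zero C E)}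

/-- The morphisms `x ⟶ y` of the relative image: the morphisms `H x ⟶ H y` compatible
with `χ`. -/
@[ext]
structure Hom (x y : RelImage χ) : Type u where
  hom : H.functor.obj x.obj ⟶ H.functor.obj y.obj
  compat : K.functor.map hom ≫ χ.toZero y.obj = χ.toZero x.obj

instance : Category (RelImage χ) where
  Hom := Hom
  id x := ⟨𝟙 _, by simp⟩
  comp f g := ⟨f.hom ≫ g.hom, by rw [Functor.map_comp, Category.assoc, g.compat, f.compat]⟩

@[ext]
theorem hom_ext {x y : RelImage χ} {f g : x ⟶ y} (h : f.hom = g.hom) : f = g := Hom.ext h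

@[simp]
theorem id_hom (x : RelImage χ) : (𝟙 x : x ⟶ x).hom = 𝟙 _ := rfl

@[simp]
theorem comp_hom {x y z : RelImage χ} (f : x ⟶ y) (g : y ⟶ z) :
    (f ≫ g).hom = f.hom ≫ g.hom := rfl

variable (χ) in
/-- The functor from the relative image to the target. -/
@[simps]
def toTarget : RelImage χ ⥤ D.carrier where
  obj x := H.functor.obj x.obj
  map f := f.hom

instance : (toTarget χ).Faithful where
  map_injective h := hom_ext h

variable (χ) in
/-- The functor from the source to the relative image. -/
@[simps]
def ofSource : C.carrier ⥤ RelImage χ where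
  obj x := ⟨x⟩
  map f := ⟨H.functor.map f, toZero_naturality χ f⟩

/-- The sum of two morphisms of the relative image. -/
def tensorMap {x y x' y' : RelImage χ} (f : x ⟶ y) (g : x' ⟶ y') :
    (⟨x.obj ⊗ x'.obj⟩ : RelImage χ) ⟶ ⟨y.obj ⊗ y'.obj⟩ :=
  ⟨δ H.functor _ _ ≫ (f.hom ⊗ₘ g.hom) ≫ μ H.functor _ _, by
    have h1 := toZero_tensor χ x.obj x'.obj
    have h2 := toZero_tensor χ y.obj y'.obj
    rw [← cancel_epi (μ K.functor _ _ ≫ K.functor.map (μ H.functor x.obj x'.obj)), h1]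
    simp only [Category.assoc] at h2
    simp only [Functor.map_comp, Category.assoc, Functor.Monoidal.map_μ_δ_assoc,
      ← Functor.LaxMonoidal.μ_natural_assoc, h2]
    rw [tensorHom_comp_tensorHom_assoc, f.compat, g.compat]⟩

instance : MonoidalCategoryStruct (RelImage χ) where
  tensorObj x y := ⟨x.obj ⊗ y.obj⟩
  tensorHom f g := tensorMap f g
  whiskerLeft x _ _ f := tensorMap (𝟙 x) f
  whiskerRight f y := tensorMap f (𝟙 y)
  tensorUnit := ⟨𝟙_ _⟩
  associator x y z := (ofSource χ).mapIso (α_ x.obj y.obj z.obj)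
  leftUnitor x := (ofSource χ).mapIso (λ_ x.obj)
  rightUnitor x := (ofSource χ).mapIso (ρ_ x.obj)

theorem tensorHom_hom {x y x' y' : RelImage χ} (f : x ⟶ y) (g : x' ⟶ y') :
    (f ⊗ₘ g).hom = δ H.functor _ _ ≫ (f.hom ⊗ₘ g.hom) ≫ μ H.functor _ _ := rfl

theorem whiskerLeft_hom (x : RelImage χ) {y y' : RelImage χ} (f : y ⟶ y') :
    (x ◁ f).hom = δ H.functor _ _ ≫ (_ ◁ f.hom) ≫ μ H.functor _ _ := by
  rw [← id_tensorHom]; rfl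

theorem whiskerRight_hom {x x' : RelImage χ} (f : x ⟶ x') (y : RelImage χ) :
    (f ▷ y).hom = δ H.functor _ _ ≫ (f.hom ▷ _) ≫ μ H.functor _ _ := by
  rw [← tensorHom_id]; rfl

variable (χ) in
/-- The monoidal structure of the relative image is induced from that of the target. -/
def inducingData : Monoidal.InducingFunctorData (toTarget χ) where
  μIso x y := Functor.Monoidal.μIso H.functor x.obj y.obj
  εIso := Functor.Monoidal.εIso H.functor
  whiskerLeft_eq x _ _ f := whiskerLeft_hom x f
  whiskerRight_eq f y := whiskerRight_hom f y
  tensorHom_eq f g := tensorHom_hom f g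
  associator_eq x y z := (Functor.Monoidal.map_associator H.functor x.obj y.obj z.obj).trans (by
    change _ = (δ H.functor (x.obj ⊗ y.obj) z.obj ≫ (δ H.functor x.obj y.obj ⊗ₘ 𝟙 _)) ≫
      (α_ _ _ _).hom ≫ (𝟙 _ ⊗ₘ μ H.functor y.obj z.obj) ≫ μ H.functor x.obj (y.obj ⊗ z.obj)
    simp only [tensorHom_id, id_tensorHom, Category.assoc])
  leftUnitor_eq x := (Functor.Monoidal.map_leftUnitor H.functor x.obj).trans (by
    simp only [Iso.trans_hom, tensorIso_hom, Iso.refl_hom, tensorHom_id,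
      Category.assoc]
    rfl)
  rightUnitor_eq x := (Functor.Monoidal.map_rightUnitor H.functor x.obj).trans (by
    simp only [Iso.trans_hom, tensorIso_hom, Iso.refl_hom, id_tensorHom,
      Category.assoc]
    rfl)

instance : MonoidalCategory (RelImage χ) := Monoidal.induced (toTarget χ) (inducingData χ)

instance : (toTarget χ).Monoidal := Monoidal.fromInducedMonoidal (toTarget χ) (inducingData χ)

instance : BraidedCategory (RelImage χ) :=
  BraidedCategory.ofFaithful (toTarget χ)
    (fun x y => (ofSource χ).mapIso (β_ x.obj y.obj))
    (fun x y => Functor.LaxBraided.braided (F := H.functor) x.obj y.obj)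

instance toTargetBraided : (toTarget χ).Braided where
  braided x y := Functor.LaxBraided.braided (F := H.functor) x.obj y.obj

instance : SymmetricCategory (RelImage χ) := SymmetricCategory.ofFaithful (toTarget χ)

instance : IsTwoGroup (RelImage χ) where
  isGroupoid :=
    { all_isIso := fun {x y} f => ⟨⟨⟨inv f.hom, by
        rw [Functor.map_inv, IsIso.inv_comp_eq, f.compat]⟩, by ext; simp, by ext; simp⟩⟩ }
  exists_neg x := by
    obtain ⟨y, ⟨i⟩⟩ := IsTwoGroup.exists_neg x.obj
    exact ⟨⟨y⟩, ⟨(ofSource χ).mapIso i⟩⟩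

end RelImage

end RelativeImage

/-- A natural transformation between monoidal functors to a 2-group that is compatible with the
sums is compatible with the units. -/
theorem unit_of_tensor {A : Type u₁} [Category.{v₁} A] [MonoidalCategory A] {B : Type u₂}
    [Category.{v₂} B] [MonoidalCategory B] [SymmetricCategory B] [IsTwoGroup B] {F G : A ⥤ B}
    [F.Monoidal] [G.Monoidal] (t : F ⟶ G)
    (h : μ F (𝟙_ A) (𝟙_ A) ≫ t.app (𝟙_ A ⊗ 𝟙_ A) =
      (t.app (𝟙_ A) ⊗ₘ t.app (𝟙_ A)) ≫ μ G (𝟙_ A) (𝟙_ A)) :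
    ε F ≫ t.app (𝟙_ A) = ε G := by
  apply whiskerRight_injective (G.obj (𝟙_ A))
  rw [← cancel_mono (μ G (𝟙_ A) (𝟙_ A) ≫ G.map (λ_ (𝟙_ A)).hom),
    ← Functor.LaxMonoidal.left_unitality, ← cancel_epi (𝟙_ B ◁ t.app (𝟙_ A)),
    leftUnitor_naturality, Functor.LaxMonoidal.left_unitality F (𝟙_ A), comp_whiskerRight,
    Category.assoc, Category.assoc, Category.assoc, t.naturality, reassoc_of% h,
    whisker_exchange_assoc, tensorHom_def'_assoc]

section RelativeImageModule

variable {R : Type w} [Category.{w'} R] [MonoidalCategory R] [SymmetricCategory R]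
  [IsTwoGroup R] [TwoRing R] {C D E : TwoModule.{w', w, u} R} {H : Mor₁ C D} {K : Mor₁ D E}

namespace RelImage

variable {χ : Mor₂ (H.comp K) (Mor₁.zero C E)}

theorem ofSource_tensorHom {x y x' y' : C.carrier} (f : x ⟶ y) (g : x' ⟶ y') :
    (ofSource χ).map (f ⊗ₘ g) = ((ofSource χ).map f ⊗ₘ (ofSource χ).map g) := by
  apply hom_ext
  change H.functor.map (f ⊗ₘ g) =
    δ H.functor x x' ≫ (H.functor.map f ⊗ₘ H.functor.map g) ≫ μ H.functor y y'
  rw [Functor.LaxMonoidal.μ_natural, Functor.Monoidal.δ_μ_assoc]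

theorem ofSource_whiskerLeft (x : C.carrier) {y y' : C.carrier} (f : y ⟶ y') :
    (ofSource χ).map (x ◁ f) = (ofSource χ).obj x ◁ (ofSource χ).map f := by
  rw [← id_tensorHom, ← id_tensorHom, ofSource_tensorHom, CategoryTheory.Functor.map_id]

theorem ofSource_whiskerRight {x x' : C.carrier} (f : x ⟶ x') (y : C.carrier) :
    (ofSource χ).map (f ▷ y) = (ofSource χ).map f ▷ (ofSource χ).obj y := by
  rw [← tensorHom_id, ← tensorHom_id, ofSource_tensorHom, CategoryTheory.Functor.map_id]

/-- The product `r · g` for a morphism `g` of the relative image. -/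
def smulMap (r : R) {x y : RelImage χ} (g : x ⟶ y) :
    (⟨bi C.smul r x.obj⟩ : RelImage χ) ⟶ ⟨bi C.smul r y.obj⟩ :=
  ⟨(H.lin r x.obj).hom ≫ (D.smul.obj r).map g.hom ≫ (H.lin r y.obj).inv, by
    have h : ∀ z : C.carrier, χ.toZero (bi C.smul r z) = K.functor.map (H.lin r z).hom ≫
        (K.lin r (H.functor.obj z)).hom ≫ (E.smul.obj r).map (χ.toZero z) ≫ η (E.smul.obj r) := by
      intro z
      have h1 : (K.functor.map (H.lin r z).hom ≫ (K.lin r _).hom) ≫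
          (E.smul.obj r).map (χ.toZero z) = χ.toZero (bi C.smul r z) ≫ ε (E.smul.obj r) :=
        χ.lin r z
      rw [Category.assoc] at h1
      rw [reassoc_of% h1, Functor.Monoidal.ε_η, Category.comp_id]
    have h2 := Mor₁.lin_map K r g.hom
    rw [h, h, ← g.compat]
    simp only [Functor.map_comp, Category.assoc, Iso.map_inv_hom_id_assoc, reassoc_of% h2]⟩

theorem smulMap_hom (r : R) {x y : RelImage χ} (g : x ⟶ y) :
    (smulMap r g).hom = (H.lin r x.obj).hom ≫ (D.smul.obj r).map g.hom ≫ (H.lin r y.obj).inv := rfl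

variable (χ) in
/-- The action of `R` on the relative image. -/
def smul : R ⥤ RelImage χ ⥤ RelImage χ where
  obj r :=
    { obj := fun x => ⟨bi C.smul r x.obj⟩
      map := fun g => smulMap r g
      map_id := fun x => hom_ext (by simp [smulMap_hom])
      map_comp := fun f g => hom_ext (by simp [smulMap_hom]) }
  map f :=
    { app := fun x => (ofSource χ).map ((C.smul.map f).app x.obj)
      naturality := fun x y g => hom_ext (by
        have h1 : ∀ z, H.functor.map ((C.smul.map f).app z) ≫ (H.lin _ z).hom =
            (H.lin _ z).hom ≫ (D.smul.map f).app _ := fun z => by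
          simpa [biMap] using H.lin_naturality f (𝟙 z)
        have h2 := h1 y.obj
        rw [← Iso.inv_comp_eq, ← Category.assoc, ← Iso.eq_comp_inv] at h2
        change ((H.lin _ x.obj).hom ≫ (D.smul.obj _).map g.hom ≫ (H.lin _ y.obj).inv) ≫
            H.functor.map ((C.smul.map f).app y.obj) = H.functor.map ((C.smul.map f).app x.obj) ≫
            (H.lin _ x.obj).hom ≫ (D.smul.obj _).map g.hom ≫ (H.lin _ y.obj).inv
        rw [reassoc_of% h1, Category.assoc, Category.assoc, h2, NatTrans.naturality_assoc]) }
  map_id r := by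
    ext x
    exact (congrArg (fun f => H.functor.map (f.app x.obj)) (C.smul.map_id r)).trans
      (H.functor.map_id _)
  map_comp f g := by
    ext x
    exact (congrArg (fun f => H.functor.map (f.app x.obj)) (C.smul.map_comp f g)).trans
      (H.functor.map_comp _ _)

theorem smul_map_ofSource (r : R) {x y : C.carrier} (f : x ⟶ y) :
    (ofSource χ).map ((C.smul.obj r).map f) = ((smul χ).obj r).map ((ofSource χ).map f) := by
  apply hom_ext
  have h := H.lin_map r f
  change H.functor.map ((C.smul.obj r).map f) =
    (H.lin r x).hom ≫ (D.smul.obj r).map (H.functor.map f) ≫ (H.lin r y).inv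
  rw [← reassoc_of% h, Iso.hom_inv_id, Category.comp_id]

theorem smul_μ_natural (r : R) {x y x' y' : RelImage χ} (f : x ⟶ y) (g : x' ⟶ y') :
    (((smul χ).obj r).map f ⊗ₘ ((smul χ).obj r).map g) ≫
        (ofSource χ).map (μ (C.smul.obj r) y.obj y'.obj) =
      (ofSource χ).map (μ (C.smul.obj r) x.obj x'.obj) ≫ ((smul χ).obj r).map (f ⊗ₘ g) := by
  apply hom_ext
  have h1 := H.lin_add r x.obj x'.obj
  have h2 := H.lin_add r y.obj y'.obj
  change (δ H.functor _ _ ≫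
      (((H.lin r x.obj).hom ≫ (D.smul.obj r).map f.hom ≫ (H.lin r y.obj).inv) ⊗ₘ
        ((H.lin r x'.obj).hom ≫ (D.smul.obj r).map g.hom ≫ (H.lin r y'.obj).inv)) ≫
      μ H.functor _ _) ≫ H.functor.map (μ (C.smul.obj r) y.obj y'.obj) =
    H.functor.map (μ (C.smul.obj r) x.obj x'.obj) ≫ (H.lin r (x.obj ⊗ x'.obj)).hom ≫
      (D.smul.obj r).map (δ H.functor _ _ ≫ (f.hom ⊗ₘ g.hom) ≫ μ H.functor _ _) ≫
      (H.lin r (y.obj ⊗ y'.obj)).inv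
  have h3 : ∀ {Z} (k : _ ⟶ Z), H.functor.map (μ (C.smul.obj r) x.obj x'.obj) ≫
      (H.lin r (x.obj ⊗ x'.obj)).hom ≫ k = δ H.functor _ _ ≫
      ((H.lin r x.obj).hom ⊗ₘ (H.lin r x'.obj).hom) ≫ addR D.smul r _ _ ≫
        (D.smul.obj r).map (μ H.functor _ _) ≫ k := by
    intro Z k
    rw [← reassoc_of% h1, Functor.Monoidal.δ_μ_assoc]
  rw [h3, ← cancel_mono (H.lin r (y.obj ⊗ y'.obj)).hom]
  simp only [Category.assoc, h2, Functor.map_comp, Iso.inv_hom_id, Category.comp_id,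
    ← tensorHom_comp_tensorHom, Functor.Monoidal.map_μ_δ_assoc]
  have h4 : ((H.lin r y.obj).inv ⊗ₘ (H.lin r y'.obj).inv) ≫
      ((H.lin r y.obj).hom ⊗ₘ (H.lin r y'.obj).hom) = 𝟙 _ := by
    rw [tensorHom_comp_tensorHom, Iso.inv_hom_id, Iso.inv_hom_id, id_tensorHom_id]
  rw [← Functor.LaxMonoidal.μ_natural_assoc, reassoc_of% h4]

instance (r : R) : ((smul χ).obj r).Monoidal :=
  Functor.CoreMonoidal.toMonoidal
    { εIso := (ofSource χ).mapIso (Functor.Monoidal.εIso (C.smul.obj r))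
      μIso x y := (ofSource χ).mapIso (Functor.Monoidal.μIso (C.smul.obj r) x.obj y.obj)
      μIso_hom_natural_left f z := by
        have := smul_μ_natural r f (𝟙 z)
        rw [CategoryTheory.Functor.map_id, tensorHom_id, tensorHom_id] at this
        exact this
      μIso_hom_natural_right z f := by
        have := smul_μ_natural r (𝟙 z) f
        rw [CategoryTheory.Functor.map_id, id_tensorHom, id_tensorHom] at this
        exact this
      associativity x y z := by
        have h := congrArg (ofSource χ).map
          (Functor.LaxMonoidal.associativity (C.smul.obj r) x.obj y.obj z.obj)
        simp only [Functor.map_comp, ofSource_whiskerLeft, ofSource_whiskerRight,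
          smul_map_ofSource] at h
        exact h
      left_unitality x := by
        have h := congrArg (ofSource χ).map
          (Functor.LaxMonoidal.left_unitality (C.smul.obj r) x.obj)
        simp only [Functor.map_comp, ofSource_whiskerRight, smul_map_ofSource] at h
        exact h
      right_unitality x := by
        have h := congrArg (ofSource χ).map
          (Functor.LaxMonoidal.right_unitality (C.smul.obj r) x.obj)
        simp only [Functor.map_comp, ofSource_whiskerLeft, smul_map_ofSource] at h
        exact h }

instance (r : R) : ((smul χ).obj r).Braided where
  braided x y := by
    have h := congrArg (ofSource χ).map
      (Functor.LaxBraided.braided (F := C.smul.obj r) x.obj y.obj)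
    simp only [Functor.map_comp, smul_map_ofSource] at h
    exact h

instance (x : RelImage χ) : ((smul χ).flip.obj x).Monoidal :=
  Functor.CoreMonoidal.toMonoidal
    { εIso := (ofSource χ).mapIso (Functor.Monoidal.εIso (C.smul.flip.obj x.obj))
      μIso r s := (ofSource χ).mapIso (Functor.Monoidal.μIso (C.smul.flip.obj x.obj) r s)
      μIso_hom_natural_left f z := by
        have h := congrArg (ofSource χ).map
          (Functor.LaxMonoidal.μ_natural_left (F := C.smul.flip.obj x.obj) f z)
        simp only [Functor.map_comp, ofSource_whiskerRight] at h
        exact h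
      μIso_hom_natural_right z f := by
        have h := congrArg (ofSource χ).map
          (Functor.LaxMonoidal.μ_natural_right (F := C.smul.flip.obj x.obj) z f)
        simp only [Functor.map_comp, ofSource_whiskerLeft] at h
        exact h
      associativity r s t := by
        have h := congrArg (ofSource χ).map
          (Functor.LaxMonoidal.associativity (C.smul.flip.obj x.obj) r s t)
        simp only [Functor.map_comp, ofSource_whiskerLeft, ofSource_whiskerRight] at h
        exact h
      left_unitality r := by
        have h := congrArg (ofSource χ).map
          (Functor.LaxMonoidal.left_unitality (C.smul.flip.obj x.obj) r)
        simp only [Functor.map_comp, ofSource_whiskerRight] at h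
        exact h
      right_unitality r := by
        have h := congrArg (ofSource χ).map
          (Functor.LaxMonoidal.right_unitality (C.smul.flip.obj x.obj) r)
        simp only [Functor.map_comp, ofSource_whiskerLeft] at h
        exact h }

instance (x : RelImage χ) : ((smul χ).flip.obj x).Braided where
  braided r s := by
    have h := congrArg (ofSource χ).map
      (Functor.LaxBraided.braided (F := C.smul.flip.obj x.obj) r s)
    simp only [Functor.map_comp] at h
    exact h

theorem ofSource_tensorμ (x y z t : C.carrier) :
    (ofSource χ).map (tensorμ x y z t) = tensorμ ((ofSource χ).obj x) ((ofSource χ).obj y)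
      ((ofSource χ).obj z) ((ofSource χ).obj t) := by
  simp only [tensorμ, Functor.map_comp, ofSource_whiskerLeft, ofSource_whiskerRight]
  rfl

theorem biMap_hom {r r' : R} (f : r ⟶ r') {x y : RelImage χ} (g : x ⟶ y) :
    (biMap (smul χ) f g).hom =
      (H.lin r x.obj).hom ≫ biMap D.smul f g.hom ≫ (H.lin r' y.obj).inv := by
  have h1 : H.functor.map ((C.smul.map f).app x.obj) ≫ (H.lin _ x.obj).hom =
      (H.lin _ x.obj).hom ≫ (D.smul.map f).app _ := by
    simpa [biMap] using H.lin_naturality f (𝟙 x.obj)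
  change H.functor.map ((C.smul.map f).app x.obj) ≫ (H.lin _ x.obj).hom ≫
    (D.smul.obj _).map g.hom ≫ (H.lin _ y.obj).inv = _
  rw [reassoc_of% h1, biMap, Category.assoc]

theorem smul_flip_natural (r s : R) {x y : RelImage χ} (g : x ⟶ y) :
    μ ((smul χ).flip.obj x) r s ≫ ((smul χ).flip.map g).app (r ⊗ s) =
      (((smul χ).flip.map g).app r ⊗ₘ ((smul χ).flip.map g).app s) ≫
        μ ((smul χ).flip.obj y) r s := by
  apply hom_ext
  have h1 := H.add_lin r s x.obj
  have h2 := H.add_lin r s y.obj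
  have h5 : addL D.smul r s _ ≫ (D.smul.obj (r ⊗ s)).map g.hom =
      ((D.smul.obj r).map g.hom ⊗ₘ (D.smul.obj s).map g.hom) ≫ addL D.smul r s _ :=
    (Biadditive.isMonoidal_flip_map (T := D.smul) g.hom).tensor r s
  change H.functor.map (addL C.smul r s x.obj) ≫ (H.lin (r ⊗ s) x.obj).hom ≫
      (D.smul.obj (r ⊗ s)).map g.hom ≫ (H.lin (r ⊗ s) y.obj).inv =
    (δ H.functor _ _ ≫
      (((H.lin r x.obj).hom ≫ (D.smul.obj r).map g.hom ≫ (H.lin r y.obj).inv) ⊗ₘ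
        ((H.lin s x.obj).hom ≫ (D.smul.obj s).map g.hom ≫ (H.lin s y.obj).inv)) ≫
      μ H.functor _ _) ≫ H.functor.map (addL C.smul r s y.obj)
  have h3 : ∀ {Z} (k : _ ⟶ Z), H.functor.map (addL C.smul r s x.obj) ≫
      (H.lin (r ⊗ s) x.obj).hom ≫ k = δ H.functor _ _ ≫
      ((H.lin r x.obj).hom ⊗ₘ (H.lin s x.obj).hom) ≫ addL D.smul r s _ ≫ k := by
    intro Z k
    rw [← reassoc_of% h1, Functor.Monoidal.δ_μ_assoc]
  rw [h3, ← cancel_mono (H.lin (r ⊗ s) y.obj).hom]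
  simp only [Category.assoc, h2, Iso.inv_hom_id, Category.comp_id, ← tensorHom_comp_tensorHom]
  have h4 : ((H.lin r y.obj).inv ⊗ₘ (H.lin s y.obj).inv) ≫
      ((H.lin r y.obj).hom ⊗ₘ (H.lin s y.obj).hom) = 𝟙 _ := by
    rw [tensorHom_comp_tensorHom, Iso.inv_hom_id, Iso.inv_hom_id, id_tensorHom_id]
  rw [reassoc_of% h4, h5]

instance : Biadditive (smul χ) where
  isMonoidal_map {r s} f :=
    { unit := by
        have h := congrArg (ofSource χ).map (Biadditive.isMonoidal_map (T := C.smul) f).unit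
        rw [Functor.map_comp] at h
        exact h
      tensor := fun x y => by
        have h := congrArg (ofSource χ).map
          ((Biadditive.isMonoidal_map (T := C.smul) f).tensor x.obj y.obj)
        rw [Functor.map_comp, Functor.map_comp, ofSource_tensorHom] at h
        exact h }
  isMonoidal_flip_map {x y} g :=
    { unit := unit_of_tensor ((smul χ).flip.map g) (smul_flip_natural _ _ g)
      tensor := fun r s => smul_flip_natural r s g }
  interchange r r' x y := by
    have h := congrArg (ofSource χ).map
      (Biadditive.interchange (T := C.smul) r r' x.obj y.obj)
    simp only [Functor.map_comp, ofSource_tensorHom, ofSource_tensorμ] at h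
    exact h
  zero_add r s := by
    have h := congrArg (ofSource χ).map (Biadditive.zero_add (T := C.smul) r s)
    simp only [Functor.map_comp, ofSource_tensorHom] at h
    exact h

variable (χ) in
/-- The relative image of `H` as an `R`-2-module. -/
def module : TwoModule.{w', w, u} R where
  carrier := RelImage χ
  smul := smul χ
  assoc r s x := (ofSource χ).mapIso (C.assoc r s x.obj)
  oneSmul x := (ofSource χ).mapIso (C.oneSmul x.obj)
  assoc_naturality {r r' s s' x y} f g h := by
    have h1 := H.lin_assoc r s x.obj
    have h2 := H.lin_assoc r' s' y.obj
    have h3 := D.assoc_naturality f g h.hom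
    have h4 : biMap D.smul f ((H.lin s x.obj).hom ≫ biMap D.smul g h.hom ≫
        (H.lin s' y.obj).inv) = (D.smul.obj r).map (H.lin s x.obj).hom ≫
        biMap D.smul f (biMap D.smul g h.hom) ≫ (D.smul.obj r').map (H.lin s' y.obj).inv := by
      simp only [biMap, Functor.map_comp, Category.assoc, NatTrans.naturality_assoc]
    apply hom_ext
    refine Eq.trans (b := ((H.lin (bi TwoRing.mul r s) x.obj).hom ≫
      biMap D.smul (biMap TwoRing.mul f g) h.hom ≫ (H.lin (bi TwoRing.mul r' s') y.obj).inv) ≫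
      H.functor.map (C.assoc r' s' y.obj).hom) ?_ (Eq.trans (b :=
      H.functor.map (C.assoc r s x.obj).hom ≫ (H.lin r (bi C.smul s x.obj)).hom ≫
      biMap D.smul f ((H.lin s x.obj).hom ≫ biMap D.smul g h.hom ≫
        (H.lin s' y.obj).inv) ≫ (H.lin r' (bi C.smul s' y.obj)).inv) ?_ ?_)
    · exact congrArg (· ≫ H.functor.map (C.assoc r' s' y.obj).hom)
        (biMap_hom (biMap TwoRing.mul f g) h)
    · rw [h4]
      simp only [Category.assoc]
      rw [reassoc_of% h1, ← reassoc_of% h3,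
        ← cancel_mono ((H.lin r' (bi C.smul s' y.obj)).hom ≫
          (D.smul.obj r').map (H.lin s' y.obj).hom)]
      simp only [Category.assoc, h2, Iso.inv_hom_id_assoc, ← Functor.map_comp, Iso.inv_hom_id,
        CategoryTheory.Functor.map_id, Category.comp_id]
    · exact congrArg (H.functor.map (C.assoc r s x.obj).hom ≫ ·)
        ((biMap_hom f (biMap (smul χ) g h)).trans (by rw [biMap_hom]; rfl)).symm
  oneSmul_naturality {x y} h := by
    have h1 := H.lin_one x.obj
    have h2 := H.lin_one y.obj
    apply hom_ext
    change ((H.lin TwoRing.one x.obj).hom ≫ (D.smul.obj TwoRing.one).map h.hom ≫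
      (H.lin TwoRing.one y.obj).inv) ≫ H.functor.map (C.oneSmul y.obj).hom =
      H.functor.map (C.oneSmul x.obj).hom ≫ h.hom
    rw [← h1, ← h2]
    simp only [Category.assoc, Iso.inv_hom_id_assoc, D.oneSmul_naturality]
  pentagon r s t x := by
    have h := congrArg (ofSource χ).map (C.pentagon r s t x.obj)
    simp only [Functor.map_comp, smul_map_ofSource] at h
    exact h
  triangle r x := by
    have h := congrArg (ofSource χ).map (C.triangle r x.obj)
    simp only [Functor.map_comp, smul_map_ofSource] at h
    exact h
  assoc_add₁ r r' s x := by
    have h := congrArg (ofSource χ).map (C.assoc_add₁ r r' s x.obj)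
    simp only [Functor.map_comp, ofSource_tensorHom] at h
    exact h
  assoc_add₂ r s s' x := by
    have h := congrArg (ofSource χ).map (C.assoc_add₂ r s s' x.obj)
    simp only [Functor.map_comp, ofSource_tensorHom, smul_map_ofSource] at h
    exact h
  assoc_add₃ r s x y := by
    have h := congrArg (ofSource χ).map (C.assoc_add₃ r s x.obj y.obj)
    simp only [Functor.map_comp, ofSource_tensorHom, smul_map_ofSource] at h
    exact h
  assoc_zero r s := by
    have h := congrArg (ofSource χ).map (C.assoc_zero r s)
    simp only [Functor.map_comp, smul_map_ofSource] at h
    exact h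
  oneSmul_add x y := by
    have h := congrArg (ofSource χ).map (C.oneSmul_add x.obj y.obj)
    simp only [Functor.map_comp, ofSource_tensorHom] at h
    exact h
  oneSmul_zero := by
    have h := congrArg (ofSource χ).map C.oneSmul_zero
    simp only [Functor.map_comp] at h
    exact h.trans ((ofSource χ).map_id _)

variable (χ) in
/-- The faithful 1-morphism from the relative image to the target. -/
def incl : Mor₁ (module χ) D where
  functor := toTarget χ
  braided := toTargetBraided
  lin r x := H.lin r x.obj
  lin_naturality {r r' x y} f h := by
    refine (congrArg (· ≫ (H.lin r' y.obj).hom) (biMap_hom f h)).trans ?_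
    change ((H.lin r x.obj).hom ≫ biMap D.smul f h.hom ≫ (H.lin r' y.obj).inv) ≫
      (H.lin r' y.obj).hom = (H.lin r x.obj).hom ≫ biMap D.smul f h.hom
    rw [Category.assoc, Category.assoc, Iso.inv_hom_id, Category.comp_id]
  lin_add r x y := H.lin_add r x.obj y.obj
  add_lin r s x := H.add_lin r s x.obj
  lin_zero r := H.lin_zero r
  lin_assoc r s x := H.lin_assoc r s x.obj
  lin_one x := H.lin_one x.obj

end RelImage

end RelativeImageModule

/-! ### Extension along a relatively exact sequence -/

section Extension

variable {R : Type w} [Category.{w'} R] [MonoidalCategory R] [SymmetricCategory R]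
  [IsTwoGroup R] [TwoRing R]

section Representatives

variable {B C D : TwoModule.{w', w, u} R} {G : Mor₁ B C} {H : Mor₁ C D}
  (ψ : Mor₂ (G.comp H) (Mor₁.zero B D))

theorem cokerCollapse_natural (b : B.carrier) {y z : C.carrier} (f : y ⟶ z) :
    H.functor.map (G.functor.obj b ◁ f) ≫ cokerCollapse ψ b z =
      cokerCollapse ψ b y ≫ H.functor.map f := by
  simp only [cokerCollapse, Category.assoc, ← leftUnitor_naturality]
  rw [← Functor.OplaxMonoidal.δ_natural_right_assoc, whisker_exchange_assoc]

theorem toZero_unit :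
    ε H.functor ≫ H.functor.map (ε G.functor) ≫ ψ.toZero (𝟙_ B.carrier) = 𝟙 _ :=
  (Category.assoc _ _ _).symm.trans ψ.isMonoidal.unit

theorem cokerCollapse_unit (y : C.carrier) :
    H.functor.map ((λ_ y).inv ≫ ε G.functor ▷ y) ≫ cokerCollapse ψ (𝟙_ B.carrier) y = 𝟙 _ := by
  have h : H.functor.map (ε G.functor) ≫ ψ.toZero (𝟙_ B.carrier) = η H.functor := by
    rw [← cancel_epi (ε H.functor), toZero_unit, Functor.Monoidal.ε_η]
  rw [cokerCollapse, Functor.map_comp, Category.assoc,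
    ← Functor.OplaxMonoidal.δ_natural_left_assoc, ← comp_whiskerRight_assoc]
  erw [h]
  rw [← Category.assoc, ← Category.assoc, Category.assoc (H.functor.map _),
    ← Functor.OplaxMonoidal.left_unitality, Iso.inv_hom_id]

theorem cokerCollapse_whiskerRight (b : B.carrier) (y w : C.carrier) :
    H.functor.map (α_ _ _ _).hom ≫ cokerCollapse ψ b (y ⊗ w) =
      δ H.functor _ _ ≫ cokerCollapse ψ b y ▷ _ ≫ μ H.functor _ _ := by
  have h : ψ.toZero b ▷ H.functor.obj y ▷ H.functor.obj w ≫
      (λ_ (H.functor.obj y)).hom ▷ H.functor.obj w =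
        (α_ _ _ _).hom ≫ ψ.toZero b ▷ _ ≫ (λ_ _).hom := by
    simp only [leftUnitor_whiskerRight, whiskerRight_tensor, Category.assoc,
      Iso.hom_inv_id_assoc]
  simp only [cokerCollapse, Category.assoc, comp_whiskerRight]
  rw [reassoc_of% h, Functor.OplaxMonoidal.δ_comp_δ_whiskerRight_assoc, Iso.inv_hom_id_assoc,
    ← leftUnitor_naturality, whisker_exchange_assoc, ← whiskerLeft_comp_assoc,
    Functor.Monoidal.δ_μ, whiskerLeft_id, Category.id_comp]

theorem cokerCollapse_tensor (b b' : B.carrier) (z : C.carrier) :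
    H.functor.map ((α_ _ _ _).inv ≫ μ G.functor b b' ▷ z) ≫ cokerCollapse ψ (b ⊗ b') z =
      cokerCollapse ψ b (G.functor.obj b' ⊗ z) ≫ cokerCollapse ψ b' z := by
  have h := toZero_tensor ψ b b'
  have h' : H.functor.map (μ G.functor b b') ≫ ψ.toZero (b ⊗ b') =
      cokerCollapse ψ b (G.functor.obj b') ≫ ψ.toZero b' := by
    rw [← cancel_epi (μ H.functor _ _), ← Category.assoc, h, cokerCollapse,
      MonoidalCategory.tensorHom_def]
    simp
  rw [cokerCollapse, Functor.map_comp, Category.assoc,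
    ← Functor.OplaxMonoidal.δ_natural_left_assoc, ← comp_whiskerRight_assoc]
  erw [h']
  have h2 := cokerCollapse_whiskerRight ψ b (G.functor.obj b') z
  rw [← cancel_epi (H.functor.map (α_ _ _ _).hom), ← Functor.map_comp_assoc, Iso.hom_inv_id,
    CategoryTheory.Functor.map_id, Category.id_comp, reassoc_of% h2, comp_whiskerRight,
    cokerCollapse.eq_1 ψ b']
  simp

theorem cokerCollapse_smul (r : R) (b : B.carrier) (y : C.carrier) :
    H.functor.map (δ (C.smul.obj r) (G.functor.obj b) y ≫ (G.lin r b).inv ▷ _) ≫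
        cokerCollapse ψ (bi B.smul r b) (bi C.smul r y) ≫ (H.lin r y).hom =
      (H.lin r _).hom ≫ (D.smul.obj r).map (cokerCollapse ψ b y) := by
  have h := H.lin_add r (G.functor.obj b) y
  have h1 : (H.functor.map (G.lin r b).hom ≫ (H.lin r _).hom) ≫
          (D.smul.obj r).map (ψ.toZero b) = ψ.toZero (bi B.smul r b) ≫ ε (D.smul.obj r) :=
    ψ.lin r b
  have h2 : H.functor.map (G.lin r b).inv ≫ ψ.toZero (bi B.smul r b) =
      (H.lin r _).hom ≫ (D.smul.obj r).map (ψ.toZero b) ≫ η (D.smul.obj r) := by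
    rw [← cancel_epi (H.functor.map (G.lin r b).hom), ← Category.assoc, ← Functor.map_comp,
      Iso.hom_inv_id, CategoryTheory.Functor.map_id, Category.id_comp, ← Category.assoc,
      ← Category.assoc, h1, Category.assoc, Functor.Monoidal.ε_η, Category.comp_id]
  have h3 : H.functor.map (δ (C.smul.obj r) (G.functor.obj b) y) ≫ δ H.functor _ _ ≫
      ((H.lin r _).hom ⊗ₘ (H.lin r y).hom) =
      (H.lin r _).hom ≫ (D.smul.obj r).map (δ H.functor _ _) ≫ δ (D.smul.obj r) _ _ := by
    rw [← cancel_epi (μ H.functor _ _ ≫ H.functor.map (addR C.smul r (G.functor.obj b) y)),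
      Category.assoc, Category.assoc, reassoc_of% h]
    simp [← Functor.map_comp_assoc]
  rw [cokerCollapse, Functor.map_comp, Category.assoc, Category.assoc, Category.assoc,
    ← Functor.OplaxMonoidal.δ_natural_left_assoc, ← comp_whiskerRight_assoc]
  erw [h2]
  have h4 : (D.smul.obj r).map (cokerCollapse ψ b y) =
      (D.smul.obj r).map (δ H.functor _ _) ≫ δ (D.smul.obj r) _ _ ≫
        ((D.smul.obj r).map (ψ.toZero b) ≫ η (D.smul.obj r)) ▷ _ ≫ (λ_ _).hom := by
    rw [cokerCollapse, Functor.map_comp, Functor.map_comp, Functor.Monoidal.map_leftUnitor,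
      ← Functor.OplaxMonoidal.δ_natural_left_assoc, comp_whiskerRight, Category.assoc]
  rw [← leftUnitor_naturality, ← whisker_exchange_assoc, comp_whiskerRight, Category.assoc, h4,
    ← reassoc_of% h3, MonoidalCategory.tensorHom_def', Category.assoc, comp_whiskerRight,
    Category.assoc]

/-- The class of `f` in the relative cokernel. -/
def cokerPreOfMap (G : Mor₁ B C) {x y : C.carrier} (f : x ⟶ y) : CokerPre G x y :=
  ⟨𝟙_ _, f ≫ (λ_ y).inv ≫ ε G.functor ▷ y⟩

/-- The composition of representatives in the relative cokernel. -/
def cokerPreComp {x y z : C.carrier} (p : CokerPre G x y) (q : CokerPre G y z) :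
    CokerPre G x z :=
  ⟨p.1 ⊗ q.1, p.2 ≫ _ ◁ q.2 ≫ (α_ _ _ _).inv ≫ μ G.functor p.1 q.1 ▷ z⟩

/-- The sum of a representative with an object. -/
def cokerPreWhiskerRight {x y : C.carrier} (p : CokerPre G x y) (z : C.carrier) :
    CokerPre G (x ⊗ z) (y ⊗ z) :=
  ⟨p.1, p.2 ▷ z ≫ (α_ _ _ _).hom⟩

/-- The multiple of a representative. -/
def cokerPreSmul (r : R) {x y : C.carrier} (p : CokerPre G x y) :
    CokerPre G (bi C.smul r x) (bi C.smul r y) :=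
  ⟨bi B.smul r p.1, (C.smul.obj r).map p.2 ≫ δ (C.smul.obj r) _ y ≫ (G.lin r p.1).inv ▷ _⟩

theorem cokerPreMap_ofMap {x y : C.carrier} (f : x ⟶ y) :
    cokerPreMap ψ x y (cokerPreOfMap G f) = H.functor.map f := by
  rw [cokerPreMap, cokerPreOfMap, Functor.map_comp, Category.assoc, cokerCollapse_unit,
    Category.comp_id]

theorem cokerPreMap_comp {x y z : C.carrier} (p : CokerPre G x y) (q : CokerPre G y z) :
    cokerPreMap ψ x z (cokerPreComp p q) = cokerPreMap ψ x y p ≫ cokerPreMap ψ y z q := by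
  rw [cokerPreMap, cokerPreMap, cokerPreMap, cokerPreComp, Functor.map_comp, Functor.map_comp,
    Category.assoc, Category.assoc, cokerCollapse_tensor, Category.assoc,
    reassoc_of% cokerCollapse_natural]

theorem cokerPreMap_whiskerRight {x y : C.carrier} (p : CokerPre G x y) (z : C.carrier) :
    cokerPreMap ψ _ _ (cokerPreWhiskerRight p z) =
      δ H.functor _ _ ≫ cokerPreMap ψ x y p ▷ _ ≫ μ H.functor _ _ := by
  rw [cokerPreMap, cokerPreMap, cokerPreWhiskerRight, Functor.map_comp, Category.assoc,
    cokerCollapse_whiskerRight, comp_whiskerRight, Category.assoc,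
    Functor.OplaxMonoidal.δ_natural_left_assoc]

theorem cokerPreMap_smul (r : R) {x y : C.carrier} (p : CokerPre G x y) :
    cokerPreMap ψ _ _ (cokerPreSmul r p) ≫ (H.lin r y).hom =
      (H.lin r x).hom ≫ (D.smul.obj r).map (cokerPreMap ψ x y p) := by
  rw [cokerPreMap, cokerPreMap, cokerPreSmul, Functor.map_comp, Category.assoc, Category.assoc,
    cokerCollapse_smul, Functor.map_comp, ← reassoc_of% Mor₁.lin_map]

end Representatives

section

variable {A B C D E J : TwoModule.{w', w, u} R} {F : Mor₁ A B} {G : Mor₁ B C} {H : Mor₁ C D}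
  {K : Mor₁ D E} {φ : Mor₂ (F.comp G) (Mor₁.zero A C)} {ψ : Mor₂ (G.comp H) (Mor₁.zero B D)}
  {χ : Mor₂ (H.comp K) (Mor₁.zero C E)} {hψ : φ.Compat ψ} {Δ : Mor₁ C J}
  {θ : Mor₂ (G.comp Δ) (Mor₁.zero B J)}

theorem RelativeExact.exists_rep (hex : RelativeExact φ ψ χ hψ) {x y : RelImage χ} (g : x ⟶ y) :
    ∃ p : CokerPre G x.obj y.obj, cokerPreMap ψ _ _ p = g.hom := by
  obtain ⟨q, hq⟩ := hex.2 x.obj y.obj g.hom g.compat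
  obtain ⟨p, rfl⟩ := Quot.exists_rep q
  exact ⟨p, hq⟩

theorem RelativeExact.eq_of_rep (hex : RelativeExact φ ψ χ hψ) (hθ : φ.Compat θ)
    {x y : C.carrier} {p q : CokerPre G x y} (h : cokerPreMap ψ x y p = cokerPreMap ψ x y q) :
    cokerPreMap θ x y p = cokerPreMap θ x y q := by
  have : (Quot.mk _ p : CokerHom φ x y) = Quot.mk _ q := hex.1 x y h
  exact congrArg (cokerMap hθ x y) this

/-- The action of `Δ` on the morphisms of the relative image. -/
noncomputable def imageMap (Δ : Mor₁ C J) (θ : Mor₂ (G.comp Δ) (Mor₁.zero B J))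
    (hex : RelativeExact φ ψ χ hψ) {x y : RelImage χ} (g : x ⟶ y) :
    Δ.functor.obj x.obj ⟶ Δ.functor.obj y.obj :=
  cokerPreMap θ _ _ (hex.exists_rep g).choose

theorem imageMap_eq (hex : RelativeExact φ ψ χ hψ) (hθ : φ.Compat θ) {x y : RelImage χ}
    {g : x ⟶ y} {p : CokerPre G x.obj y.obj} (h : cokerPreMap ψ _ _ p = g.hom) :
    imageMap Δ θ hex g = cokerPreMap θ _ _ p :=
  hex.eq_of_rep hθ ((hex.exists_rep g).choose_spec.trans h.symm)

theorem imageMap_ofSource (hex : RelativeExact φ ψ χ hψ) (hθ : φ.Compat θ) {x y : C.carrier}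
    (f : x ⟶ y) : imageMap Δ θ hex ((RelImage.ofSource χ).map f) = Δ.functor.map f :=
  (imageMap_eq hex hθ (cokerPreMap_ofMap ψ f)).trans (cokerPreMap_ofMap θ f)

/-- The functor induced by `Δ` on the relative image. -/
noncomputable def imageFunctor (Δ : Mor₁ C J) (θ : Mor₂ (G.comp Δ) (Mor₁.zero B J))
    (hex : RelativeExact φ ψ χ hψ) (hθ : φ.Compat θ) : RelImage χ ⥤ J.carrier where
  obj x := Δ.functor.obj x.obj
  map g := imageMap Δ θ hex g
  map_id x := by
    have h := imageMap_ofSource (Δ := Δ) hex hθ (𝟙 x.obj)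
    rw [CategoryTheory.Functor.map_id, CategoryTheory.Functor.map_id] at h
    exact h
  map_comp {x y z} f g := by
    obtain ⟨p, hp⟩ := hex.exists_rep f
    obtain ⟨q, hq⟩ := hex.exists_rep g
    rw [imageMap_eq hex hθ hp, imageMap_eq hex hθ hq, ← cokerPreMap_comp]
    exact imageMap_eq hex hθ ((cokerPreMap_comp ψ p q).trans (by rw [hp, hq]; rfl))

theorem imageFunctor_map_ofSource (hex : RelativeExact φ ψ χ hψ) (hθ : φ.Compat θ)
    {x y : C.carrier} (f : x ⟶ y) :
    (imageFunctor Δ θ hex hθ).map ((RelImage.ofSource χ).map f) = Δ.functor.map f :=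
  imageMap_ofSource hex hθ f

end

end Extension

section ImageMorphism

variable {R : Type w} [Category.{w'} R] [MonoidalCategory R] [SymmetricCategory R]
  [IsTwoGroup R] [TwoRing R] {A B C D E J : TwoModule.{w', w, u} R} {F : Mor₁ A B}
  {G : Mor₁ B C} {H : Mor₁ C D}
  {K : Mor₁ D E} {φ : Mor₂ (F.comp G) (Mor₁.zero A C)} {ψ : Mor₂ (G.comp H) (Mor₁.zero B D)}
  {χ : Mor₂ (H.comp K) (Mor₁.zero C E)} {hψ : φ.Compat ψ} {Δ : Mor₁ C J}
  {θ : Mor₂ (G.comp Δ) (Mor₁.zero B J)}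
  (hex : RelativeExact φ ψ χ hψ)

theorem imageMap_whiskerRight (hθ : φ.Compat θ) {x y : RelImage χ} (f : x ⟶ y) (z : RelImage χ) :
    imageMap Δ θ hex f ▷ Δ.functor.obj z.obj ≫ μ Δ.functor y.obj z.obj =
      μ Δ.functor x.obj z.obj ≫ imageMap Δ θ hex (f ▷ z) := by
  obtain ⟨p, hp⟩ := hex.exists_rep f
  have h1 : imageMap Δ θ hex f = cokerPreMap θ _ _ p := imageMap_eq hex hθ hp
  have h2 : imageMap Δ θ hex (f ▷ z) =
      cokerPreMap θ _ _ (cokerPreWhiskerRight p z.obj) := imageMap_eq hex hθ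
    ((cokerPreMap_whiskerRight ψ p z.obj).trans (by rw [hp, RelImage.whiskerRight_hom]))
  refine Eq.trans ?_ (congrArg (μ Δ.functor x.obj z.obj ≫ ·)
    (h2.trans (cokerPreMap_whiskerRight θ p z.obj)).symm)
  rw [h1, Functor.Monoidal.μ_δ_assoc]

theorem imageMap_comp_ofSource (hθ : φ.Compat θ) {x y : RelImage χ} (f : x ⟶ y) {z : C.carrier} (g : y.obj ⟶ z) :
    imageMap Δ θ hex (f ≫ (RelImage.ofSource χ).map g) =
      imageMap Δ θ hex f ≫ Δ.functor.map g :=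
  ((imageFunctor Δ θ hex hθ).map_comp f ((RelImage.ofSource χ).map g)).trans
    (congrArg (imageMap Δ θ hex f ≫ ·) (imageMap_ofSource hex hθ g))

theorem imageMap_ofSource_comp (hθ : φ.Compat θ) {x y : RelImage χ} (f : x ⟶ y) {z : C.carrier} (g : z ⟶ x.obj) :
    imageMap Δ θ hex ((RelImage.ofSource χ).map g ≫ f) =
      Δ.functor.map g ≫ imageMap Δ θ hex f :=
  ((imageFunctor Δ θ hex hθ).map_comp ((RelImage.ofSource χ).map g) f).trans
    (congrArg (· ≫ imageMap Δ θ hex f) (imageMap_ofSource hex hθ g))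

theorem imageMap_whiskerLeft (hθ : φ.Compat θ) (z : RelImage χ) {x y : RelImage χ} (f : x ⟶ y) :
    Δ.functor.obj z.obj ◁ imageMap Δ θ hex f ≫ μ Δ.functor z.obj y.obj =
      μ Δ.functor z.obj x.obj ≫ imageMap Δ θ hex (z ◁ f) := by
  have h2 : imageMap Δ θ hex (z ◁ f) ≫ Δ.functor.map (β_ z.obj y.obj).hom =
      Δ.functor.map (β_ z.obj x.obj).hom ≫ imageMap Δ θ hex (f ▷ z) :=
    (imageMap_comp_ofSource hex hθ (z ◁ f) (β_ z.obj y.obj).hom).symm.trans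
      ((congrArg (imageMap Δ θ hex) (BraidedCategory.braiding_naturality_right z f)).trans
        (imageMap_ofSource_comp hex hθ (f ▷ z) (β_ z.obj x.obj).hom))
  have h3 := Functor.LaxBraided.braided (F := Δ.functor) z.obj x.obj
  have h4 := Functor.LaxBraided.braided (F := Δ.functor) z.obj y.obj
  have h5 := imageMap_whiskerRight hex hθ f z
  have h6 := BraidedCategory.braiding_naturality_right (Δ.functor.obj z.obj)
    (imageMap Δ θ hex f)
  rw [← cancel_mono (Δ.functor.map (β_ z.obj y.obj).hom), Category.assoc, h4,
    reassoc_of% h6, h5, ← reassoc_of% h3, ← h2]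
  exact (Category.assoc _ _ _).symm

theorem imageMap_smul (hθ : φ.Compat θ) (r : R) {x y : RelImage χ} (g : x ⟶ y) :
    imageMap Δ θ hex (((RelImage.smul χ).obj r).map g) ≫ (Δ.lin r y.obj).hom =
      (Δ.lin r x.obj).hom ≫ (J.smul.obj r).map (imageMap Δ θ hex g) := by
  obtain ⟨p, hp⟩ := hex.exists_rep g
  have h1 : imageMap Δ θ hex g = cokerPreMap θ _ _ p := imageMap_eq hex hθ hp
  have h2 : imageMap Δ θ hex (((RelImage.smul χ).obj r).map g) =
      cokerPreMap θ _ _ (cokerPreSmul r p) := imageMap_eq hex hθ (by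
    change _ = (H.lin r x.obj).hom ≫ (D.smul.obj r).map g.hom ≫ (H.lin r y.obj).inv
    rw [← hp, ← reassoc_of% cokerPreMap_smul, Iso.hom_inv_id]
    exact (Category.comp_id _).symm)
  rw [h1, ← cokerPreMap_smul, h2]
  rfl

noncomputable instance (hθ : φ.Compat θ) : (imageFunctor Δ θ hex hθ).Monoidal :=
  Functor.CoreMonoidal.toMonoidal
    { εIso := Functor.Monoidal.εIso Δ.functor
      μIso x y := Functor.Monoidal.μIso Δ.functor x.obj y.obj
      μIso_hom_natural_left f z := imageMap_whiskerRight hex hθ f z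
      μIso_hom_natural_right z f := imageMap_whiskerLeft hex hθ z f
      associativity x y z := by
        have h := Functor.LaxMonoidal.associativity Δ.functor x.obj y.obj z.obj
        rw [← imageFunctor_map_ofSource hex hθ] at h
        exact h
      left_unitality x := by
        have h := Functor.LaxMonoidal.left_unitality Δ.functor x.obj
        rw [← imageFunctor_map_ofSource hex hθ] at h
        exact h
      right_unitality x := by
        have h := Functor.LaxMonoidal.right_unitality Δ.functor x.obj
        rw [← imageFunctor_map_ofSource hex hθ] at h
        exact h }

noncomputable instance imageBraided (hθ : φ.Compat θ) : (imageFunctor Δ θ hex hθ).Braided where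
  braided x y := by
    have h := Functor.LaxBraided.braided (F := Δ.functor) x.obj y.obj
    rw [← imageFunctor_map_ofSource hex hθ] at h
    exact h

/-- The 1-morphism induced by `Δ` on the relative image. -/
noncomputable def imageMor (hθ : φ.Compat θ) : Mor₁ (RelImage.module χ) J where
  functor := imageFunctor Δ θ hex hθ
  braided := imageBraided hex hθ
  lin r x := Δ.lin r x.obj
  lin_naturality {r r' x y} f g := by
    have h4 : Δ.functor.map ((C.smul.map f).app x.obj) ≫ (Δ.lin r' x.obj).hom =
        (Δ.lin r x.obj).hom ≫ (J.smul.map f).app (Δ.functor.obj x.obj) := by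
      simpa [biMap] using Δ.lin_naturality f (𝟙 x.obj)
    have h5 := imageMap_smul hex hθ r' g
    refine Eq.trans (congrArg (· ≫ (Δ.lin r' y.obj).hom)
      (imageMap_ofSource_comp hex hθ (((RelImage.smul χ).obj r').map g)
        ((C.smul.map f).app x.obj))) ?_
    change (Δ.functor.map ((C.smul.map f).app x.obj) ≫ _) ≫ _ = (Δ.lin r x.obj).hom ≫
          (J.smul.map f).app (Δ.functor.obj x.obj) ≫ (J.smul.obj r').map (imageMap Δ θ hex g)
    rw [← reassoc_of% h4, ← h5]
    exact Category.assoc _ _ _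
  lin_add r x y := by
    have h := Δ.lin_add r x.obj y.obj
    rw [← imageFunctor_map_ofSource hex hθ] at h
    exact h
  add_lin r s x := by
    have h := Δ.add_lin r s x.obj
    rw [← imageFunctor_map_ofSource hex hθ] at h
    exact h
  lin_zero r := by
    have h := Δ.lin_zero r
    rw [← imageFunctor_map_ofSource hex hθ] at h
    exact h
  lin_assoc r s x := by
    have h := Δ.lin_assoc r s x.obj
    rw [← imageFunctor_map_ofSource hex hθ] at h
    exact h
  lin_one x := by
    have h := Δ.lin_one x.obj
    rw [← imageFunctor_map_ofSource hex hθ] at h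
    exact h

theorem cokerPreMap_rightUnitor_inv (ψ : Mor₂ (G.comp H) (Mor₁.zero B D)) (b : B.carrier) :
    cokerPreMap ψ _ _ (⟨b, (ρ_ _).inv⟩ : CokerPre G (G.functor.obj b) (𝟙_ C.carrier)) =
      ψ.toZero b ≫ ε H.functor := by
  change H.functor.map (ρ_ (G.functor.obj b)).inv ≫ δ H.functor _ _ ≫ ψ.toZero b ▷ _ ≫
    (λ_ _).hom = _
  rw [Functor.Monoidal.map_rightUnitor_inv, Category.assoc,
    Category.assoc, Functor.Monoidal.μ_δ_assoc, whisker_exchange_assoc, leftUnitor_naturality,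
    unitors_equal, rightUnitor_naturality_assoc, Iso.inv_hom_id_assoc]

/-- A 1-morphism `Δ` with a trivialisation of `Δ ∘ G` extends along `H` if the sequence
`G, H` is relative 2-exact and the target is injective. -/
theorem RelativeExact.exists_extension (hex : RelativeExact φ ψ χ hψ)
    (hJ : J.IsInjective) (hχ : ψ.Compat χ)
    (hθ : φ.Compat θ) : ∃ (h : Mor₁ D J) (σ : Mor₂ (H.comp h) Δ), ∀ b : B.carrier,
      h.functor.map (ψ.toZero b) ≫ η h.functor =
        σ.nat.app (G.functor.obj b) ≫ θ.toZero b := by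
  obtain ⟨h, ⟨σ'⟩⟩ := hJ _ _ (RelImage.incl χ) (imageMor hex hθ)
    (inferInstanceAs (RelImage.toTarget χ).Faithful)
  let σ : Mor₂ (H.comp h) Δ := Mor₂.ofApp (fun x => σ'.nat.app (⟨x⟩ : RelImage χ))
    (fun {x y} f => (σ'.naturality ((RelImage.ofSource χ).map f)).trans
      (congrArg (σ'.nat.app (⟨x⟩ : RelImage χ) ≫ ·) (imageMap_ofSource hex hθ f)))
    σ'.unit (fun x y => σ'.tensor (⟨x⟩ : RelImage χ) ⟨y⟩)
    (fun r x => σ'.lin r (⟨x⟩ : RelImage χ))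
  refine ⟨h, σ, fun b => ?_⟩
  have hK : K.functor.map (ε H.functor) ≫ χ.toZero (𝟙_ C.carrier) = η K.functor := by
    rw [← cancel_epi (ε K.functor), toZero_unit, Functor.Monoidal.ε_η]
  let g : (⟨G.functor.obj b⟩ : RelImage χ) ⟶ 𝟙_ (RelImage χ) := RelImage.Hom.mk (ψ.toZero b ≫ ε H.functor) (by
    rw [Functor.map_comp, Category.assoc]
    erw [hK]
    exact hχ b)
  have hg : imageMap Δ θ hex g = θ.toZero b ≫ ε Δ.functor :=
    (imageMap_eq hex hθ (cokerPreMap_rightUnitor_inv ψ b)).trans (cokerPreMap_rightUnitor_inv θ b)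
  have key : ∀ (s₁ : h.functor.obj (H.functor.obj (G.functor.obj b)) ⟶
        Δ.functor.obj (G.functor.obj b))
      (s₂ : h.functor.obj (H.functor.obj (𝟙_ C.carrier)) ⟶ Δ.functor.obj (𝟙_ C.carrier)),
      h.functor.map (ψ.toZero b ≫ ε H.functor) ≫ s₂ = s₁ ≫ θ.toZero b ≫ ε Δ.functor →
      (ε h.functor ≫ h.functor.map (ε H.functor)) ≫ s₂ = ε Δ.functor →
      h.functor.map (ψ.toZero b) ≫ η h.functor = s₁ ≫ θ.toZero b := by
    intro s₁ s₂ h1 h2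
    rw [← cancel_mono (ε Δ.functor), Category.assoc, Category.assoc, ← h1, ← h2, Category.assoc,
      Functor.Monoidal.η_ε_assoc, Functor.map_comp, Category.assoc]
  exact key _ _ ((σ'.naturality g).trans (congrArg (σ.nat.app (G.functor.obj b) ≫ ·) hg)) σ.unit

end ImageMorphism

/-! ### Comparison of two 1-morphisms along a relatively exact sequence -/

section Comparison

variable {R : Type w} [Category.{w'} R] [MonoidalCategory R] [SymmetricCategory R]
  [IsTwoGroup R] [TwoRing R]

theorem tensorHom_left_injective {C : Type u₁} [Category.{v₁} C] [MonoidalCategory C]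
    [SymmetricCategory C] [IsTwoGroup C] {X Y X' Y' : C} {f g : X ⟶ Y} (k : X' ⟶ Y')
    (h : (f ⊗ₘ k) = (g ⊗ₘ k)) : f = g := by
  rw [MonoidalCategory.tensorHom_def, MonoidalCategory.tensorHom_def, cancel_mono] at h
  exact whiskerRight_injective X' h

namespace Mor₂

variable {M N : TwoModule.{w', w, u} R} {F G H : Mor₁ M N}

/-- The identity 2-morphism. -/
def id (F : Mor₁ M N) : Mor₂ F F :=
  ofApp (fun _ => 𝟙 _) (by simp) (by simp) (by simp) (by simp)

/-- A 2-morphism `F + H ⇒ G + H` comes from a 2-morphism `F ⇒ G`. -/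
theorem exists_of_sum (T : Mor₂ (F.sum H) (G.sum H)) :
    ∃ t : Mor₂ F G, ∀ m, t.nat.app m ▷ H.functor.obj m = T.nat.app m := by
  have h : ∀ m, ∃ t : F.functor.obj m ⟶ G.functor.obj m,
      t ▷ H.functor.obj m = T.nat.app m := fun m =>
    whiskerRight_surjective (H.functor.obj m) (T.nat.app m)
  choose t ht using h
  refine ⟨ofApp t (fun {m m'} f => ?_) ?_ (fun m m' => ?_) (fun r m => ?_), ht⟩
  · have h := T.naturality f
    rw [← ht, ← ht] at h
    simp only [Mor₁.sum_map, Mor₁.sum_obj, ← tensorHom_id, tensorHom_comp_tensorHom,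
      Category.comp_id, Category.id_comp] at h
    exact tensorHom_left_injective _ h
  · have h := T.unit
    rw [← ht] at h
    simp only [Mor₁.sum_ε, Mor₁.sum_obj, Category.assoc, ← tensorHom_id,
      tensorHom_comp_tensorHom, Category.comp_id, cancel_epi] at h
    exact tensorHom_left_injective _ h
  · have h := T.tensor m m'
    rw [← ht, ← ht, ← ht] at h
    simp only [Mor₁.sum_μ, Mor₁.sum_obj, Category.assoc, ← tensorHom_id,
      tensorμ_natural_assoc, tensorHom_comp_tensorHom, Category.comp_id, id_tensorHom_id,
      Category.id_comp, cancel_epi] at h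
    exact tensorHom_left_injective _ h
  · have h := T.lin r m
    rw [← ht, ← ht] at h
    simp only [Mor₁.sum_lin, Mor₁.sum_obj, Category.assoc, ← tensorHom_id,
      ← Functor.LaxMonoidal.μ_natural, tensorHom_comp_tensorHom_assoc, Category.comp_id,
      CategoryTheory.Functor.map_id, Category.id_comp, cancel_mono] at h
    exact tensorHom_left_injective _ h

end Mor₂

theorem eq_η_of_ε_comp {C : Type u₁} [Category.{v₁} C] [MonoidalCategory C] {D : Type u₂}
    [Category.{v₂} D] [MonoidalCategory D] (F : C ⥤ D) [F.Monoidal] {f : F.obj (𝟙_ C) ⟶ 𝟙_ D}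
    (h : ε F ≫ f = 𝟙 _) : f = η F := by
  rw [← cancel_epi (ε F), h, Functor.Monoidal.ε_η]

theorem Mor₁.sum_η {M N : TwoModule.{w', w, u} R} (F G : Mor₁ M N) :
    η (F.sum G).functor = (η F.functor ⊗ₘ η G.functor) ≫ (λ_ (𝟙_ N.carrier)).hom := by
  refine (eq_η_of_ε_comp _ ?_).symm
  simp only [Mor₁.sum_ε, Mor₁.sum_obj, Category.assoc, tensorHom_comp_tensorHom_assoc,
    Functor.Monoidal.ε_η, id_tensorHom_id, Category.id_comp, Iso.inv_hom_id]

theorem pairing_triangle {C : Type u₁} [Category.{v₁} C] [MonoidalCategory C]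
    [SymmetricCategory C] [IsTwoGroup C] {X Y n : C} (u : X ⟶ Y) (e : Y ⊗ n ⟶ 𝟙_ C) :
    ((u ▷ n ≫ e) ▷ Y ≫ (λ_ Y).hom) ▷ n =
      (α_ _ _ _).hom ≫ (X ⊗ n) ◁ e ≫ (ρ_ _).hom ≫ u ▷ n := by
  have h : e ▷ Y ▷ n ≫ (λ_ Y).hom ▷ n = (α_ _ _ _).hom ≫ (Y ⊗ n) ◁ e ≫ (ρ_ _).hom := by
    rw [← cancel_mono e]
    have h1 : e ▷ Y ▷ n ≫ (λ_ Y).hom ▷ n = (α_ _ _ _).hom ≫ e ▷ (Y ⊗ n) ≫ (λ_ _).hom := by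
      simp
    rw [h1]
    simp only [Category.assoc]
    rw [← leftUnitor_naturality, ← rightUnitor_naturality, whisker_exchange_assoc,
      unitors_equal]
  rw [comp_whiskerRight, comp_whiskerRight, comp_whiskerRight, Category.assoc, h,
    ← rightUnitor_naturality, whisker_exchange_assoc, associator_naturality_left_assoc]

variable {A B C D E J : TwoModule.{w', w, u} R} {F : Mor₁ A B}
  {G : Mor₁ B C} {H : Mor₁ C D}
  {K : Mor₁ D E} {φ : Mor₂ (F.comp G) (Mor₁.zero A C)} {ψ : Mor₂ (G.comp H) (Mor₁.zero B D)}
  {χ : Mor₂ (H.comp K) (Mor₁.zero C E)} {hψ : φ.Compat ψ} {Φ Γ : Mor₁ C J}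

/-- The trivialisation of `(Φ - Γ) ∘ G` given by a 2-morphism `Φ ∘ G ⇒ Γ ∘ G`. -/
noncomputable def differenceZero (θ : Mor₂ (G.comp Φ) (G.comp Γ)) :
    Mor₂ (G.comp (Φ.sum (Γ.comp (Mor₁.neg J)))) (Mor₁.zero B J) :=
  (Mor₂.compSum G Φ (Γ.comp (Mor₁.neg J))).vcomp
    ((θ.sumMap (Mor₂.compAssoc G Γ (Mor₁.neg J)).symm).vcomp (Mor₂.sumNeg (G.comp Γ)))

theorem differenceZero_toZero (θ : Mor₂ (G.comp Φ) (G.comp Γ)) (b : B.carrier) :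
    (differenceZero θ).toZero b =
      θ.square b ▷ (negFunctor J).obj (Γ.functor.obj (G.functor.obj b)) ≫
        negPairing J (Γ.functor.obj (G.functor.obj b)) := by
  change 𝟙 _ ≫ (θ.square b ⊗ₘ inv (𝟙 _)) ≫ negPairing J _ = _
  rw [Category.id_comp, IsIso.inv_id, tensorHom_id]

theorem differenceZero_compat (θ : Mor₂ (G.comp Φ) (G.comp Γ))
    (hθ : ∀ a : A.carrier, θ.square (F.functor.obj a) ≫ Γ.functor.map (φ.toZero a) ≫
      η Γ.functor = Φ.functor.map (φ.toZero a) ≫ η Φ.functor) :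
    φ.Compat (differenceZero θ) := by
  intro a
  have h1 := (Mor₂.sumNeg Γ).naturality (φ.toZero a)
  have h2 : (Mor₂.sumNeg Γ).nat.app (𝟙_ C.carrier) = η (Γ.sum (Γ.comp (Mor₁.neg J))).functor :=
    eq_η_of_ε_comp (Γ.sum (Γ.comp (Mor₁.neg J))).functor (Mor₂.sumNeg Γ).unit
  have h3 : (Γ.functor.map (φ.toZero a) ⊗ₘ (Γ.comp (Mor₁.neg J)).functor.map (φ.toZero a)) ≫
      (η Γ.functor ⊗ₘ η (Γ.comp (Mor₁.neg J)).functor) ≫ (λ_ (𝟙_ J.carrier)).hom =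
        negPairing J (Γ.functor.obj (G.functor.obj (F.functor.obj a))) := by
    rw [h2, Mor₁.sum_η] at h1
    exact h1.trans (Category.comp_id _)
  rw [differenceZero_toZero, ← h3, Mor₁.sum_η]
  change (Φ.functor.map (φ.toZero a) ⊗ₘ (Γ.comp (Mor₁.neg J)).functor.map (φ.toZero a)) ≫ _ ≫ _ =
    _ ▷ (Γ.comp (Mor₁.neg J)).functor.obj _ ≫ _
  rw [tensorHom_comp_tensorHom_assoc, tensorHom_comp_tensorHom_assoc, ← tensorHom_id,
    tensorHom_comp_tensorHom_assoc, Category.id_comp]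
  exact congrArg (fun k => (k ⊗ₘ _) ≫ _) (hθ a).symm

/-- Two 1-morphisms `Φ`, `Γ` which agree after composition with `G` differ by a 1-morphism
factoring through `H` if the sequence `G, H` is relative 2-exact and the target is injective. -/
theorem RelativeExact.exists_difference (hex : RelativeExact φ ψ χ hψ) (hJ : J.IsInjective)
    (hχ : ψ.Compat χ) (θ : Mor₂ (G.comp Φ) (G.comp Γ))
    (hθ : ∀ a : A.carrier, θ.square (F.functor.obj a) ≫ Γ.functor.map (φ.toZero a) ≫
      η Γ.functor = Φ.functor.map (φ.toZero a) ≫ η Φ.functor) :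
    ∃ (h : Mor₁ D J) (τ : Mor₂ Φ ((H.comp h).sum Γ)), ∀ b : B.carrier,
      τ.nat.app (G.functor.obj b) ≫
        (h.functor.map (ψ.toZero b) ≫ η h.functor) ▷ Γ.functor.obj (G.functor.obj b) ≫
          (λ_ _).hom = θ.square b := by
  obtain ⟨h, σ, hσ⟩ := hex.exists_extension hJ hχ (differenceZero_compat θ hθ)
  obtain ⟨t, ht⟩ := Mor₂.exists_of_sum (F := (Φ.sum (Γ.comp (Mor₁.neg J))).sum Γ) (G := Φ)
    (H := Γ.comp (Mor₁.neg J)) ((Mor₂.sumAssoc _ _ _).vcomp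
      (((Mor₂.id _).sumMap (Mor₂.sumNeg Γ)).vcomp (Mor₂.sumZeroRight _)))
  refine ⟨h, t.symm.vcomp (σ.symm.sumMap (Mor₂.id Γ)), fun b => ?_⟩
  have key : ∀ {x : J.carrier} {X Y : J.carrier} (e : Y ⊗ (negFunctor J).obj Y ⟶ 𝟙_ J.carrier)
      (t : (X ⊗ (negFunctor J).obj Y) ⊗ Y ⟶ X) (u : X ⟶ Y)
      (s : x ⟶ X ⊗ (negFunctor J).obj Y) (k : x ⟶ 𝟙_ J.carrier),
      k = s ≫ u ▷ _ ≫ e →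
      t ▷ (negFunctor J).obj Y = (α_ _ _ _).hom ≫ (𝟙 _ ⊗ₘ e) ≫ (β_ _ _).hom ≫ (λ_ _).hom →
      (inv t ≫ (inv s ⊗ₘ 𝟙 Y)) ≫ k ▷ Y ≫ (λ_ _).hom = u := by
    intro x X Y e t u s k hk ht
    have h1 := pairing_triangle u e
    rw [hk, Category.assoc, IsIso.inv_comp_eq, tensorHom_id, ← comp_whiskerRight_assoc,
      IsIso.inv_hom_id_assoc]
    apply whiskerRight_injective ((negFunctor J).obj Y)
    rw [h1, comp_whiskerRight, ht, braiding_leftUnitor, id_tensorHom]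
    simp only [Category.assoc]
  refine key (negPairing J _) (t.nat.app (G.functor.obj b)) (θ.square b)
    (σ.nat.app (G.functor.obj b)) _ ?_ ?_
  · exact (hσ b).trans (congrArg (σ.nat.app (G.functor.obj b) ≫ ·) (differenceZero_toZero θ b))
  · exact ht _

end Comparison

/-! ### Lifting and comparison steps -/

section Steps

variable {R : Type w} [Category.{w'} R] [MonoidalCategory R] [SymmetricCategory R]
  [IsTwoGroup R] [TwoRing R]

section

variable {A B C D E J : TwoModule.{w', w, u} R} {F : Mor₁ A B}
  {G : Mor₁ B C} {H : Mor₁ C D}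
  {K : Mor₁ D E} {φ : Mor₂ (F.comp G) (Mor₁.zero A C)} {ψ : Mor₂ (G.comp H) (Mor₁.zero B D)}
  {χ : Mor₂ (H.comp K) (Mor₁.zero C E)} {hψ : φ.Compat ψ} {Φ Γ₁ Γ₂ : Mor₁ C J}

/-- The component `F (d x) ⟶ G (d x) + H (d x)` of a 2-morphism. -/
def Mor₂.squareSum {L M N : TwoModule.{w', w, u} R} {d : Mor₁ L M} {F G H : Mor₁ M N}
    (θ : Mor₂ (d.comp F) (d.comp (G.sum H))) (x : L.carrier) :
    F.functor.obj (d.functor.obj x) ⟶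
      G.functor.obj (d.functor.obj x) ⊗ H.functor.obj (d.functor.obj x) :=
  θ.nat.app x

/-- The component `F x ⟶ (G x + H (d x)) + K x` of a 2-morphism. -/
def Mor₂.appSum {L M N : TwoModule.{w', w, u} R} {d : Mor₁ L M} {F G K : Mor₁ L N}
    {H : Mor₁ M N} (τ : Mor₂ F ((G.sum (d.comp H)).sum K)) (x : L.carrier) :
    F.functor.obj x ⟶ (G.functor.obj x ⊗ H.functor.obj (d.functor.obj x)) ⊗ K.functor.obj x :=
  τ.nat.app x

/-- The variant of `RelativeExact.exists_difference` with the difference added in the middle. -/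
theorem RelativeExact.exists_difference_sum (hex : RelativeExact φ ψ χ hψ) (hJ : J.IsInjective)
    (hχ : ψ.Compat χ) (θ : Mor₂ (G.comp Φ) (G.comp (Γ₁.sum Γ₂)))
    (hθ : ∀ a : A.carrier, θ.square (F.functor.obj a) ≫ (Γ₁.sum Γ₂).functor.map (φ.toZero a) ≫
      η (Γ₁.sum Γ₂).functor = Φ.functor.map (φ.toZero a) ≫ η Φ.functor) :
    ∃ (h : Mor₁ D J) (τ : Mor₂ Φ ((Γ₁.sum (H.comp h)).sum Γ₂)), ∀ b : B.carrier,
      τ.appSum (G.functor.obj b) ≫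
        ((Γ₁.functor.obj (G.functor.obj b) ◁ (h.functor.map (ψ.toZero b) ≫ η h.functor) ≫
          (ρ_ _).hom) ⊗ₘ 𝟙 _) = θ.squareSum b := by
  obtain ⟨h, τ, hτ⟩ := hex.exists_difference hJ hχ θ hθ
  refine ⟨h, τ.vcomp ((Mor₂.sumAssoc (H.comp h) Γ₁ Γ₂).symm.vcomp
    ((Mor₂.sumBraiding (H.comp h) Γ₁).sumMap (Mor₂.id Γ₂))), fun b => ?_⟩
  have key : ∀ {f x y z : J.carrier} (t : f ⟶ x ⊗ (y ⊗ z)) (k : x ⟶ 𝟙_ J.carrier),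
      (t ≫ inv (α_ x y z).hom ≫ ((β_ x y).hom ⊗ₘ 𝟙 z)) ≫ ((y ◁ k ≫ (ρ_ y).hom) ⊗ₘ 𝟙 z) =
        t ≫ k ▷ (y ⊗ z) ≫ (λ_ _).hom := by
    intro f x y z t k
    have h1 : (β_ x y).hom ≫ y ◁ k ≫ (ρ_ y).hom = k ▷ y ≫ (λ_ y).hom := by
      rw [← BraidedCategory.braiding_naturality_left_assoc, braiding_rightUnitor]
    rw [Category.assoc, Category.assoc, tensorHom_comp_tensorHom, h1, Category.comp_id,
      tensorHom_id, comp_whiskerRight]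
    simp
  exact (key _ _).trans (hτ b)

end

section Lift

variable {X₀ X₁ X₂ X₃ X₄ Y₀ Y₁ Y₂ Y₃ : TwoModule.{w', w, u} R}
  {d₀ : Mor₁ X₀ X₁} {d₁ : Mor₁ X₁ X₂} {d₂ : Mor₁ X₂ X₃} {d₃ : Mor₁ X₃ X₄}
  {α₀ : Mor₂ (d₀.comp d₁) (Mor₁.zero X₀ X₂)} {α₁ : Mor₂ (d₁.comp d₂) (Mor₁.zero X₁ X₃)}
  {α₂ : Mor₂ (d₂.comp d₃) (Mor₁.zero X₂ X₄)} {hα : α₀.Compat α₁}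
  {e₀ : Mor₁ Y₀ Y₁} {e₁ : Mor₁ Y₁ Y₂} {e₂ : Mor₁ Y₂ Y₃}
  {β₀ : Mor₂ (e₀.comp e₁) (Mor₁.zero Y₀ Y₂)} {β₁ : Mor₂ (e₁.comp e₂) (Mor₁.zero Y₁ Y₃)}
  {f₀ : Mor₁ X₀ Y₀} {f₁ : Mor₁ X₁ Y₁} {f₂ : Mor₁ X₂ Y₂}

/-- The canonical 2-morphism `0 ∘ F ⇒ 0`. -/
def Mor₂.compZero {M N P : TwoModule.{w', w, u} R} (F : Mor₁ M N) :
    Mor₂ (F.comp (Mor₁.zero N P)) (Mor₁.zero M P) :=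
  Mor₂.ofApp (fun _ => 𝟙 _) (fun _ => rfl)
    (by
      change (𝟙 _ ≫ 𝟙 _) ≫ 𝟙 _ = 𝟙 (𝟙_ P.carrier)
      simp)
    (fun m m' => by
      change ((λ_ (𝟙_ P.carrier)).hom ≫ 𝟙 _) ≫ 𝟙 _ = (𝟙 _ ⊗ₘ 𝟙 _) ≫ (λ_ (𝟙_ P.carrier)).hom
      simp)
    (fun r m => by
      change (𝟙 (𝟙_ P.carrier) ≫ ε (P.smul.obj r)) ≫ (P.smul.obj r).map (𝟙 _) =
        𝟙 _ ≫ ε (P.smul.obj r)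
      simp)

/-- The precomposition of a trivialisation `e' e ⇒ 0` with a 1-morphism. -/
def Mor₂.precompZero {M N P Q : TwoModule.{w', w, u} R} (F : Mor₁ M N) {e : Mor₁ N P}
    {e' : Mor₁ P Q} (β : Mor₂ (e.comp e') (Mor₁.zero N Q)) :
    Mor₂ ((F.comp e).comp e') (Mor₁.zero M Q) :=
  (Mor₂.compAssoc F e e').vcomp ((Mor₂.whiskerL F β).vcomp (Mor₂.compZero F))

theorem Mor₂.precompZero_toZero {M N P Q : TwoModule.{w', w, u} R} (F : Mor₁ M N) {e : Mor₁ N P}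
    {e' : Mor₁ P Q} (β : Mor₂ (e.comp e') (Mor₁.zero N Q)) (m : M.carrier) :
    (Mor₂.precompZero F β).toZero m = β.toZero (F.functor.obj m) := by
  change 𝟙 _ ≫ β.toZero (F.functor.obj m) ≫ 𝟙 _ = _
  rw [Category.id_comp]
  exact Category.comp_id _

/-- The 2-morphism `e₂ f₂ d₁ ⇒ e₂ e₁ f₁ ⇒ 0`. -/
noncomputable def liftZero (c₁ : Mor₂ (d₁.comp f₂) (f₁.comp e₁))
    (β₁ : Mor₂ (e₁.comp e₂) (Mor₁.zero Y₁ Y₃)) :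
    Mor₂ (d₁.comp (f₂.comp e₂)) (Mor₁.zero X₁ Y₃) :=
  (Mor₂.compAssoc d₁ f₂ e₂).symm.vcomp ((c₁.whiskerR e₂).vcomp (Mor₂.precompZero f₁ β₁))

theorem liftZero_toZero (c₁ : Mor₂ (d₁.comp f₂) (f₁.comp e₁)) (x : X₁.carrier) :
    (liftZero c₁ β₁).toZero x =
      e₂.functor.map (c₁.square x) ≫ β₁.toZero (f₁.functor.obj x) := by
  change inv (𝟙 _) ≫ e₂.functor.map (c₁.square x) ≫ (Mor₂.precompZero f₁ β₁).toZero x = _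
  rw [IsIso.inv_id, Category.id_comp, Mor₂.precompZero_toZero]

/-- The next component of a morphism from a relatively exact complex to a complex of injectives. -/
theorem RelativeExact.exists_lift (hex : RelativeExact α₀ α₁ α₂ hα) (hα' : α₁.Compat α₂)
    (hβ : β₀.Compat β₁) (hY : Y₃.IsInjective) (c₀ : Mor₂ (d₀.comp f₁) (f₀.comp e₀))
    (c₁ : Mor₂ (d₁.comp f₂) (f₁.comp e₁))
    (hc : ∀ x, f₂.functor.map (α₀.toZero x) ≫ η f₂.functor = c₁.square (d₀.functor.obj x) ≫
      e₁.functor.map (c₀.square x) ≫ β₀.toZero (f₀.functor.obj x)) :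
    ∃ (f₃ : Mor₁ X₃ Y₃) (c₂ : Mor₂ (d₂.comp f₃) (f₂.comp e₂)), ∀ x,
      f₃.functor.map (α₁.toZero x) ≫ η f₃.functor = c₂.square (d₁.functor.obj x) ≫
        e₂.functor.map (c₁.square x) ≫ β₁.toZero (f₁.functor.obj x) := by
  have hθ : α₀.Compat (liftZero c₁ β₁) := by
    intro a
    rw [liftZero_toZero, ← toZero_naturality β₁ (c₀.square a), ← hβ, ← Functor.map_comp_assoc,
      ← Functor.map_comp_assoc]
    have h := congrArg e₂.functor.map (hc a)
    rw [Category.assoc, ← h]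
    change e₂.functor.map (f₂.functor.map (α₀.toZero a)) ≫ e₂.functor.map (η f₂.functor) ≫ _ = _
    rw [Functor.map_comp_assoc]
  obtain ⟨f₃, σ, hσ⟩ := hex.exists_extension hY hα' hθ
  refine ⟨f₃, σ, fun x => (hσ x).trans ?_⟩
  exact congrArg (σ.nat.app (d₁.functor.obj x) ≫ ·) (liftZero_toZero c₁ x)

end Lift

section Difference

theorem toZero_cokerCollapse {A B C D : TwoModule.{w', w, u} R} {F : Mor₁ A B} {G : Mor₁ B C}
    {H : Mor₁ C D} {φ : Mor₂ (F.comp G) (Mor₁.zero A C)} {ψ : Mor₂ (G.comp H) (Mor₁.zero B D)}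
    (h : φ.Compat ψ) (a : A.carrier) (b : B.carrier) :
    H.functor.map (cokerCollapse φ a b) ≫ ψ.toZero b = ψ.toZero (F.functor.obj a ⊗ b) := by
  have h2 := toZero_tensor ψ (F.functor.obj a) b
  rw [← h a] at h2
  rw [← cancel_epi (μ H.functor _ _ ≫ H.functor.map (μ G.functor (F.functor.obj a) b)), h2]
  simp only [cokerCollapse, Functor.map_comp, Category.assoc]
  rw [← Functor.map_comp_assoc H.functor (μ G.functor _ _), Functor.Monoidal.μ_δ,
    CategoryTheory.Functor.map_id, Category.id_comp,
    ← Functor.LaxMonoidal.μ_natural_left_assoc, MonoidalCategory.tensorHom_def,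
    comp_whiskerRight, Category.assoc, Category.assoc, Functor.Monoidal.map_leftUnitor_assoc,
    Functor.Monoidal.μ_δ_assoc, leftUnitor_naturality]

variable {C : Type u₁} [Category.{v₁} C] [MonoidalCategory C] {D : Type u₂} [Category.{v₂} D]
  [MonoidalCategory D] (e : C ⥤ D) [e.Monoidal]

theorem collapse_comp_unit {p h : C} (z : e.obj p ⟶ 𝟙_ D) (k : h ⟶ 𝟙_ C) :
    δ e p h ≫ z ▷ e.obj h ≫ (λ_ _).hom ≫ e.map k ≫ η e = e.map (p ◁ k ≫ (ρ_ p).hom) ≫ z := by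
  rw [Functor.map_comp, Category.assoc, ← Functor.OplaxMonoidal.right_unitality_hom_assoc,
    ← Functor.OplaxMonoidal.δ_natural_right_assoc, ← rightUnitor_naturality,
    whisker_exchange_assoc, whisker_exchange_assoc, ← unitors_equal,
    leftUnitor_naturality, leftUnitor_naturality_assoc]

theorem difference_comp_unit {f p h g : C} {a b : D} (cF : a ⟶ e.obj f) (cG : b ⟶ e.obj g)
    [IsIso cG] (t : f ⟶ (p ⊗ h) ⊗ g) (z : e.obj p ⟶ 𝟙_ D) (k : h ⟶ 𝟙_ C) (r : e.obj g ⟶ 𝟙_ D) :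
    (cF ≫ e.map t ≫ δ e (p ⊗ h) g ≫ ((δ e p h ≫ z ▷ e.obj h ≫ (λ_ _).hom) ⊗ₘ inv cG)) ≫
        ((e.map k ≫ η e) ⊗ₘ (cG ≫ r)) ≫ (λ_ _).hom =
      cF ≫ e.map (t ≫ ((p ◁ k ≫ (ρ_ p).hom) ⊗ₘ 𝟙 g)) ≫ δ e p g ≫ (z ⊗ₘ r) ≫ (λ_ _).hom := by
  have h1 := collapse_comp_unit e z k
  simp only [Category.assoc, tensorHom_comp_tensorHom_assoc, IsIso.inv_hom_id_assoc]
  rw [h1, Functor.map_comp e t, Category.assoc, ← Functor.OplaxMonoidal.δ_natural_assoc,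
    tensorHom_comp_tensorHom_assoc, CategoryTheory.Functor.map_id, Category.id_comp]

theorem Mor₁.sum_toUnit {M N : TwoModule.{w', w, u} R} (F G : Mor₁ M N) {m : M.carrier}
    (k : m ⟶ 𝟙_ M.carrier) : (F.sum G).functor.map k ≫ η (F.sum G).functor =
      ((F.functor.map k ≫ η F.functor) ⊗ₘ (G.functor.map k ≫ η G.functor)) ≫ (λ_ _).hom := by
  rw [Mor₁.sum_η, ← tensorHom_comp_tensorHom, Category.assoc]
  rfl

theorem Mor₁.comp_toUnit {M N P : TwoModule.{w', w, u} R} (F : Mor₁ M N) (G : Mor₁ N P)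
    {m : M.carrier} (k : m ⟶ 𝟙_ M.carrier) : (F.comp G).functor.map k ≫ η (F.comp G).functor =
      G.functor.map (F.functor.map k ≫ η F.functor) ≫ η G.functor := by
  rw [Functor.map_comp, Category.assoc]
  rfl

theorem Mor₂.app_tensorUnit {M N : TwoModule.{w', w, u} R} {F G : Mor₁ M N} (θ : Mor₂ F G) :
    θ.nat.app (𝟙_ M.carrier) ≫ η G.functor = η F.functor :=
  eq_η_of_ε_comp F.functor (by rw [← Category.assoc, θ.unit, Functor.Monoidal.ε_η])

theorem difference_comp_toZero {Y₂ Y₃ Y₄ P : TwoModule.{w', w, u} R} {q : Mor₁ P Y₂}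
    {e₂ : Mor₁ Y₂ Y₃} {e₃ : Mor₁ Y₃ Y₄} {z : Mor₂ (q.comp e₂) (Mor₁.zero P Y₃)}
    {β : Mor₂ (e₂.comp e₃) (Mor₁.zero Y₂ Y₄)} (hz : z.Compat β) (y : P.carrier)
    {a b : Y₃.carrier} {f h g : Y₂.carrier} (cF : a ⟶ e₂.functor.obj f)
    (cG : b ⟶ e₂.functor.obj g) (t : f ⟶ (q.functor.obj y ⊗ h) ⊗ g) :
    e₃.functor.map (cF ≫ e₂.functor.map t ≫ δ e₂.functor _ g ≫
        (cokerCollapse z y h ⊗ₘ inv cG)) ≫ δ e₃.functor _ _ ≫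
      (β.toZero h ⊗ₘ (e₃.functor.map cG ≫ β.toZero g)) ≫ (λ_ _).hom =
    e₃.functor.map cF ≫ β.toZero f := by
  have h1 := toZero_cokerCollapse hz y h
  have h2 := toZero_tensor β (q.functor.obj y ⊗ h) g
  have h3 : e₃.functor.map (δ e₂.functor (q.functor.obj y ⊗ h) g) ≫ δ e₃.functor _ _ ≫
      (β.toZero (q.functor.obj y ⊗ h) ⊗ₘ β.toZero g) ≫ (λ_ _).hom =
        β.toZero ((q.functor.obj y ⊗ h) ⊗ g) := by
    rw [← h2]; simp
  rw [← toZero_naturality β t, ← h3]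
  simp only [Functor.map_comp, Category.assoc]
  rw [← Functor.OplaxMonoidal.δ_natural_assoc, tensorHom_comp_tensorHom_assoc, h1,
    Functor.map_inv, IsIso.inv_hom_id_assoc]

end Difference

end Steps

/-! ### Existence of morphisms of complexes and of homotopies -/

section Complexes

variable {R : Type w} [Category.{w'} R] [MonoidalCategory R] [SymmetricCategory R]
  [IsTwoGroup R] [TwoRing R]

namespace CochainComplex₂

variable {C D : CochainComplex₂.{w', w, u} R}

/-- The part of a morphism of complexes in the degrees `n`, `n + 1`, `n + 2`. -/
structure PartialHom (C D : CochainComplex₂.{w', w, u} R) (n : ℕ) where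
  f₀ : Mor₁ (C.X n) (D.X n)
  f₁ : Mor₁ (C.X (n + 1)) (D.X (n + 1))
  f₂ : Mor₁ (C.X (n + 2)) (D.X (n + 2))
  c₀ : Mor₂ ((C.d n).comp f₁) (f₀.comp (D.d n))
  c₁ : Mor₂ ((C.d (n + 1)).comp f₂) (f₁.comp (D.d (n + 1)))
  compat : ∀ x : (C.X n).carrier, f₂.functor.map ((C.α n).toZero x) ≫ η f₂.functor =
    c₁.square ((C.d n).functor.obj x) ≫ (D.d (n + 1)).functor.map (c₀.square x) ≫
      (D.α n).toZero (f₀.functor.obj x)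

section Existence

variable (hC : ∀ n, RelativeExact (C.α n) (C.α (n + 1)) (C.α (n + 2)) (C.compat n))
  (hD : ∀ n, (D.X (n + 3)).IsInjective)

/-- A partial morphism in the next degrees. -/
noncomputable def PartialHom.next {n : ℕ} (s : PartialHom C D n) : PartialHom C D (n + 1) :=
  have h := (hC n).exists_lift (C.compat (n + 1)) (D.compat n) (hD n) s.c₀ s.c₁ s.compat
  ⟨s.f₁, s.f₂, h.choose, s.c₁, h.choose_spec.choose, h.choose_spec.choose_spec⟩

/-- The partial morphisms obtained from an initial one. -/
noncomputable def PartialHom.iterate (s : PartialHom C D 0) : ∀ n, PartialHom C D n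
  | 0 => s
  | n + 1 => (s.iterate n).next hC hD

/-- The morphism of complexes extending a partial morphism. -/
noncomputable def PartialHom.toHom (s : PartialHom C D 0) : Hom C D where
  f n := (s.iterate hC hD n).f₀
  comm n := (s.iterate hC hD n).c₀
  compat n := (s.iterate hC hD n).compat

end Existence

section Homotopy

variable {X₂ X₃ Y₂ Y₃ : TwoModule.{w', w, u} R} {d : Mor₁ X₂ X₃} {e : Mor₁ Y₂ Y₃}
  {f g p : Mor₁ X₂ Y₂} {f' g' : Mor₁ X₃ Y₃} {H : Mor₁ X₃ Y₂}

/-- The 2-morphism `f' d ⇒ e f ⇒ e (p + H d + g) ⇒ e H d + e g ⇒ (e H + g') d`. -/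
noncomputable def nextDifference (cF : Mor₂ (d.comp f') (f.comp e)) (cG : Mor₂ (d.comp g') (g.comp e))
    (z : Mor₂ (p.comp e) (Mor₁.zero X₂ Y₃)) (τ : Mor₂ f ((p.sum (d.comp H)).sum g)) :
    Mor₂ (d.comp f') (d.comp ((H.comp e).sum g')) :=
  cF.vcomp ((τ.whiskerR e).vcomp ((Mor₂.compSumInv (p.sum (d.comp H)) g e).symm.vcomp
    ((((Mor₂.compSumInv p (d.comp H) e).symm.vcomp ((z.sumMap (Mor₂.compAssoc d H e)).vcomp
      (Mor₂.sumZeroLeft _))).sumMap cG.symm).vcomp (Mor₂.compSum d (H.comp e) g').symm)))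

theorem nextDifference_square (cF : Mor₂ (d.comp f') (f.comp e)) (cG : Mor₂ (d.comp g') (g.comp e))
    (z : Mor₂ (p.comp e) (Mor₁.zero X₂ Y₃)) (τ : Mor₂ f ((p.sum (d.comp H)).sum g))
    (x : X₂.carrier) :
    (nextDifference cF cG z τ).squareSum x = cF.square x ≫ e.functor.map (τ.appSum x) ≫
      δ e.functor _ _ ≫ (cokerCollapse z x _ ⊗ₘ inv (cG.square x)) := by
  change cF.square x ≫ e.functor.map _ ≫ inv (μ e.functor _ _) ≫
    ((inv (μ e.functor _ _) ≫ (z.toZero x ⊗ₘ 𝟙 _) ≫ (λ_ _).hom) ⊗ₘ inv (cG.square x)) ≫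
      inv (𝟙 _) = _
  rw [IsIso.inv_id, Functor.Monoidal.inv_μ, Functor.Monoidal.inv_μ, tensorHom_id]
  exact congrArg (_ ≫ _ ≫ _ ≫ ·) (Category.comp_id _)

/-- The data from which the next component of a homotopy is constructed. -/
structure HomotopyStage (Φ Ψ : Hom C D) (n : ℕ) where
  prev : Mor₁ (C.X (n + 1)) (D.X (n + 1))
  toZero : Mor₂ (prev.comp (D.d (n + 1))) (Mor₁.zero (C.X (n + 1)) (D.X (n + 2)))
  toZero_compat : toZero.Compat (D.α (n + 1))
  difference : Mor₂ ((C.d n).comp (Φ.f (n + 1))) ((C.d n).comp (prev.sum (Ψ.f (n + 1))))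
  difference_toZero : ∀ x : (C.X n).carrier,
    (D.d (n + 1)).functor.map (difference.squareSum x) ≫
      δ (D.d (n + 1)).functor _ _ ≫ (toZero.toZero ((C.d n).functor.obj x) ⊗ₘ
        ((D.d (n + 1)).functor.map ((Ψ.comm n).square x) ≫
          (D.α n).toZero ((Ψ.f n).functor.obj x))) ≫ (λ_ _).hom =
    (D.d (n + 1)).functor.map ((Φ.comm n).square x) ≫ (D.α n).toZero ((Φ.f n).functor.obj x)
  difference_unit : ∀ y : (C.prependZero.X n).carrier,
    difference.square ((C.prependZero.d n).functor.obj y) ≫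
        (prev.sum (Ψ.f (n + 1))).functor.map ((C.prependZero.α n).toZero y) ≫
          η (prev.sum (Ψ.f (n + 1))).functor =
      (Φ.f (n + 1)).functor.map ((C.prependZero.α n).toZero y) ≫ η (Φ.f (n + 1)).functor

namespace HomotopyStage

variable {Φ Ψ : Hom C D} {n : ℕ} (s : HomotopyStage Φ Ψ n) (hC : C.IsExact)
  (hD : ∀ n, (D.X (n + 1)).IsInjective)

theorem exists_component (hC : C.IsExact) (hD : ∀ n, (D.X (n + 1)).IsInjective) :
    ∃ (H : Mor₁ (C.X (n + 2)) (D.X (n + 1)))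
      (τ : Mor₂ (Φ.f (n + 1)) ((s.prev.sum ((C.d (n + 1)).comp H)).sum (Ψ.f (n + 1)))),
      ∀ x : (C.X n).carrier,
      τ.appSum ((C.d n).functor.obj x) ≫
        ((_ ◁ (H.functor.map ((C.α n).toZero x) ≫ η H.functor) ≫ (ρ_ _).hom) ⊗ₘ 𝟙 _) =
      s.difference.squareSum x :=
  RelativeExact.exists_difference_sum (hC (n + 1)) (hD n) (C.compat n) s.difference
    s.difference_unit

/-- The component `H n` of a homotopy. -/
noncomputable def component : Mor₁ (C.X (n + 2)) (D.X (n + 1)) :=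
  (s.exists_component hC hD).choose

/-- The component `τ n` of a homotopy. -/
noncomputable def componentTau : Mor₂ (Φ.f (n + 1))
    ((s.prev.sum ((C.d (n + 1)).comp (s.component hC hD))).sum (Ψ.f (n + 1))) :=
  (s.exists_component hC hD).choose_spec.choose

theorem componentTau_spec (x : (C.X n).carrier) :
    (s.componentTau hC hD).appSum ((C.d n).functor.obj x) ≫
      ((_ ◁ ((s.component hC hD).functor.map ((C.α n).toZero x) ≫
        η (s.component hC hD).functor) ≫ (ρ_ _).hom) ⊗ₘ 𝟙 _) =
    s.difference.squareSum x :=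
  (s.exists_component hC hD).choose_spec.choose_spec x

/-- The data for the following component of a homotopy. -/
noncomputable def next : HomotopyStage Φ Ψ (n + 1) where
  prev := (s.component hC hD).comp (D.d (n + 1))
  toZero := Mor₂.precompZero (s.component hC hD) (D.α (n + 1))
  toZero_compat y :=
    (congrArg (fun k => (D.d (n + 3)).functor.map k ≫ η (D.d (n + 3)).functor)
      (Mor₂.precompZero_toZero _ _ y)).trans (D.compat (n + 1) _)
  difference := nextDifference (Φ.comm (n + 1)) (Ψ.comm (n + 1)) s.toZero (s.componentTau hC hD)
  difference_toZero x := by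
    rw [Mor₂.precompZero_toZero]
    have h := difference_comp_toZero s.toZero_compat x ((Φ.comm (n + 1)).square x)
      ((Ψ.comm (n + 1)).square x) ((s.componentTau hC hD).appSum x)
    refine Eq.trans ?_ h
    rw [nextDifference_square]
    rfl
  difference_unit x := by
    refine Eq.trans ?_ (Φ.compat n x).symm
    have h1 := difference_comp_unit (D.d (n + 1)).functor
      ((Φ.comm (n + 1)).square ((C.d n).functor.obj x))
      ((Ψ.comm (n + 1)).square ((C.d n).functor.obj x))
      ((s.componentTau hC hD).appSum ((C.d n).functor.obj x))
      (s.toZero.toZero ((C.d n).functor.obj x))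
      ((s.component hC hD).functor.map ((C.α n).toZero x) ≫ η (s.component hC hD).functor)
      ((D.d (n + 1)).functor.map ((Ψ.comm n).square x) ≫
          (D.α n).toZero ((Ψ.f n).functor.obj x))
    have h2 := s.componentTau_spec hC hD x
    have h3 := s.difference_toZero x
    have h4 := Ψ.compat n x
    have h5 := nextDifference_square (Φ.comm (n + 1)) (Ψ.comm (n + 1)) s.toZero
      (s.componentTau hC hD) ((C.d n).functor.obj x)
    rw [h2, h3, ← h4] at h1
    rw [cokerCollapse] at h5
    refine Eq.trans ?_ h1
    rw [← h5, ← Mor₁.comp_toUnit]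
    exact congrArg (_ ≫ ·) (Mor₁.sum_toUnit _ _ _)

/-- The data for all the components of a homotopy. -/
noncomputable def iterate (s : HomotopyStage Φ Ψ 0) : ∀ n, HomotopyStage Φ Ψ n
  | 0 => s
  | n + 1 => (iterate s n).next hC hD

end HomotopyStage

theorem leftUnitor_inv_collapse {M N : Type*} [Category* M] [MonoidalCategory M]
    [Category* N] [MonoidalCategory N] (e : M ⥤ N) [e.Monoidal] {x : M} (k : e.obj x ⟶ 𝟙_ N) :
    e.map (λ_ x).inv ≫ δ e (𝟙_ M) x ≫ (η e ⊗ₘ k) ≫ (λ_ (𝟙_ N)).hom = k := by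
  rw [MonoidalCategory.tensorHom_def, Category.assoc, leftUnitor_naturality,
    Functor.OplaxMonoidal.left_unitality_hom_assoc, ← Functor.map_comp_assoc, Iso.inv_hom_id,
    CategoryTheory.Functor.map_id, Category.id_comp]

theorem toZero_tensorUnit {L M N : TwoModule.{w', w, u} R} {F : Mor₁ L M} {G : Mor₁ M N}
    (φ : Mor₂ (F.comp G) (Mor₁.zero L N)) :
    φ.toZero (𝟙_ L.carrier) = G.functor.map (η F.functor) ≫ η G.functor :=
  eq_η_of_ε_comp (F.comp G).functor φ.isMonoidal.unit

/-- The initial difference of two morphisms of complexes which agree in degree zero. -/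
noncomputable def initialDifference (Φ Ψ : Hom C D) (c : Mor₂ (Φ.f 0) (Ψ.f 0)) :
    Mor₂ ((C.d 0).comp (Φ.f 1)) ((C.d 0).comp ((Mor₁.zero (C.X 1) (D.X 1)).sum (Ψ.f 1))) :=
  (Φ.comm 0).vcomp ((c.whiskerR (D.d 0)).vcomp ((Ψ.comm 0).symm.vcomp
    (Mor₂.whiskerL (C.d 0) (Mor₂.sumZeroLeft (Ψ.f 1)).symm)))

theorem initialDifference_square (Φ Ψ : Hom C D) (c : Mor₂ (Φ.f 0) (Ψ.f 0))
    (x : (C.X 0).carrier) :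
    (initialDifference Φ Ψ c).squareSum x =
    (Φ.comm 0).square x ≫ (D.d 0).functor.map (c.nat.app x) ≫ inv ((Ψ.comm 0).square x) ≫
      (λ_ _).inv := by
  change _ ≫ _ ≫ _ ≫ inv (λ_ _).hom = _
  rw [IsIso.Iso.inv_hom]
  rfl

/-- The data for the component in degree zero of a homotopy. -/
noncomputable def HomotopyStage.initial (Φ Ψ : Hom C D) (c : Mor₂ (Φ.f 0) (Ψ.f 0)) :
    HomotopyStage Φ Ψ 0 where
  prev := Mor₁.zero (C.X 1) (D.X 1)
  toZero := Mor₂.zeroComp (C.X 1) (D.d 1)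
  toZero_compat _ := (toZero_tensorUnit (D.α 1)).symm
  difference := initialDifference Φ Ψ c
  difference_toZero x := by
    have h : ∀ {f f' g : (D.X 1).carrier} (s : f ⟶ f') (t : g ⟶ f')
        (k : (D.d 1).functor.obj f' ⟶ 𝟙_ (D.X 2).carrier),
        (D.d 1).functor.map (s ≫ inv t ≫ (λ_ g).inv) ≫ δ (D.d 1).functor (𝟙_ _) g ≫
          (η (D.d 1).functor ⊗ₘ ((D.d 1).functor.map t ≫ k)) ≫ (λ_ _).hom =
        (D.d 1).functor.map s ≫ k := by
      intro f f' g s t k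
      rw [Functor.map_comp, Functor.map_comp, Category.assoc, Category.assoc,
        leftUnitor_inv_collapse, Functor.map_inv, IsIso.inv_hom_id_assoc]
    have h1 := h ((Φ.comm 0).square x ≫ (D.d 0).functor.map (c.nat.app x))
      ((Ψ.comm 0).square x) ((D.α 0).toZero ((Ψ.f 0).functor.obj x))
    refine (Eq.trans ?_ h1).trans ?_
    · rw [initialDifference_square, Category.assoc]
      rfl
    · rw [Functor.map_comp, Category.assoc, toZero_naturality]
  difference_unit _ := (initialDifference Φ Ψ c).app_tensorUnit

end Homotopy

end CochainComplex₂

/-- The morphism of augmented complexes given by a morphism over `F`. -/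
def MorphismOver.toHom {A B : TwoModule.{w', w, u} R} {F : Mor₁ A B}
    {P : InjectiveResolution₂ A} {Q : InjectiveResolution₂ B} (Φ : MorphismOver F P Q) :
    CochainComplex₂.Hom (P.I.prepend P.L₀ P.α₀ P.compat₀) (Q.I.prepend Q.L₀ Q.α₀ Q.compat₀) where
  f
    | 0 => F
    | n + 1 => Φ.hom.f n
  comm
    | 0 => Φ.comm₀
    | n + 1 => Φ.hom.comm n
  compat
    | 0 => Φ.compat₀
    | n + 1 => Φ.hom.compat n

section

variable {A B : TwoModule.{w', w, u} R} {F : Mor₁ A B} {P : InjectiveResolution₂ A}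
  {Q : InjectiveResolution₂ B}

theorem comp_tensorHom_of_inv {C : Type u₁} [Category.{v₁} C] [MonoidalCategory C]
    {a b c x y z x' z' : C} {t : a ⟶ x ⊗ z} {k : x ⟶ y} {g : z ⟶ z'} [IsIso g] {p : a ⟶ b}
    {q : b ⟶ c} {r : c ⟶ x' ⊗ z'} {w : x' ⟶ y}
    (h : t ≫ (k ⊗ₘ 𝟙 z) = p ≫ q ≫ r ≫ (w ⊗ₘ inv g)) :
    t ≫ (k ⊗ₘ g) = p ≫ q ≫ r ≫ (w ⊗ₘ 𝟙 z') := by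
  have h1 : (k ⊗ₘ g) = (k ⊗ₘ 𝟙 z) ≫ (𝟙 y ⊗ₘ g) := by
    rw [tensorHom_comp_tensorHom, Category.comp_id, Category.id_comp]
  rw [h1, reassoc_of% h, tensorHom_comp_tensorHom, IsIso.inv_hom_id, Category.comp_id]

/-- The data for the components of the homotopy between two morphisms over `F`. -/
noncomputable def homotopyStage (Φ Ψ : MorphismOver F P Q) (n : ℕ) :
    CochainComplex₂.HomotopyStage Φ.toHom Ψ.toHom n :=
  (CochainComplex₂.HomotopyStage.initial Φ.toHom Ψ.toHom (Mor₂.id F)).iterate P.exact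
    Q.injective n

/-- Two morphisms over `F` are homotopic. -/
noncomputable def homotopyOver (Φ Ψ : MorphismOver F P Q) :
    CochainComplex₂.Homotopy Φ.hom Ψ.hom where
  H n := (homotopyStage Φ Ψ n).component P.exact Q.injective
  τ
    | 0 => (homotopyStage Φ Ψ 0).componentTau P.exact Q.injective
    | n + 1 => (homotopyStage Φ Ψ (n + 1)).componentTau P.exact Q.injective
  compat n x := by
    have h1 := (homotopyStage Φ Ψ (n + 1)).componentTau_spec P.exact Q.injective x
    have h2 := CochainComplex₂.nextDifference_square (Φ.hom.comm n) (Ψ.hom.comm n)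
      (homotopyStage Φ Ψ n).toZero ((homotopyStage Φ Ψ n).componentTau P.exact Q.injective) x
    cases n with
    | zero => exact comp_tensorHom_of_inv (h1.trans h2)
    | succ n =>
      have h3 : cokerCollapse (homotopyStage Φ Ψ (n + 1)).toZero x
          (((homotopyStage Φ Ψ (n + 1)).component P.exact Q.injective).functor.obj
            ((P.I.d (n + 1)).functor.obj x)) =
          δ (Q.I.d (n + 1)).functor _ _ ≫ (Q.I.α n).toZero
            (((homotopyStage Φ Ψ n).component P.exact Q.injective).functor.obj x) ▷ _ ≫
              (λ_ _).hom :=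
        congrArg (fun k => δ (Q.I.d (n + 1)).functor _ _ ≫ k ▷ _ ≫ (λ_ _).hom)
          (Mor₂.precompZero_toZero _ _ x)
      exact comp_tensorHom_of_inv ((h1.trans h2).trans
        (congrArg (fun k => _ ≫ _ ≫ _ ≫ (k ⊗ₘ _)) h3))

/-- The initial part, with `F` in degree two, of a morphism of the complexes extended by zero. -/
noncomputable def initialPartialHom (F : Mor₁ A B) (P : InjectiveResolution₂ A)
    (Q : InjectiveResolution₂ B) : CochainComplex₂.PartialHom
      (P.I.prepend P.L₀ P.α₀ P.compat₀).prependZero.prependZero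
      (Q.I.prepend Q.L₀ Q.α₀ Q.compat₀).prependZero.prependZero 0 where
  f₀ := Mor₁.zero _ _
  f₁ := Mor₁.zero _ _
  f₂ := F
  c₀ := (Mor₂.zeroComp _ (Mor₁.zero (TwoModule.zero R) (TwoModule.zero R))).vcomp
    (Mor₂.zeroComp _ (Mor₁.zero (TwoModule.zero R) (TwoModule.zero R))).symm
  c₁ := (Mor₂.zeroComp _ F).vcomp (Mor₂.zeroComp _ (Mor₁.zero (TwoModule.zero R) B)).symm
  compat x := by
    change F.functor.map (𝟙 (𝟙_ A.carrier)) ≫ η F.functor =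
      (η F.functor ≫ inv (𝟙 (𝟙_ B.carrier))) ≫ 𝟙 (𝟙_ B.carrier) ≫ 𝟙 (𝟙_ B.carrier)
    simp

/-- The morphism over `F` given by injectivity. -/
noncomputable def morphismOver (F : Mor₁ A B) (P : InjectiveResolution₂ A)
    (Q : InjectiveResolution₂ B) : MorphismOver F P Q :=
  let Φ := (initialPartialHom F P Q).toHom P.exact Q.injective
  { hom :=
      { f := fun n => Φ.f (n + 3)
        comm := fun n => Φ.comm (n + 3)
        compat := fun n => Φ.compat (n + 3) }
    comm₀ := Φ.comm 2
    compat₀ := Φ.compat 2 }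

end

end Complexes

theorem theorem1 {R : Type w} [Category.{w'} R] [MonoidalCategory R] [SymmetricCategory R]
    [IsTwoGroup R] [TwoRing R] {A B : TwoModule.{w', w, u} R}
    (P : InjectiveResolution₂ A) (F : Mor₁ A B) (Q : InjectiveResolution₂ B) :
    Nonempty (MorphismOver F P Q) ∧
      ∀ Φ Ψ : MorphismOver F P Q, Nonempty (CochainComplex₂.Homotopy Φ.hom Ψ.hom) :=
  ⟨⟨morphismOver F P Q⟩, fun Φ Ψ => ⟨homotopyOver Φ Ψ⟩⟩
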